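/- All graphs are finite, simple and undirected. A nonempty set $S\subseteq V(G)$ is a \emph{defensive alliance} in $G$ if $|N[v]\cap S|\ge |N(v)\setminus S|$ for every $v\in S$; it is a \emph{locally minimal} defensive alliance if, in addition, for no $v\in S$ the set $S\setminus\{v\}$ is a defensive alliance. A tree decomposition $(T,\{X_t\}_{t\in V(T)})$ of $G$, with $T$ rooted at $r$, is \emph{nice} if $X_r=\emptyset$ and every node $t$ is either a leaf with $X_t=\emptyset$, or an introduce node (one child $s$, $X_t=X_s\cup\{v\}$ with $v\notin X_s$), or a forget node (one child $s$, $X_t=X_s\setminus\{v\}$ with $v\in X_s$), or a join node (two children $s_1,s_2$, $X_t=X_{s_1}=X_{s_2}$). Its width is $\max_t|X_t|-1$. \textbf{Theorem.} There is an algorithm (a program for the random access machine with unit-cost addition and truncated subtraction of natural numbers) which, given a graph $G$ with $n\ge 1$ vertices and a nice tree decomposition $(T,\{X_t\})$ of $G$ with $n^{O(1)}$ nodes, computes the maximum size of a locally minimal defensive alliance of $G$ (in particular, one exists) in time $8^k\, n^{O(2^{k+1})}$, for every integer $k\ge 0$ that is at least the width of the decomposition. Precisely: there is one program $P$ such that for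 every $c\in\mathbb N$ there is $C\in\mathbb N$ such that, for all $n\ge 1$, $k\ge 0$, every $n$-vertex graph $G$ and every nice tree decomposition of $G$ with width at most $k$ and at most $c\,n^c$ nodes, $P$ halts on this input within $C\cdot 8^k\cdot n^{C\cdot 2^{k+1}}$ steps and outputs the maximum size of a locally minimal defensive alliance of $G$. The graph is given by its adjacency matrix, and the decomposition by its root, its parent-child matrix and the node-vertex incidence matrix of its bags. -/

import Mathlib

/-! ## Defensive alliances -/

section Alliance

variable {V : Type*}

/-- A nonempty set `S` of vertices is a defensive alliance if `|N(v) \ S| ≤ |N[v] ∩ S|` for every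
`v ∈ S`. -/
def IsDefensiveAlliance (G : SimpleGraph V) (S : Finset V) : Prop :=
  S.Nonempty ∧ ∀ v ∈ S,
    (G.neighborSet v \ (S : Set V)).ncard ≤ (insert v (G.neighborSet v) ∩ (S : Set V)).ncard

/-- A defensive alliance that stops being one whenever a single vertex is removed. -/
def IsLocallyMinimalDefensiveAlliance [DecidableEq V] (G : SimpleGraph V) (S : Finset V) : Prop :=
  IsDefensiveAlliance G S ∧ ∀ v ∈ S, ¬ IsDefensiveAlliance G (S.erase v)

end Alliance

/-! ## Nice tree decompositions -/

section TreeDecomposition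

variable {V ι : Type*}

/-- `(T, X)` is a tree decomposition of `G`, where `X t` is the bag of the node `t` of `T`. -/
structure IsTreeDecomposition (G : SimpleGraph V) (T : SimpleGraph ι) (X : ι → Finset V) :
    Prop where
  isTree : T.IsTree
  vertex_mem : ∀ v, ∃ t, v ∈ X t
  edge_mem : ∀ u v, G.Adj u v → ∃ t, u ∈ X t ∧ v ∈ X t
  connected : ∀ v, (T.induce {t | v ∈ X t}).Connected

/-- In the tree `T` rooted at `r`, the node `s` is a child of the node `t`. -/
def IsChild (T : SimpleGraph ι) (r t s : ι) : Prop :=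
  T.Adj t s ∧ T.dist r s = T.dist r t + 1

/-- A tree decomposition rooted at `r` is nice if the root has an empty bag and every node is a
leaf node (with empty bag), an introduce node, a forget node or a join node. -/
structure IsNiceTreeDecomposition [DecidableEq V] (G : SimpleGraph V) (T : SimpleGraph ι) (r : ι)
    (X : ι → Finset V) : Prop extends IsTreeDecomposition G T X where
  root_bag : X r = ∅
  node : ∀ t,
    ({s | IsChild T r t s} = ∅ ∧ X t = ∅) ∨
    (∃ s v, {s | IsChild T r t s} = {s} ∧ v ∉ X s ∧ X t = insert v (X s)) ∨
    (∃ s v, {s | IsChild T r t s} = {s} ∧ v ∈ X s ∧ X t = (X s).erase v) ∨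
    (∃ s₁ s₂, s₁ ≠ s₂ ∧ {s | IsChild T r t s} = {s₁, s₂} ∧ X t = X s₁ ∧ X t = X s₂)

/-- The width of a tree decomposition: the maximum size of a bag, minus one. -/
def bagWidth [Fintype ι] (X : ι → Finset V) : ℕ :=
  (Finset.univ.sup fun t => (X t).card) - 1

end TreeDecomposition

/-! ## Random access machines with unit costs -/

namespace RAM

/-- Programs of a random access machine. The machine has registers, which a program addresses by
constants, and a memory, which it addresses through the contents of registers. All of them hold
natural numbers; the only arithmetic is addition and truncated subtraction. -/
inductive Program : Type
  | skip
  | const (i a : ℕ)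
  | add (i j l : ℕ)
  | sub (i j l : ℕ)
  | load (i j : ℕ)
  | store (i j : ℕ)
  | seq (p q : Program)
  | ifNonzero (i : ℕ) (p q : Program)
  | whileNonzero (i : ℕ) (p : Program)

/-- Contents of the registers and of the memory. -/
structure State where
  reg : ℕ → ℕ
  mem : ℕ → ℕ

/-- `s.setReg i a` writes the number `a` to register `i`. -/
def State.setReg (s : State) (i a : ℕ) : State :=
  { s with reg := Function.update s.reg i a }

/-- `s.setMem i a` writes the number `a` to the memory cell with address `i`. -/
def State.setMem (s : State) (i a : ℕ) : State :=
  { s with mem := Function.update s.mem i a }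

/-- `Exec p s t s'`: started in the state `s`, the program `p` halts after `t` steps in the state
`s'`. Every elementary instruction and every evaluation of a test is one step. -/
inductive Exec : Program → State → ℕ → State → Prop
  | skip (s : State) : Exec .skip s 1 s
  | const (s : State) (i a : ℕ) : Exec (.const i a) s 1 (s.setReg i a)
  | add (s : State) (i j l : ℕ) : Exec (.add i j l) s 1 (s.setReg i (s.reg j + s.reg l))
  | sub (s : State) (i j l : ℕ) : Exec (.sub i j l) s 1 (s.setReg i (s.reg j - s.reg l))
  | load (s : State) (i j : ℕ) : Exec (.load i j) s 1 (s.setReg i (s.mem (s.reg j)))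
  | store (s : State) (i j : ℕ) : Exec (.store i j) s 1 (s.setMem (s.reg i) (s.reg j))
  | seq {p q : Program} {s s₁ s₂ : State} {t₁ t₂ : ℕ} (hp : Exec p s t₁ s₁)
      (hq : Exec q s₁ t₂ s₂) : Exec (.seq p q) s (t₁ + t₂) s₂
  | if_true {i : ℕ} {p q : Program} {s s' : State} {t : ℕ} (hi : s.reg i ≠ 0)
      (hp : Exec p s t s') : Exec (.ifNonzero i p q) s (1 + t) s'
  | if_false {i : ℕ} {p q : Program} {s s' : State} {t : ℕ} (hi : s.reg i = 0)
      (hq : Exec q s t s') : Exec (.ifNonzero i p q) s (1 + t) s'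
  | while_true {i : ℕ} {p : Program} {s s₁ s₂ : State} {t₁ t₂ : ℕ} (hi : s.reg i ≠ 0)
      (hp : Exec p s t₁ s₁) (hw : Exec (.whileNonzero i p) s₁ t₂ s₂) :
      Exec (.whileNonzero i p) s (1 + t₁ + t₂) s₂
  | while_false {i : ℕ} {p : Program} {s : State} (hi : s.reg i = 0) :
      Exec (.whileNonzero i p) s 1 s

/-- The initial state on an input word: the word stands at the start of the memory, and everything
else is zero. -/
def initial (w : List ℕ) : State where
  reg := fun _ => 0
  mem := fun a => w.getD a 0

/-- On the input word `w`, the program `p` halts after `t` steps with the number `m` in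
register `0`. -/
def Outputs (p : Program) (w : List ℕ) (t m : ℕ) : Prop :=
  ∃ s, Exec p (initial w) t s ∧ s.reg 0 = m

end RAM

/-! ## The input of the algorithm -/

open Classical in
/-- The `0/1` matrix of a relation, row by row. -/
noncomputable def relationMatrix {m n : ℕ} (R : Fin m → Fin n → Prop) : List ℕ :=
  List.ofFn fun p : Fin (m * n) => if R p.divNat p.modNat then 1 else 0

/-- The input word for a graph with a rooted tree decomposition: the number of vertices, the
number of nodes, the root, the adjacency matrix of the graph, the parent-child matrix of the rooted
tree, and the node-vertex incidence matrix of the bags. -/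
noncomputable def inputWord {n N : ℕ} (G : SimpleGraph (Fin n)) (T : SimpleGraph (Fin N))
    (r : Fin N) (X : Fin N → Finset (Fin n)) : List ℕ :=
  [n, N, (r : ℕ)] ++ relationMatrix G.Adj ++ relationMatrix (IsChild T r) ++
    relationMatrix fun t v => v ∈ X t

/-! Let `a` be the number of neighbours of `v` in `S`. Then `S` is a defensive alliance iff it is
nonempty and every `v ∈ S` has degree at most `2a + 1`. Call `v ∈ S` marginal if `2a ≤ deg v`.
Deleting a vertex affects only its neighbours, and it destroys the condition at a neighbour in `S`
exactly when that neighbour is marginal. So a defensive alliance with at least two vertices is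
locally minimal iff each member has a marginal neighbour in `S` (`of_marginal`, `exists_marginal`).
This is a local condition on a class function `σ` with values `0`, `1`, `2`, where class `2` asserts
marginality (`Good`). Singletons escape this description. But a defensive alliance of least size is
locally minimal, so if nothing larger is found the maximum is `1`.

Class functions satisfying the local condition everywhere are found by dynamic programming. For a
node `t` whose children with index below `j` have been treated, a record stores the classes of the
vertices in the bag, their numbers of forgotten neighbours of class at least `1` and of class at
least `2`, and the number of forgotten members. Children are treated one at a time, so a single
transition rule covers all kinds of nodes. A vertex is checked when it is forgotten, since by the
separation property all its neighbours are then in the bag or already forgotten (`nb_top`).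
Soundness glues the class functions of two records along the common part of their bags
(`describes_step`); completeness derives the records of a given class function (`record_mem_table`).
No traversal order is computed: all candidates are filtered `N * (N + 1)` times.

A bag with `m` vertices has `(3 (n + 1)²) ^ m` states, and everything else is polynomial in this
number and in the size of the input. As `m ≤ k + 1 ≤ 2 ^ (k + 1)`, the claimed bound follows
(`stateBound_le`).

To obtain an actual program, `PolyOn` expresses that a function on heap-coded data is computed
within a polynomial bound. It is closed under composition, pairing, case distinction and bounded
iteration. The heap is never overwritten below the free pointer, so stored data behave like values
of a functional language. The one step not polynomial in its input is the enumeration of states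
(`PolyOn.sections`), whose domain therefore bounds the size of the output. -/

namespace RAM

/-! ## Running programs -/

/-- The program `p` halts when started in `s`, and its running time and final state satisfy `Q`. -/
def Run (p : Program) (s : State) (Q : ℕ → State → Prop) : Prop :=
  ∃ t s', Exec p s t s' ∧ Q t s'

section Run

variable {p q : Program} {s : State} {Q R : ℕ → State → Prop}

theorem Run.imp (h : Run p s Q) (hQ : ∀ t s', Q t s' → R t s') : Run p s R := by
  obtain ⟨t, s', he, hq⟩ := h
  exact ⟨t, s', he, hQ _ _ hq⟩

theorem run_skip (h : Q 1 s) : Run .skip s Q := ⟨_, _, .skip s, h⟩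

theorem run_const {i a : ℕ} (h : Q 1 (s.setReg i a)) : Run (.const i a) s Q :=
  ⟨_, _, .const s i a, h⟩

theorem run_add {i j l : ℕ} (h : Q 1 (s.setReg i (s.reg j + s.reg l))) : Run (.add i j l) s Q :=
  ⟨_, _, .add s i j l, h⟩

theorem run_sub {i j l : ℕ} (h : Q 1 (s.setReg i (s.reg j - s.reg l))) : Run (.sub i j l) s Q :=
  ⟨_, _, .sub s i j l, h⟩

theorem run_load {i j : ℕ} (h : Q 1 (s.setReg i (s.mem (s.reg j)))) : Run (.load i j) s Q :=
  ⟨_, _, .load s i j, h⟩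

theorem run_store {i j : ℕ} (h : Q 1 (s.setMem (s.reg i) (s.reg j))) : Run (.store i j) s Q :=
  ⟨_, _, .store s i j, h⟩

theorem run_seq (h : Run p s fun t₁ s₁ => Run q s₁ fun t₂ s₂ => Q (t₁ + t₂) s₂) :
    Run (.seq p q) s Q := by
  obtain ⟨t₁, s₁, h₁, t₂, s₂, h₂, hQ⟩ := h
  exact ⟨_, _, .seq h₁ h₂, hQ⟩

/-- A loop whose counter is tracked by an invariant indexed by the number of remaining rounds. -/
theorem run_while {i : ℕ} {I : ℕ → State → Prop} {T : ℕ → Prop}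
    (hI : ∀ k s, I k s → (s.reg i = 0 ↔ k = 0))
    (hp : ∀ k s, I (k + 1) s → Run p s fun t s' => (∀ c, T c → t ≤ c) ∧ I k s') (k : ℕ) :
    ∀ s, I k s →
      Run (.whileNonzero i p) s fun t s' => (∀ c, T c → t ≤ k * (c + 1) + 1) ∧ I 0 s' := by
  induction k with
  | zero => exact fun s hs => ⟨_, _, .while_false ((hI 0 s hs).2 rfl), by simp, hs⟩
  | succ k ih =>
    intro s hs
    obtain ⟨t₁, s₁, h₁, ht₁, hs₁⟩ := hp k s hs
    obtain ⟨t₂, s₂, h₂, ht₂, hs₂⟩ := ih s₁ hs₁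
    refine ⟨_, _, .while_true (fun h => by simpa using (hI _ s hs).1 h) h₁ h₂, fun c hc => ?_, hs₂⟩
    have := ht₁ c hc
    have := ht₂ c hc
    rw [Nat.succ_mul]
    omega

theorem State.reg_setReg (s : State) (i a j : ℕ) :
    (s.setReg i a).reg j = if j = i then a else s.reg j := by
  simp [State.setReg, Function.update_apply]

theorem State.mem_setMem (s : State) (i a j : ℕ) :
    (s.setMem i a).mem j = if j = i then a else s.mem j := by
  simp [State.setMem, Function.update_apply]

@[simp] theorem State.mem_setReg (s : State) (i a : ℕ) : (s.setReg i a).mem = s.mem := rfl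

@[simp] theorem State.reg_setMem (s : State) (i a : ℕ) : (s.setMem i a).reg = s.reg := rfl

/-- Copy register `j` to the register `i ≠ j`. -/
def mov (i j : ℕ) : Program := .seq (.const i 0) (.add i j i)

/-- Register `i` is zeroed before `j` is read, hence `i ≠ j`. -/
theorem run_mov {i j : ℕ} (hij : i ≠ j) (h : Q 2 (s.setReg i (s.reg j))) :
    Run (mov i j) s Q := by
  refine run_seq (run_const (run_add ?_))
  have : ((s.setReg i 0).setReg i ((s.setReg i 0).reg j + (s.setReg i 0).reg i))
      = s.setReg i (s.reg j) := by
    simp [State.setReg, Function.update_of_ne hij.symm]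
  rw [this]
  exact h

end Run

/-- From `s` to `s'`, the free pointer in register `0` has not decreased, the heap below it and the
registers below `d` have been kept. -/
structure Ext (d : ℕ) (s s' : State) : Prop where
  reg : ∀ i, 0 < i → i < d → s'.reg i = s.reg i
  free : s.reg 0 ≤ s'.reg 0
  mem : ∀ x < s.reg 0, s'.mem x = s.mem x

theorem Ext.refl (d : ℕ) (s : State) : Ext d s s := ⟨fun _ _ _ => rfl, le_rfl, fun _ _ => rfl⟩

theorem Ext.trans {d : ℕ} {s₁ s₂ s₃ : State} (h : Ext d s₁ s₂) (h' : Ext d s₂ s₃) : Ext d s₁ s₃ :=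
  ⟨fun i hi hd => (h'.reg i hi hd).trans (h.reg i hi hd), h.free.trans h'.free,
    fun x hx => (h'.mem x (hx.trans_le h.free)).trans (h.mem x hx)⟩

theorem Ext.mono {d e : ℕ} {s s' : State} (h : Ext e s s') (hd : d ≤ e) : Ext d s s' :=
  ⟨fun i hi hid => h.reg i hi (hid.trans_le hd), h.free, h.mem⟩

theorem Ext.setReg {d i : ℕ} (s : State) (a : ℕ) (hd : d ≤ i) (hi : 0 < i) :
    Ext d s (s.setReg i a) := by
  refine ⟨fun j _ hj => ?_, ?_, fun _ _ => rfl⟩ <;> rw [State.reg_setReg, if_neg (by omega)]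

/-- Allocate a cell with the contents of the registers `d` and `d + 1`, and put its address into
register `d`. -/
def allocPair (d : ℕ) : Program :=
  .seq (.store 0 d) <| .seq (.const (d + 2) 1) <| .seq (.add 0 0 (d + 2)) <|
    .seq (.store 0 (d + 1)) <| .seq (.add 0 0 (d + 2)) <| .seq (.const (d + 3) 2)
      (.sub d 0 (d + 3))

theorem run_allocPair {d : ℕ} (hd : 0 < d) (s : State) :
    Run (allocPair d) s fun t s' => t = 7 ∧ Ext d s s' ∧ s'.reg d = s.reg 0 ∧
      s'.reg 0 = s.reg 0 + 2 ∧ s'.mem (s.reg 0) = s.reg d ∧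
      s'.mem (s.reg 0 + 1) = s.reg (d + 1) := by
  have h0 : d ≠ 0 := by omega
  have h0' : 0 ≠ d := by omega
  refine run_seq (run_store (run_seq (run_const (run_seq (run_add (run_seq (run_store
    (run_seq (run_add (run_seq (run_const (run_sub ?_))))))))))))
  refine ⟨rfl, ⟨fun i hi hid => ?_, ?_, fun x hx => ?_⟩, ?_, ?_, ?_, ?_⟩ <;>
    simp [State.reg_setReg, State.mem_setMem, h0, h0']
  · repeat rw [if_neg (by omega)]
  · omega
  · repeat rw [if_neg (by omega)]

end RAM

/-! ## Polynomial bounds -/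

/-- A function that is bounded by a polynomial. -/
def PolyBound (p : ℕ → ℕ) : Prop := ∃ C, ∀ B, p B ≤ (B + 2) ^ C

namespace PolyBound

variable {p q : ℕ → ℕ}

theorem id : PolyBound fun B => B := ⟨1, fun B => by simp⟩

/-- The base `B + 2` is at least `2`, so a power of it absorbs any constant, even for `B = 0`. -/
theorem const (c : ℕ) : PolyBound fun _ => c :=
  ⟨c, fun B => (Nat.lt_two_pow_self (n := c)).le.trans (Nat.pow_le_pow_left (by omega) c)⟩

theorem mul (hp : PolyBound p) (hq : PolyBound q) : PolyBound fun B => p B * q B := by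
  obtain ⟨C, hC⟩ := hp
  obtain ⟨E, hE⟩ := hq
  exact ⟨C + E, fun B => by rw [pow_add]; exact Nat.mul_le_mul (hC B) (hE B)⟩

theorem add (hp : PolyBound p) (hq : PolyBound q) : PolyBound fun B => p B + q B := by
  obtain ⟨C, hC⟩ := hp
  obtain ⟨E, hE⟩ := hq
  refine ⟨max C E + 1, fun B => ?_⟩
  have h₁ := (hC B).trans (Nat.pow_le_pow_right (by omega) (le_max_left C E))
  have h₂ := (hE B).trans (Nat.pow_le_pow_right (by omega) (le_max_right C E))
  rw [pow_succ]
  nlinarith [Nat.zero_le ((B + 2) ^ max C E)]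

theorem comp (hp : PolyBound p) (hq : PolyBound q) : PolyBound fun B => p (q B) := by
  obtain ⟨C, hC⟩ := hp
  obtain ⟨E, hE⟩ := hq
  -- Two extra factors `B + 2` multiply by at least `4`, which absorbs the summand in `q B + 2 ≤ (B
  -- + 2) ^ (E + 2)`.
  refine ⟨(E + 2) * C, fun B => (hC _).trans ?_⟩
  rw [pow_mul]
  refine Nat.pow_le_pow_left ?_ C
  have h1 : 1 ≤ (B + 2) ^ E := Nat.one_le_pow _ _ (by omega)
  rw [pow_add, pow_two]
  have h4 : 2 * 2 ≤ (B + 2) * (B + 2) := Nat.mul_le_mul (by omega) (by omega)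
  have := Nat.mul_le_mul_left ((B + 2) ^ E) h4
  have := hE B
  omega

end PolyBound

/-! ## Representation of data on the heap -/

/-- Data that can be stored on the heap of a random access machine. `Stored mem free v a` says that
the number `v` represents `a`, all cells it refers to being below the address `free`, and
`Bdd B a` that all numbers in `a`, and the lengths of all lists in `a`, are at most `B`. -/
class Code (α : Type) where
  Stored : (ℕ → ℕ) → ℕ → ℕ → α → Prop
  Bdd : ℕ → α → Prop
  rep_mono : ∀ {mem mem' : ℕ → ℕ} {free free' v : ℕ} {a : α}, (∀ x < free, mem' x = mem x) →
    free ≤ free' → Stored mem free v a → Stored mem' free' v a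
  bdd_mono : ∀ {B B' : ℕ} {a : α}, B ≤ B' → Bdd B a → Bdd B' a

namespace Code

instance : Code ℕ where
  Stored _ _ v a := v = a
  Bdd B a := a ≤ B
  rep_mono _ _ h := h
  bdd_mono h h' := h'.trans h

instance : Code Bool where
  Stored _ _ v a := v = a.toNat
  Bdd _ _ := True
  rep_mono _ _ h := h
  bdd_mono _ h := h

variable {α β : Type} [Code α] [Code β]

/-- Address `0` is excluded because it codes the empty list. Thus a pair `(a, l)` and a list `a ::
l` have the same representation. -/
instance : Code (α × β) where
  Stored mem free v a :=
    v ≠ 0 ∧ v + 1 < free ∧ Stored mem free (mem v) a.1 ∧ Stored mem free (mem (v + 1)) a.2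
  Bdd B a := Bdd B a.1 ∧ Bdd B a.2
  rep_mono h hf := fun ⟨h0, h1, h2, h3⟩ => ⟨h0, h1.trans_le hf, by
    rw [h _ (by omega)]; exact rep_mono h hf h2, by rw [h _ h1]; exact rep_mono h hf h3⟩
  bdd_mono h h' := ⟨bdd_mono h h'.1, bdd_mono h h'.2⟩

/-- Representation of a list by linked cells. -/
def ListStored (mem : ℕ → ℕ) (free : ℕ) : ℕ → List α → Prop
  | v, [] => v = 0
  | v, a :: l =>
    v ≠ 0 ∧ v + 1 < free ∧ Stored mem free (mem v) a ∧ ListStored mem free (mem (v + 1)) l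

theorem ListStored.mono {mem mem' : ℕ → ℕ} {free free' : ℕ} (h : ∀ x < free, mem' x = mem x)
    (hf : free ≤ free') : ∀ {v : ℕ} {l : List α},
      ListStored mem free v l → ListStored mem' free' v l
  | _, [], hl => hl
  | _, _ :: _, ⟨h0, h1, h2, h3⟩ => ⟨h0, h1.trans_le hf, by
      rw [h _ (by omega)]; exact rep_mono h hf h2, by rw [h _ h1]; exact h3.mono h hf⟩

instance : Code (List α) where
  Stored mem free v l := ListStored mem free v l
  Bdd B l := l.length ≤ B ∧ ∀ a ∈ l, Bdd B a
  rep_mono h hf h' := h'.mono h hf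
  bdd_mono h h' := ⟨h'.1.trans h, fun a ha => bdd_mono h (h'.2 a ha)⟩

@[simp] theorem bdd_nat {B a : ℕ} : Bdd B a ↔ a ≤ B := Iff.rfl

/-- The state `s` holds a representation of `a` in register `d`. -/
def Holds (s : RAM.State) (d : ℕ) (a : α) : Prop := Stored s.mem (s.reg 0) (s.reg d) a

/-- All cells reachable from a stored datum lie below the old free pointer, hence survive any later
computation. -/
theorem Holds.ext {s s' : RAM.State} {d e : ℕ} {a : α} (h : Holds s d a) (hs : RAM.Ext e s s')
    {d' : ℕ} (hd : s'.reg d' = s.reg d) : Holds s' d' a := by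
  unfold Holds
  rw [hd]
  exact rep_mono hs.mem hs.free h

end Code

open Code RAM

/-! ## Functions computed in polynomial time -/

section PolyOn

variable {α β γ : Type} [Code α] [Code β] [Code γ] {D : ℕ → α → Prop}

/-- The function `f` is computed by a program that works above an arbitrary register `d`, which
contains the argument and later the value; on arguments with `D B a`, the running time and the
value are bounded by a polynomial in `B`. -/
def PolyOn (D : ℕ → α → Prop) (f : α → β) : Prop :=
  ∃ p, PolyBound p ∧ (∀ B a, D B a → Bdd (p B) (f a)) ∧
    ∀ d, 0 < d → ∃ P, ∀ s a, 0 < s.reg 0 → Holds s d a →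
      Run P s fun t s' => (∀ B, D B a → t ≤ p B) ∧ Ext d s s' ∧ Holds s' d (f a)

/-- The function `f` is computed in polynomial time. -/
abbrev PolyTime (f : α → β) : Prop := PolyOn Bdd f

/-- `PolyOn` uses one polynomial for time and size; two separate bounds are merged into their sum.
-/
theorem polyOn_of_run {f : α → β} {p q : ℕ → ℕ} (hp : PolyBound p) (hq : PolyBound q)
    (hf : ∀ B a, D B a → Bdd (p B) (f a))
    (h : ∀ d, 0 < d → ∃ P, ∀ s a, 0 < s.reg 0 → Holds s d a →
      Run P s fun t s' => (∀ B, D B a → t ≤ q B) ∧ Ext d s s' ∧ Holds s' d (f a)) :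
    PolyOn D f := by
  refine ⟨fun B => p B + q B, hp.add hq, fun B a ha => bdd_mono (Nat.le_add_right _ _) (hf B a ha),
    fun d hd => ?_⟩
  obtain ⟨P, hP⟩ := h d hd
  exact ⟨P, fun s a h0 hs => (hP s a h0 hs).imp fun t s' ⟨h1, h2⟩ =>
    ⟨fun B hB => (h1 B hB).trans (Nat.le_add_left _ _), h2⟩⟩

theorem PolyOn.mono {E : ℕ → α → Prop} {f : α → β} (hf : PolyOn D f)
    (h : ∃ q, PolyBound q ∧ ∀ B a, E B a → D (q B) a) : PolyOn E f := by
  obtain ⟨p, hp, hb, hP⟩ := hf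
  obtain ⟨q, hq, hE⟩ := h
  refine ⟨fun B => p (q B), hp.comp hq, fun B a ha => hb _ _ (hE B a ha), fun d hd => ?_⟩
  obtain ⟨P, hP⟩ := hP d hd
  exact ⟨P, fun s a h0 hs => (hP s a h0 hs).imp fun t s' ⟨h1, h2⟩ =>
    ⟨fun B hB => h1 _ (hE B a hB), h2⟩⟩

theorem PolyOn.comp {E : ℕ → β → Prop} {g : β → γ} {f : α → β} (hg : PolyOn E g)
    (hf : PolyOn D f) (h : ∃ q, PolyBound q ∧ ∀ B a, D B a → E (q B) (f a)) :
    PolyOn D fun a => g (f a) := by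
  obtain ⟨p, hp, -, hP⟩ := hf
  obtain ⟨r, hr, hrb, hR⟩ := hg
  obtain ⟨q, hq, hE⟩ := h
  refine polyOn_of_run (hr.comp hq) (hp.add (hr.comp hq)) (fun B a ha => hrb _ _ (hE B a ha))
    fun d hd => ?_
  obtain ⟨P, hP⟩ := hP d hd
  obtain ⟨R, hR⟩ := hR d hd
  refine ⟨.seq P R, fun s a h0 hs => run_seq ?_⟩
  refine (hP s a h0 hs).imp fun t₁ s₁ ⟨ht₁, he₁, hs₁⟩ => ?_
  refine (hR s₁ _ (h0.trans_le he₁.free) hs₁).imp fun t₂ s₂ ⟨ht₂, he₂, hs₂⟩ => ?_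
  exact ⟨fun B hB => Nat.add_le_add (ht₁ B hB) (ht₂ _ (hE B a hB)), he₁.trans he₂, hs₂⟩

/-- The size bound contained in `PolyOn` is exactly the side condition of `PolyOn.comp`. -/
theorem PolyTime.comp {g : β → γ} {f : α → β} (hg : PolyTime g) (hf : PolyOn D f) :
    PolyOn D fun a => g (f a) := by
  obtain ⟨p, hp, hb, hP⟩ := hf
  exact PolyOn.comp hg ⟨p, hp, hb, hP⟩ ⟨p, hp, hb⟩

theorem PolyTime.id : PolyTime fun a : α => a := by
  refine polyOn_of_run .id (.const 1) (fun _ _ h => h) fun d hd => ⟨.skip, fun s a _ hs => ?_⟩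
  exact run_skip ⟨fun _ _ => le_rfl, .refl _ _, hs⟩

theorem PolyOn.id_of (h : ∀ B a, D B a → Bdd B a) : PolyOn D fun a : α => a :=
  PolyTime.id.mono ⟨_, .id, h⟩

theorem PolyOn.const_nat (c : ℕ) : PolyOn D fun _ => c := by
  refine polyOn_of_run (.const c) (.const 1) (fun _ _ _ => le_rfl)
    fun d hd => ⟨.const d c, fun s a _ hs => ?_⟩
  refine run_const ⟨fun _ _ => le_rfl, .setReg _ _ le_rfl hd, ?_⟩
  simp [Holds, Stored, State.reg_setReg]

theorem PolyOn.const_bool (c : Bool) : PolyOn D fun _ => c := by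
  refine polyOn_of_run (.const 0) (.const 1) (fun _ _ _ => trivial)
    fun d hd => ⟨.const d c.toNat, fun s a _ hs => ?_⟩
  refine run_const ⟨fun _ _ => le_rfl, .setReg _ _ le_rfl hd, ?_⟩
  simp [Holds, Stored, State.reg_setReg]

theorem PolyOn.nil : PolyOn D fun _ => ([] : List β) := by
  refine polyOn_of_run (.const 0) (.const 1) (fun _ _ _ => ⟨le_rfl, by simp⟩)
    fun d hd => ⟨.const d 0, fun s a _ hs => ?_⟩
  refine run_const ⟨fun _ _ => le_rfl, .setReg _ _ le_rfl hd, ?_⟩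
  simp [Holds, Stored, ListStored, State.reg_setReg]

theorem polyTime_fst : PolyTime (Prod.fst : α × β → α) := by
  refine polyOn_of_run .id (.const 1) (fun _ _ h => h.1)
    fun d hd => ⟨.load d d, fun s a _ hs => ?_⟩
  refine run_load ⟨fun _ _ => le_rfl, .setReg _ _ le_rfl hd, ?_⟩
  have := hs.2.2.1
  simpa [Holds, State.reg_setReg, hd.ne] using this

theorem polyTime_snd : PolyTime (Prod.snd : α × β → β) := by
  refine polyOn_of_run .id (.const 3) (fun _ _ h => h.2)
    fun d hd => ⟨.seq (.const (d + 1) 1) (.seq (.add d d (d + 1)) (.load d d)), fun s a _ hs => ?_⟩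
  refine run_seq (run_const (run_seq (run_add (run_load ⟨fun _ _ => le_rfl, ?_, ?_⟩))))
  · exact ((Ext.setReg _ _ (by omega) (by omega)).trans (.setReg _ _ le_rfl hd)).trans
      (.setReg _ _ le_rfl hd)
  have := hs.2.2.2
  simpa [Holds, State.reg_setReg, hd.ne] using this

theorem Code.Holds.setReg {s : State} {d i x : ℕ} {a : α} (h : Holds s d a)
    (hi : 0 < i) (hd : d ≠ i) :
    Holds (s.setReg i x) d a := by
  simpa [Holds, State.reg_setReg, hi.ne, hd] using h

theorem Code.Holds.mov {s : State} {d i : ℕ} {a : α} (h : Holds s d a) (hi : 0 < i) :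
    Holds (s.setReg i (s.reg d)) i a := by
  simpa [Holds, State.reg_setReg, hi.ne] using h

theorem holds_allocPair {d : ℕ} (hd : 0 < d) {s : State} (h0 : 0 < s.reg 0) {a : α} {b : β}
    (ha : Holds s d a) (hb : Holds s (d + 1) b) :
    Run (allocPair d) s fun t s' => t = 7 ∧ Ext d s s' ∧ Holds s' d (a, b) := by
  refine (run_allocPair hd s).imp fun t s' ⟨ht, he, h1, h2, h3, h4⟩ => ⟨ht, he, ?_⟩
  refine ⟨by omega, by omega, ?_, ?_⟩
  · rw [h1, h3]
    exact rep_mono he.mem he.free ha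
  · rw [h1, h4]
    exact rep_mono he.mem he.free hb

theorem PolyOn.pair {f : α → β} {g : α → γ} (hf : PolyOn D f) (hg : PolyOn D g) :
    PolyOn D fun a => (f a, g a) := by
  obtain ⟨p, hp, hpb, hP⟩ := hf
  obtain ⟨q, hq, hqb, hQ⟩ := hg
  refine polyOn_of_run (hp.add hq) ((hp.add hq).add (.const 15))
    (fun B a ha => ⟨bdd_mono (by omega) (hpb B a ha), bdd_mono (by omega) (hqb B a ha)⟩)
    fun d hd => ?_
  -- The first program works above `d`, the second above `d + 1`, so the argument and then the first
  -- value are preserved.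
  obtain ⟨P, hP⟩ := hP (d + 1) (by omega)
  obtain ⟨Q, hQ⟩ := hQ (d + 2) (by omega)
  refine ⟨.seq (mov (d + 1) d) <| .seq P <| .seq (mov (d + 2) d) <| .seq Q <|
    .seq (mov d (d + 1)) <| .seq (mov (d + 1) (d + 2)) (allocPair d), fun s a h0 hs => ?_⟩
  refine run_seq (run_mov (by omega) (run_seq ?_))
  have e1 := Ext.setReg (d := d + 1) s (s.reg d) (i := d + 1) (by omega) (by omega)
  refine (hP _ a (h0.trans_le e1.free) (hs.mov (by omega))).imp
    fun t₁ s₁ ⟨ht₁, he₁, hs₁⟩ => ?_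
  refine run_seq (run_mov (by omega) (run_seq ?_))
  have e2 := e1.trans he₁
  have e3 := Ext.setReg (d := d + 2) s₁ (s₁.reg d) (i := d + 2) (by omega) (by omega)
  have hs₁' : Holds s₁ d a := hs.ext e2 (e2.reg d hd (by omega))
  refine (hQ _ a ((h0.trans_le e2.free).trans_le e3.free) (hs₁'.mov (by omega))).imp
    fun t₂ s₂ ⟨ht₂, he₂, hs₂⟩ => ?_
  have e4 := e3.trans he₂
  have hs₂' : Holds s₂ (d + 1) (f a) := hs₁.ext e4 (e4.reg _ (by omega) (by omega))
  refine run_seq (run_mov (by omega) (run_seq (run_mov (by omega) ?_)))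
  have e5 : Ext d s₂ ((s₂.setReg d (s₂.reg (d + 1))).setReg (d + 1)
      ((s₂.setReg d (s₂.reg (d + 1))).reg (d + 2))) :=
    (Ext.setReg _ _ le_rfl hd).trans (.setReg _ _ (by omega) (by omega))
  have e6 : Ext d s s₂ := (e2.mono (by omega)).trans (e4.mono (by omega))
  refine (holds_allocPair hd ((h0.trans_le e6.free).trans_le e5.free) (a := f a) (b := g a)
    ((hs₂'.mov hd).setReg (by omega) (by omega))
    ((hs₂.setReg hd (by omega)).mov (by omega))).imp fun t₃ s₃ ⟨ht₃, he₃, hs₃⟩ => ?_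
  refine ⟨fun B hB => ?_, (e6.trans e5).trans he₃, hs₃⟩
  have := ht₁ B hB
  have := ht₂ B hB
  omega

theorem PolyOn.cond {c : α → Bool} {f g : α → β} (hc : PolyOn D c) (hf : PolyOn D f)
    (hg : PolyOn D g) : PolyOn D fun a => if c a then f a else g a := by
  obtain ⟨o, ho, -, hO⟩ := hc
  obtain ⟨p, hp, hpb, hP⟩ := hf
  obtain ⟨q, hq, hqb, hQ⟩ := hg
  refine polyOn_of_run (hp.add hq) (((ho.add hp).add hq).add (.const 3)) (fun B a ha => ?_)
    fun d hd => ?_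
  · split
    · exact bdd_mono (by omega) (hpb B a ha)
    · exact bdd_mono (by omega) (hqb B a ha)
  obtain ⟨O, hO⟩ := hO (d + 1) (by omega)
  obtain ⟨P, hP⟩ := hP d hd
  obtain ⟨Q, hQ⟩ := hQ d hd
  refine ⟨.seq (mov (d + 1) d) <| .seq O (.ifNonzero (d + 1) P Q), fun s a h0 hs => ?_⟩
  refine run_seq (run_mov (by omega) (run_seq ?_))
  have e1 := Ext.setReg (d := d + 1) s (s.reg d) (i := d + 1) (by omega) (by omega)
  refine (hO _ a (h0.trans_le e1.free) (hs.mov (by omega))).imp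
    fun t₁ s₁ ⟨ht₁, he₁, hs₁⟩ => ?_
  have e2 := e1.trans he₁
  have hs₁' : Holds s₁ d a := hs.ext e2 (e2.reg d hd (by omega))
  change s₁.reg (d + 1) = (c a).toNat at hs₁
  cases hca : c a
  · obtain ⟨t₂, s₂, h₂, ht₂, he₂, hs₂⟩ := hQ s₁ a (h0.trans_le e2.free) hs₁'
    refine ⟨_, s₂, .if_false (by simp [hs₁, hca]) h₂, fun B hB => ?_,
      (e2.mono (by omega)).trans he₂, by simpa using hs₂⟩
    have := ht₁ B hB
    have := ht₂ B hB
    omega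
  · obtain ⟨t₂, s₂, h₂, ht₂, he₂, hs₂⟩ := hP s₁ a (h0.trans_le e2.free) hs₁'
    refine ⟨_, s₂, .if_true (by simp [hs₁, hca]) h₂, fun B hB => ?_,
      (e2.mono (by omega)).trans he₂, by simpa using hs₂⟩
    have := ht₁ B hB
    have := ht₂ B hB
    omega

/-- The cell of the pair already is the cell of the list, so nothing has to be done. -/
theorem polyTime_cons : PolyTime fun x : β × List β => x.1 :: x.2 := by
  refine polyOn_of_run (PolyBound.id.add (.const 1)) (.const 1) (fun B a h => ?_)
    fun d hd => ⟨.skip, fun s a _ hs => run_skip ⟨fun _ _ => le_rfl, .refl _ _, hs⟩⟩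
  obtain ⟨h1, h2, h3⟩ := h
  refine ⟨by simpa using h2, fun b hb => ?_⟩
  rcases List.mem_cons.1 hb with rfl | hb
  · exact bdd_mono (by omega) h1
  · exact bdd_mono (by omega) (h3 b hb)

/-- Load the components of the pair in register `d` into the registers `d + 1` and `d`. -/
def unpair (d : ℕ) : Program :=
  .seq (.load (d + 1) d) <| .seq (.const (d + 2) 1) <| .seq (.add d d (d + 2)) (.load d d)

theorem run_unpair {d : ℕ} (hd : 0 < d) {s : State} {a b : ℕ} (hs : Holds s d (a, b))
    {Q : ℕ → State → Prop}
    (h : ∀ s', Ext d s s' → s'.reg (d + 1) = a → s'.reg d = b → Q 4 s') :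
    Run (unpair d) s Q := by
  refine run_seq (run_load (run_seq (run_const (run_seq (run_add (run_load (h _ ?_ ?_ ?_)))))))
  · exact (((Ext.setReg _ _ (by omega) (by omega)).trans (.setReg _ _ (by omega) (by omega))).trans
      (.setReg _ _ le_rfl hd)).trans (.setReg _ _ le_rfl hd)
  · have : s.mem (s.reg d) = a := hs.2.2.1
    simpa [State.reg_setReg] using this
  · have : s.mem (s.reg d + 1) = b := hs.2.2.2
    simpa [State.reg_setReg] using this

theorem polyTime_add : PolyTime fun x : ℕ × ℕ => x.1 + x.2 := by
  refine polyOn_of_run (PolyBound.id.add .id) (.const 5)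
    (fun B a h => Nat.add_le_add h.1 h.2)
    fun d hd => ⟨.seq (unpair d) (.add d (d + 1) d), fun s a _ hs => run_seq ?_⟩
  refine run_unpair hd hs fun s' he h1 h2 => run_add ⟨fun _ _ => le_rfl,
    he.trans (.setReg _ _ le_rfl hd), ?_⟩
  simp [Holds, Stored, State.reg_setReg, h1, h2]

theorem polyTime_sub : PolyTime fun x : ℕ × ℕ => x.1 - x.2 := by
  refine polyOn_of_run .id (.const 5)
    (fun B a h => (Nat.sub_le _ _).trans h.1)
    fun d hd => ⟨.seq (unpair d) (.sub d (d + 1) d), fun s a _ hs => run_seq ?_⟩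
  refine run_unpair hd hs fun s' he h1 h2 => run_sub ⟨fun _ _ => le_rfl,
    he.trans (.setReg _ _ le_rfl hd), ?_⟩
  simp [Holds, Stored, State.reg_setReg, h1, h2]

/-- The truncated difference `1 - x` is the code of the truth value. -/
theorem polyTime_eq_zero : PolyTime fun x : ℕ => decide (x = 0) := by
  refine polyOn_of_run .id (.const 2) (fun _ _ _ => trivial)
    fun d hd => ⟨.seq (.const (d + 1) 1) (.sub d (d + 1) d), fun s a _ hs => ?_⟩
  refine run_seq (run_const (run_sub ⟨fun _ _ => le_rfl,
    (Ext.setReg _ _ (by omega) (by omega)).trans (.setReg _ _ le_rfl hd), ?_⟩))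
  have hs : s.reg d = a := hs
  simp only [Holds, Stored, State.reg_setReg, hs]
  rcases a with _ | a <;> simp

end PolyOn

open Code RAM

/-! ### Loops over lists and ranges -/

section Loops

variable {α β γ : Type} [Code α] [Code β] [Code γ] {D : ℕ → α → Prop}

/-- Allows the pointer to the remaining list to serve as the loop test in `run_while`. -/
theorem holds_list_eq_zero {s : State} {d : ℕ} {l : List β} (h : Holds s d l) :
    s.reg d = 0 ↔ l.length = 0 := by
  cases l with
  | nil => exact iff_of_true h rfl
  | cons b l => simpa using h.1

/-- The body of a loop over the list in register `d + 1` with the accumulator in register `d + 2`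
and the parameter in register `d`; the program `P` expects its argument in register `d + 3`. -/
def foldBody (d : ℕ) (P : Program) : Program :=
  .seq (mov (d + 4) (d + 2)) <| .seq (.load (d + 5) (d + 1)) <| .seq (allocPair (d + 4)) <|
    .seq (mov (d + 3) d) <| .seq (allocPair (d + 3)) <| .seq P <| .seq (mov (d + 2) (d + 3)) <|
    .seq (.const (d + 3) 1) <| .seq (.add (d + 1) (d + 1) (d + 3)) (.load (d + 1) (d + 1))

theorem run_foldBody {d : ℕ} (hd : 0 < d) {P : Program} {h : α × γ × β → γ} {T : ℕ → Prop}
    {a : α} {c : γ} {b : β} {l : List β}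
    (hP : ∀ s x, 0 < s.reg 0 → x = (a, c, b) → Holds s (d + 3) x →
      Run P s fun t s' => (∀ k, T k → t ≤ k) ∧ Ext (d + 3) s s' ∧ Holds s' (d + 3) (h x))
    {s : State} (h0 : 0 < s.reg 0) (ha : Holds s d a) (hl : Holds s (d + 1) (b :: l))
    (hc : Holds s (d + 2) c) :
    Run (foldBody d P) s fun t s' => (∀ k, T k → t ≤ k + 24) ∧ Ext (d + 1) s s' ∧
      Holds s' (d + 1) l ∧ Holds s' (d + 2) (h (a, c, b)) := by
  refine run_seq (run_mov (by omega) (run_seq (run_load (run_seq ?_))))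
  set s₁ := (s.setReg (d + 4) (s.reg (d + 2))).setReg (d + 5)
    ((s.setReg (d + 4) (s.reg (d + 2))).mem ((s.setReg (d + 4) (s.reg (d + 2))).reg (d + 1)))
    with hs₁
  have e₁ : Ext (d + 3) s s₁ :=
    (Ext.setReg _ _ (by omega) (by omega)).trans (.setReg _ _ (by omega) (by omega))
  have hc₁ : Holds s₁ (d + 4) c := (hc.mov (by omega)).setReg (by omega) (by omega)
  have hb₁ : Holds s₁ (d + 5) b := by
    have := hl.2.2.1
    simpa [hs₁, Holds, State.reg_setReg] using this
  refine (holds_allocPair (by omega) (h0.trans_le e₁.free) hc₁ hb₁).imp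
    fun t₂ s₂ ⟨ht₂, e₂, hs₂⟩ => run_seq (run_mov (by omega) (run_seq ?_))
  have e₂ := e₁.trans (e₂.mono (by omega))
  have ha₂ : Holds s₂ d a := ha.ext e₂ (e₂.reg _ hd (by omega))
  have e₃ : Ext (d + 3) s (s₂.setReg (d + 3) (s₂.reg d)) :=
    e₂.trans (.setReg _ _ (by omega) (by omega))
  refine (holds_allocPair (by omega) (h0.trans_le e₃.free) (ha₂.mov (by omega))
    (hs₂.setReg (by omega) (by omega))).imp fun t₄ s₄ ⟨ht₄, e₄, hs₄⟩ => run_seq ?_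
  have e₄ := e₃.trans e₄
  refine (hP s₄ _ (h0.trans_le e₄.free) rfl hs₄).imp fun t₅ s₅ ⟨ht₅, e₅, hs₅⟩ => ?_
  have e₅ := e₄.trans e₅
  refine run_seq (run_mov (by omega) (run_seq (run_const (run_seq (run_add (run_load ?_))))))
  have hl₅ := hl.ext e₅ (e₅.reg _ (by omega) (by omega))
  -- The overhead `24` consists of two allocations at `7` steps, three moves at `2` and four
  -- elementary instructions.
  refine ⟨fun k hk => ?_, ?_, ?_, ?_⟩
  · have := ht₅ k hk
    omega
  · refine (e₅.mono (by omega)).trans ?_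
    refine (((Ext.setReg _ _ (by omega) (by omega)).trans (Ext.setReg _ _ (by omega)
      (by omega))).trans (Ext.setReg _ _ (by omega) (by omega))).trans
      (Ext.setReg _ _ (by omega) (by omega))
  · have : Stored s₅.mem (s₅.reg 0) (s₅.mem (s₅.reg (d + 1) + 1)) l := hl₅.2.2.2
    simpa [Holds, State.reg_setReg] using this
  · exact (((hs₅.mov (by omega)).setReg (by omega) (by omega)).setReg (by omega)
      (by omega)).setReg (by omega) (by omega)

/-- Iterating a polynomial step may blow up the accumulator. Therefore `hq` asks one polynomial `q`
to control the accumulators after all initial segments of the list, and all arguments of the step to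
lie in its domain. -/
theorem PolyOn.foldl {E : ℕ → α × γ × β → Prop} {f : α → List β} {g : α → γ} {h : α → γ → β → γ}
    (hf : PolyOn D f) (hg : PolyOn D g)
    (hh : PolyOn E fun x : α × γ × β => h x.1 x.2.1 x.2.2)
    (hq : ∃ q, PolyBound q ∧ ∀ B a, D B a → ∀ l₁ l₂, f a = l₁ ++ l₂ →
      Bdd (q B) (l₁.foldl (h a) (g a)) ∧
        ∀ b l₃, l₂ = b :: l₃ → E (q B) (a, l₁.foldl (h a) (g a), b)) :
    PolyOn D fun a => (f a).foldl (h a) (g a) := by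
  obtain ⟨p, hp, hpb, hP⟩ := hf
  obtain ⟨o, ho, hob, hO⟩ := hg
  obtain ⟨r, hr, hrb, hR⟩ := hh
  obtain ⟨q, hq, hqE⟩ := hq
  refine polyOn_of_run hq (q := fun B => p B + o B + (p B * (r (q B) + 24 + 1) + 1) + 6)
    (((hp.add ho).add ((hp.mul ((((hr.comp hq).add (.const _))).add (.const _))).add
      (.const _))).add (.const _)) (fun B a ha => (hqE B a ha (f a) [] (by simp)).1) fun d hd => ?_
  obtain ⟨P, hP⟩ := hP (d + 1) (by omega)
  obtain ⟨O, hO⟩ := hO (d + 2) (by omega)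
  obtain ⟨R, hR⟩ := hR (d + 3) (by omega)
  refine ⟨.seq (mov (d + 1) d) <| .seq P <| .seq (mov (d + 2) d) <| .seq O <|
    .seq (.whileNonzero (d + 1) (foldBody d R)) (mov d (d + 2)), fun s a h0 hs => ?_⟩
  refine run_seq (run_mov (by omega) (run_seq ?_))
  have e1 := Ext.setReg (d := d + 1) s (s.reg d) (i := d + 1) (by omega) (by omega)
  refine (hP _ a (h0.trans_le e1.free) (hs.mov (by omega))).imp fun t₁ s₁ ⟨ht₁, e₁, hs₁⟩ => ?_
  have e₁ := e1.trans e₁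
  refine run_seq (run_mov (by omega) (run_seq ?_))
  have e2 := Ext.setReg (d := d + 2) s₁ (s₁.reg d) (i := d + 2) (by omega) (by omega)
  have hs₁' : Holds s₁ d a := hs.ext e₁ (e₁.reg d hd (by omega))
  refine (hO _ a ((h0.trans_le e₁.free).trans_le e2.free) (hs₁'.mov (by omega))).imp
    fun t₂ s₂ ⟨ht₂, e₂, hs₂⟩ => run_seq ?_
  have e₂ := e2.trans e₂
  have hl₂ : Holds s₂ (d + 1) (f a) := hs₁.ext e₂ (e₂.reg _ (by omega) (by omega))
  have e₂ := e₁.trans (e₂.mono (by omega))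
  have ha₂ : Holds s₂ d a := hs.ext e₂ (e₂.reg d hd (by omega))
  let I : ℕ → State → Prop := fun k s' => ∃ l₁ l₂, f a = l₁ ++ l₂ ∧ l₂.length = k ∧
    Ext (d + 1) s s' ∧ Holds s' d a ∧ Holds s' (d + 1) l₂ ∧
    Holds s' (d + 2) (l₁.foldl (h a) (g a))
  -- The program does not know `B`. The run is fixed first, and its time is then bounded for every
  -- admissible `B` simultaneously.
  refine (run_while (I := I) (T := fun c => ∃ B, D B a ∧ c = r (q B) + 24) ?_ ?_ (f a).length s₂
    ⟨[], f a, rfl, rfl, e₂, ha₂, hl₂, hs₂⟩).imp ?_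
  · rintro k s' ⟨l₁, l₂, -, hk, -, -, hl, -⟩
    rw [holds_list_eq_zero hl, hk]
  · rintro k s' ⟨l₁, l₂, hl, hk, he, ha, hl', hc⟩
    obtain ⟨b, l₃, rfl⟩ := List.exists_cons_of_length_eq_add_one hk
    refine (run_foldBody (h := fun x => h x.1 x.2.1 x.2.2)
      (T := fun c => ∃ B, D B a ∧ c = r (q B)) hd ?_ (h0.trans_le he.free) ha hl' hc).imp ?_
    · rintro s'' x h0' rfl hx
      refine (hR s'' _ h0' hx).imp fun t s₃ ⟨ht, h'⟩ => ⟨?_, h'⟩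
      rintro c ⟨B, hB, rfl⟩
      exact ht _ ((hqE B a hB l₁ _ hl).2 b l₃ rfl)
    · rintro t s₃ ⟨ht, e₃, hs₃, hs₃'⟩
      have e₄ := he.trans e₃
      refine ⟨?_, l₁ ++ [b], l₃, by simp [hl], by simpa using hk, e₄,
        hs.ext e₄ (e₄.reg d hd (by omega)), hs₃, by simpa using hs₃'⟩
      rintro c ⟨B, hB, rfl⟩
      exact ht _ ⟨B, hB, rfl⟩
  · rintro t₃ s₃ ⟨ht₃, l₁, l₂, hl, hk, he, ha, hl', hc⟩
    obtain rfl := List.length_eq_zero_iff.1 hk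
    rw [List.append_nil] at hl
    refine run_mov (by omega) ⟨fun B hB => ?_, (he.mono (by omega)).trans
      (.setReg _ _ le_rfl hd), by rw [hl]; exact hc.mov hd⟩
    have h1 := ht₁ B hB
    have h2 := ht₂ B hB
    have h3 := ht₃ _ ⟨B, hB, rfl⟩
    have h4 := Nat.mul_le_mul_right (r (q B) + 24 + 1) (hpb B a hB).1
    omega

theorem polyTime_range : PolyTime List.range := by
  refine polyOn_of_run .id (q := fun B => B * (13 + 1) + 1 + 5)
    (((PolyBound.id.mul (.const _)).add (.const _)).add (.const _)) (fun B n h => ?_) fun d hd => ?_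
  · refine ⟨by simpa using h, fun i hi => ?_⟩
    have h : n ≤ B := h
    have := List.mem_range.1 hi
    simp only [bdd_nat]
    omega
  refine ⟨.seq (.const (d + 2) 0) <| .seq (.whileNonzero d <| .seq (.const (d + 1) 1) <|
    .seq (.sub d d (d + 1)) <| .seq (mov (d + 1) d) <| .seq (allocPair (d + 1))
      (mov (d + 2) (d + 1))) (mov d (d + 2)), fun s n h0 hs => ?_⟩
  -- Lists grow at the front, so the counter runs downwards and the list built so far is `[k, …, n -
  -- 1]`.
  let I : ℕ → State → Prop := fun k s' => k ≤ n ∧ s'.reg d = k ∧ Ext d s s' ∧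
    Holds s' (d + 2) (List.range' k (n - k))
  refine run_seq (run_const (run_seq ((run_while (I := I) (T := fun c => c = 13) ?_ ?_ n _
    ?_).imp ?_)))
  · rintro k s' ⟨-, hk, -⟩
    rw [hk]
  · rintro k s' ⟨hkn, hk, he, hl⟩
    refine run_seq (run_const (run_seq (run_sub (run_seq (run_mov (by omega) (run_seq ?_))))))
    set s₁ := ((s'.setReg (d + 1) 1).setReg d ((s'.setReg (d + 1) 1).reg d -
      (s'.setReg (d + 1) 1).reg (d + 1))) with hs₁
    have e₁ : Ext d s' (s₁.setReg (d + 1) (s₁.reg d)) :=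
      ((Ext.setReg _ _ (by omega) (by omega)).trans (.setReg _ _ le_rfl hd)).trans
        (.setReg _ _ (by omega) (by omega))
    have hd₁ : s₁.reg d = k := by simp [hs₁, State.reg_setReg, hk]
    refine (holds_allocPair (a := k) (b := List.range' (k + 1) (n - (k + 1))) (by omega)
      ((h0.trans_le he.free).trans_le e₁.free) ?_
      (((hl.setReg (by omega) (by omega)).setReg hd (by omega)).setReg (by omega)
        (by omega))).imp fun t₂ s₂ ⟨ht₂, e₂, hs₂⟩ => ?_
    · simp [Holds, Stored, State.reg_setReg, hd₁]
    refine run_mov (by omega) ⟨?_, by omega, ?_, ?_, ?_⟩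
    · rintro c rfl
      omega
    · have := e₂.reg d hd (by omega)
      simpa [State.reg_setReg, hd₁] using this
    · exact (he.trans (e₁.trans (e₂.mono (by omega)))).trans (.setReg _ _ (by omega) (by omega))
    · have h := hs₂.mov (i := d + 2) (by omega)
      have h' : List.range' k (n - k) = k :: List.range' (k + 1) (n - (k + 1)) := by
        rw [show n - k = n - (k + 1) + 1 by omega, List.range'_succ]
      rw [h']
      exact h
  · refine ⟨le_rfl, ?_, .setReg _ _ (by omega) (by omega), ?_⟩
    · have : s.reg d = n := hs
      simp [State.reg_setReg, this]
    · rw [Nat.sub_self]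
      simp [Holds, Stored, ListStored, State.reg_setReg]
  · rintro t s' ⟨ht, -, -, he, hl⟩
    refine run_mov (by omega) ⟨fun B hB => ?_, he.trans (.setReg _ _ le_rfl hd), ?_⟩
    · have := ht _ rfl
      have : n ≤ B := hB
      omega
    · rw [List.range_eq_range']
      exact hl.mov hd

end Loops

/-! ## From the input word to a list -/

namespace RAM

/-- Add the product of the registers `1` and `j` to register `0`. -/
def mulAcc (j : ℕ) : Program :=
  .whileNonzero 1 <| .seq (.add 0 0 j) <| .seq (.const 4 1) (.sub 1 1 4)

/-- Multiplication is repeated addition: register `0` plus the outstanding multiple of register `j`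
is invariant. -/
theorem run_mulAcc {j : ℕ} (hj : j = 2 ∨ j = 3) {s : State} {Q : ℕ → State → Prop}
    (h : ∀ t s', t ≤ s.reg 1 * 4 + 1 → s'.mem = s.mem → s'.reg 2 = s.reg 2 →
      s'.reg 3 = s.reg 3 → s'.reg 0 = s.reg 0 + s.reg 1 * s.reg j → Q t s') :
    Run (mulAcc j) s Q := by
  let I : ℕ → State → Prop := fun k s' => s'.reg 1 = k ∧ s'.mem = s.mem ∧ s'.reg 2 = s.reg 2 ∧
    s'.reg 3 = s.reg 3 ∧ s'.reg 0 + k * s.reg j = s.reg 0 + s.reg 1 * s.reg j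
  refine (run_while (I := I) (T := fun c => c = 3) ?_ ?_ (s.reg 1) s
    ⟨rfl, rfl, rfl, rfl, rfl⟩).imp ?_
  · rintro k s' ⟨h, -⟩
    rw [h]
  · rintro k s' ⟨h1, hm, h2, h3, h0⟩
    refine run_seq (run_add (run_seq (run_const (run_sub ⟨by simp, ?_⟩))))
    have hj' : s'.reg j = s.reg j := by rcases hj with rfl | rfl <;> assumption
    refine ⟨by simp [State.reg_setReg, h1], hm, by simp [State.reg_setReg, h2],
      by simp [State.reg_setReg, h3], ?_⟩
    rw [← h0]
    simp [State.reg_setReg, hj']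
    ring
  · rintro t s' ⟨ht, h1, hm, h2, h3, h0⟩
    exact h t s' (ht _ rfl) hm h2 h3 (by simpa using h0)

/-- Build a list of the contents of the memory cells below the address in register `0`, in which
it leaves the free pointer, and put the list into register `1`. -/
def readList : Program :=
  .seq (mov 1 0) <| .seq (.const 3 0) <| .seq (.whileNonzero 1 <| .seq (.const 4 1) <|
    .seq (.sub 1 1 4) <| .seq (.load 2 1) <| .seq (allocPair 2) (mov 3 2)) (mov 1 3)

/-- The free pointer starts right behind the input, so the allocated cells do not overwrite it, and
reading backwards lets the list grow at its front. -/
theorem run_readList {s : State} {w : List ℕ} (hw : s.reg 0 = w.length)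
    (hm : ∀ i, s.mem i = w.getD i 0) {Q : ℕ → State → Prop}
    (h : ∀ t s', t ≤ w.length * 13 + 6 → w.length ≤ s'.reg 0 → Holds s' 1 w → Q t s') :
    Run readList s Q := by
  let I : ℕ → State → Prop := fun k s' => k ≤ w.length ∧ s'.reg 1 = k ∧ w.length ≤ s'.reg 0 ∧
    (∀ i < w.length, s'.mem i = w.getD i 0) ∧ Holds s' 3 (w.drop k)
  refine run_seq (run_mov (by omega) (run_seq (run_const (run_seq ((run_while (I := I)
    (T := fun c => c = 12) ?_ ?_ w.length _ ?_).imp ?_)))))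
  · rintro k s' ⟨-, h, -⟩
    rw [h]
  · rintro k s' ⟨hk, h1, h0, hm', hl⟩
    refine run_seq (run_const (run_seq (run_sub (run_seq (run_load (run_seq ?_))))))
    have hl₁ := (hl.setReg (i := 4) (x := 1) (by omega) (by omega)).setReg (i := 1)
      (x := (s'.setReg 4 1).reg 1 - (s'.setReg 4 1).reg 4) (by omega) (by omega)
    generalize hs₁ : ((s'.setReg 4 1).setReg 1 ((s'.setReg 4 1).reg 1 - (s'.setReg 4 1).reg 4))
      = s₁ at hl₁ ⊢
    have hk₁ : s₁.reg 1 = k := by simp [← hs₁, State.reg_setReg, h1]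
    have hm₁ : s₁.mem = s'.mem := by simp [← hs₁]
    have h0₁ : (s₁.setReg 2 (s₁.mem (s₁.reg 1))).reg 0 = s'.reg 0 := by
      simp [← hs₁, State.reg_setReg]
    refine (holds_allocPair (a := w.getD k 0) (b := w.drop (k + 1)) (by omega) (by omega) ?_
      (hl₁.setReg (by omega) (by omega))).imp fun t₂ s₂ ⟨ht₂, e₂, hs₂⟩ => ?_
    · have := hm' k (by omega)
      simpa [Holds, Stored, State.reg_setReg, hk₁, hm₁] using this
    refine run_mov (by omega) ⟨?_, by omega, ?_, ?_, fun i hi => ?_, ?_⟩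
    · rintro c rfl
      omega
    · have := e₂.reg 1 (by omega) (by omega)
      simpa [State.reg_setReg, hk₁] using this
    · have := e₂.free
      simp only [State.reg_setReg]
      rw [if_neg (by omega)]
      omega
    · have := e₂.mem i (by omega)
      simp only [State.mem_setReg, hm₁] at this ⊢
      rw [this]
      exact hm' i hi
    · have h := hs₂.mov (i := 3) (by omega)
      have h' : w.drop k = w.getD k 0 :: w.drop (k + 1) := by
        rw [List.drop_eq_getElem_cons (by omega), List.getD_eq_getElem _ _ (by omega)]
      rw [h']
      exact h
  · refine ⟨le_rfl, by simp [State.reg_setReg, hw], by simp [State.reg_setReg, hw],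
      fun i _ => hm i, ?_⟩
    rw [List.drop_length]
    simp [Holds, Stored, ListStored, State.reg_setReg]
  · rintro t s' ⟨ht, -, h1, h0, hm', hl⟩
    have := ht _ rfl
    refine run_mov (by omega) (h _ _ (by omega) (by simpa [State.reg_setReg] using h0) ?_)
    have := hl.mov (i := 1) (by omega)
    simpa using this

/-- Compute the length of the input word, and read it. -/
def readInput : Program :=
  .seq (.const 1 0) <| .seq (.load 2 1) <| .seq (.const 1 1) <| .seq (.load 3 1) <|
    .seq (.const 0 3) <| .seq (mov 1 2) <| .seq (mulAcc 2) <| .seq (mov 1 3) <|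
    .seq (mulAcc 3) <| .seq (mov 1 3) <| .seq (mulAcc 2) readList

/-- The input has no end mark. Its length is computed from `n` and `N`, and it is also the first
free address. -/
theorem run_readInput {w : List ℕ} {n N : ℕ} (hn : w.getD 0 0 = n) (hN : w.getD 1 0 = N)
    (hw : w.length = 3 + n * n + N * N + N * n) {Q : ℕ → State → Prop}
    (h : ∀ t s', t ≤ n * 4 + N * 8 + w.length * 13 + 20 → 0 < s'.reg 0 → Holds s' 1 w →
      Q t s') : Run readInput (initial w) Q := by
  have hm : ∀ i, (initial w).mem i = w.getD i 0 := fun _ => rfl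
  refine run_seq (run_const (run_seq (run_load (run_seq (run_const (run_seq (run_load
    (run_seq (run_const (run_seq (run_mov (by omega) (run_seq ?_))))))))))))
  refine run_mulAcc (.inl rfl) fun t₁ s₁ ht₁ hm₁ h2₁ h3₁ h0₁ => ?_
  simp [State.reg_setReg, hm, hn, hN, -List.getD_eq_getElem?_getD] at ht₁ hm₁ h2₁ h3₁ h0₁
  refine run_seq (run_mov (by omega) (run_seq ?_))
  refine run_mulAcc (.inr rfl) fun t₂ s₂ ht₂ hm₂ h2₂ h3₂ h0₂ => ?_
  simp [State.reg_setReg, hm₁, h2₁, h3₁, h0₁] at ht₂ hm₂ h2₂ h3₂ h0₂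
  refine run_seq (run_mov (by omega) (run_seq ?_))
  refine run_mulAcc (.inl rfl) fun t₃ s₃ ht₃ hm₃ h2₃ h3₃ h0₃ => ?_
  simp [State.reg_setReg, hm₂, h2₂, h3₂, h0₂] at ht₃ hm₃ h2₃ h3₃ h0₃
  refine run_readList (w := w) (by omega) (by rw [hm₃]; exact hm) fun t s' ht h0 hs => ?_
  exact h _ s' (by omega) (by omega) hs

/-- A function of the input word that is computed in polynomial time is computed by a random access
machine. -/
theorem exists_program {D : ℕ → List ℕ → Prop} {f : List ℕ → ℕ} (hf : PolyOn D f)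
    (hD : ∀ B w, D B w → Bdd B w) :
    ∃ P q, PolyBound q ∧ ∀ B w n N, w.getD 0 0 = n → w.getD 1 0 = N →
      w.length = 3 + n * n + N * N + N * n → D B w → ∃ t ≤ q B, Outputs P w t (f w) := by
  obtain ⟨p, hp, -, hP⟩ := hf
  obtain ⟨P, hP⟩ := hP 1 one_pos
  refine ⟨.seq readInput (.seq P (mov 0 1)), fun B => B * 4 + B * 8 + B * 13 + 20 + p B + 2,
    (((((PolyBound.id.mul (.const _)).add (.mul .id (.const _))).add (.mul .id (.const _))).add
      (.const _)).add hp).add (.const _), fun B w n N hn hN hw hB => ?_⟩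
  have : Run (.seq readInput (.seq P (mov 0 1))) (initial w) fun t s' =>
      t ≤ B * 4 + B * 8 + B * 13 + 20 + p B + 2 ∧ s'.reg 0 = f w := by
    refine run_seq (run_readInput hn hN hw fun t₁ s₁ ht₁ h0₁ hs₁ => run_seq ?_)
    refine (hP s₁ w h0₁ hs₁).imp fun t₂ s₂ ⟨ht₂, _, hs₂⟩ => run_mov (by omega) ⟨?_, ?_⟩
    · have h2 := ht₂ B hB
      obtain ⟨hB1, hB2⟩ := hD B w hB
      -- The numbers `n` and `N` are entries of the word, so `B` bounds them.
      have hnB : n ≤ B := by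
        rw [← hn, List.getD_eq_getElem _ _ (by omega)]
        exact hB2 _ (List.getElem_mem _)
      have hNB : N ≤ B := by
        rw [← hN, List.getD_eq_getElem _ _ (by omega)]
        exact hB2 _ (List.getElem_mem _)
      omega
    · have : s₂.reg 1 = f w := hs₂
      simp [State.reg_setReg, this]
  obtain ⟨t, s', he, ht, h0⟩ := this
  exact ⟨t, ht, s', he, h0⟩

end RAM

open Code RAM

/-! ### Arithmetic, Boolean and list operations in polynomial time -/

section Closure

variable {α β γ : Type} [Code α] [Code β] [Code γ] {D : ℕ → α → Prop}

/-- Neither `p` nor `D` need be monotone in `B`; replacing `p` by its majorant `(B + 2) ^ C` makes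
the domain upward closed. -/
theorem PolyOn.le {f : α → β} (hf : PolyOn D f) : PolyOn (fun B a => ∃ B' ≤ B, D B' a) f := by
  obtain ⟨p, ⟨C, hC⟩, hb, hP⟩ := hf
  have hC' : ∀ B' B, B' ≤ B → p B' ≤ (B + 2) ^ C := fun B' B h =>
    (hC B').trans (Nat.pow_le_pow_left (by omega) C)
  refine ⟨fun B => (B + 2) ^ C, ⟨C, fun _ => le_rfl⟩, ?_, fun d hd => ?_⟩
  · rintro B a ⟨B', hB', h⟩
    exact bdd_mono (hC' _ _ hB') (hb B' a h)
  obtain ⟨P, hP⟩ := hP d hd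
  refine ⟨P, fun s a h0 hs => (hP s a h0 hs).imp fun t s' ⟨h1, h2⟩ => ⟨?_, h2⟩⟩
  rintro B ⟨B', hB', h⟩
  exact (h1 B' h).trans (hC' _ _ hB')

theorem PolyTime.on {f : α → β} (hf : PolyTime f) (hD : ∀ B a, D B a → Bdd B a) : PolyOn D f :=
  hf.mono ⟨_, .id, hD⟩

theorem PolyOn.fst {f : α → β × γ} (hf : PolyOn D f) : PolyOn D fun a => (f a).1 :=
  polyTime_fst.comp hf

theorem PolyOn.snd {f : α → β × γ} (hf : PolyOn D f) : PolyOn D fun a => (f a).2 :=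
  polyTime_snd.comp hf

theorem PolyOn.add {f g : α → ℕ} (hf : PolyOn D f) (hg : PolyOn D g) :
    PolyOn D fun a => f a + g a :=
  polyTime_add.comp (hf.pair hg)

theorem PolyOn.sub {f g : α → ℕ} (hf : PolyOn D f) (hg : PolyOn D g) :
    PolyOn D fun a => f a - g a :=
  polyTime_sub.comp (hf.pair hg)

theorem PolyOn.max {f g : α → ℕ} (hf : PolyOn D f) (hg : PolyOn D g) :
    PolyOn D fun a => Max.max (f a) (g a) := by
  convert hf.add (hg.sub hf) using 2
  omega

theorem PolyOn.le_nat {f g : α → ℕ} (hf : PolyOn D f) (hg : PolyOn D g) :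
    PolyOn D fun a => decide (f a ≤ g a) := by
  convert polyTime_eq_zero.comp (hf.sub hg) using 3
  rw [Nat.sub_eq_zero_iff_le]

theorem PolyOn.eq_nat {f g : α → ℕ} (hf : PolyOn D f) (hg : PolyOn D g) :
    PolyOn D fun a => decide (f a = g a) := by
  convert polyTime_eq_zero.comp ((hf.sub hg).add (hg.sub hf)) using 3
  omega

theorem PolyOn.and {f g : α → Bool} (hf : PolyOn D f) (hg : PolyOn D g) :
    PolyOn D fun a => f a && g a := by
  convert hf.cond hg (.const_bool false) using 2 with a
  cases f a <;> simp

theorem PolyOn.or {f g : α → Bool} (hf : PolyOn D f) (hg : PolyOn D g) :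
    PolyOn D fun a => f a || g a := by
  convert hf.cond (.const_bool true) hg using 2 with a
  cases f a <;> simp

theorem PolyOn.not {f : α → Bool} (hf : PolyOn D f) : PolyOn D fun a => !f a := by
  convert hf.cond (.const_bool false) (.const_bool true) using 2 with a
  cases f a <;> simp

theorem PolyOn.cons {f : α → β} {g : α → List β} (hf : PolyOn D f) (hg : PolyOn D g) :
    PolyOn D fun a => f a :: g a :=
  polyTime_cons.comp (hf.pair hg)

theorem PolyOn.range {f : α → ℕ} (hf : PolyOn D f) : PolyOn D fun a => List.range (f a) :=
  polyTime_range.comp hf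

/-- For a step that is polynomial on all data, only the growth of the accumulator has to be
controlled. -/
theorem PolyTime.foldl {f : α → List β} {g : α → γ} {h : α → γ → β → γ}
    (hf : PolyTime f) (hg : PolyTime g) (hh : PolyTime fun x : α × γ × β => h x.1 x.2.1 x.2.2)
    (hq : ∃ q, PolyBound q ∧ ∀ B a, Bdd B a → Bdd B (f a) → Bdd B (g a) → ∀ l₁ l₂,
      f a = l₁ ++ l₂ → Bdd (q B) (l₁.foldl (h a) (g a))) :
    PolyTime fun a => (f a).foldl (h a) (g a) := by
  refine PolyOn.foldl hf hg hh ?_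
  obtain ⟨p, hp, hpb, -⟩ := hf
  obtain ⟨r, hr, hrb, -⟩ := hg
  obtain ⟨q, ⟨C, hC⟩, hqb⟩ := hq
  -- `B + p B + r B` bounds the parameter, the list and the initial value at once, as `hqb`
  -- requires.
  refine ⟨fun B => (B + p B + r B + 2) ^ C + (B + p B + r B),
    PolyBound.add (.comp (p := fun B => (B + 2) ^ C) ⟨C, fun _ => le_rfl⟩
      ((PolyBound.id.add hp).add hr)) ((PolyBound.id.add hp).add hr),
    fun B a ha l₁ l₂ hl => ?_⟩
  have hf' : Bdd (B + p B + r B) (f a) := bdd_mono (by omega) (hpb B a ha)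
  have h1 := hqb (B + p B + r B) a (bdd_mono (by omega) ha) hf'
    (bdd_mono (by omega) (hrb B a ha)) l₁ l₂ hl
  have h2 : Bdd ((B + p B + r B + 2) ^ C + (B + p B + r B)) (l₁.foldl (h a) (g a)) :=
    bdd_mono ((hC _).trans (Nat.le_add_right _ _)) h1
  refine ⟨h2, ?_⟩
  rintro b l₃ rfl
  exact ⟨bdd_mono (Nat.le_trans (by omega : B ≤ B + p B + r B) (Nat.le_add_left _ _)) ha, h2,
    bdd_mono (Nat.le_add_left _ _) (hf'.2 b (by simp [hl]))⟩

theorem polyTime_reverse : PolyTime (List.reverse : List β → List β) := by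
  have : PolyTime fun l : List β => l.foldl (fun acc b => b :: acc) [] := by
    refine PolyTime.foldl (h := fun _ acc b => b :: acc) .id .nil
      (PolyOn.cons PolyTime.id.snd.snd PolyTime.id.snd.fst) ⟨_, .id, ?_⟩
    intro B l hl _ _ l₁ l₂ h
    simp only [List.foldl_flip_cons_eq_append, List.append_nil]
    refine ⟨?_, fun b hb => hl.2 b (by simp_all)⟩
    have := hl.1
    simp [h] at this ⊢
    omega
  simpa [List.foldl_flip_cons_eq_append] using this

theorem PolyOn.reverse {f : α → List β} (hf : PolyOn D f) : PolyOn D fun a => (f a).reverse :=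
  polyTime_reverse.comp hf

theorem polyTime_append : PolyTime fun x : List β × List β => x.1 ++ x.2 := by
  have : PolyTime fun x : List β × List β => x.1.reverse.foldl (fun acc b => b :: acc) x.2 := by
    refine PolyTime.foldl (h := fun _ acc b => b :: acc) PolyTime.id.fst.reverse PolyTime.id.snd
      (PolyOn.cons PolyTime.id.snd.snd PolyTime.id.snd.fst) ⟨_, PolyBound.id.add .id, ?_⟩
    intro B x hx hr _ l₁ l₂ h
    obtain ⟨⟨h1, h1'⟩, h2, h2'⟩ := hx
    simp only [List.foldl_flip_cons_eq_append, List.map_id']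
    refine ⟨?_, fun b hb => ?_⟩
    · have := congrArg List.length h
      simp at this ⊢
      omega
    · rcases List.mem_append.1 hb with hb | hb
      · exact bdd_mono (by omega) (hr.2 b (by simp_all))
      · exact bdd_mono (by omega) (h2' b hb)
  simpa [List.foldl_flip_cons_eq_append] using this

theorem PolyOn.append {f g : α → List β} (hf : PolyOn D f) (hg : PolyOn D g) :
    PolyOn D fun a => f a ++ g a :=
  polyTime_append.comp (hf.pair hg)

theorem PolyTime.filter {f : α → List β} {p : α → β → Bool} (hf : PolyTime f)
    (hp : PolyTime fun x : α × β => p x.1 x.2) : PolyTime fun a => (f a).filter (p a) := by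
  have key : ∀ (p : β → Bool) (l acc : List β),
      l.foldl (fun acc b => if p b then b :: acc else acc) acc = (l.filter p).reverse ++ acc := by
    intro p l
    induction l with
    | nil => simp
    | cons b l ih =>
      intro acc
      cases h : p b <;> simp [h, ih]
  have : PolyTime fun a => (f a).foldl (fun acc b => if p a b then b :: acc else acc) [] := by
    refine PolyTime.foldl (h := fun a acc b => if p a b then b :: acc else acc) hf .nil
      ((hp.comp (PolyTime.id.fst.pair PolyTime.id.snd.snd)).cond
        (PolyOn.cons PolyTime.id.snd.snd PolyTime.id.snd.fst) PolyTime.id.snd.fst) ⟨_, .id, ?_⟩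
    intro B a _ hf _ l₁ l₂ h
    rw [key]
    refine ⟨?_, fun b hb => hf.2 b ?_⟩
    · have := hf.1
      have := List.length_filter_le (p a) l₁
      simp [h] at *
      omega
    · simp_all
  simpa [key] using this.reverse

/-- General domains are needed here, because the inner function will be the enumeration of the
states of a node. -/
theorem PolyOn.flatMap {E : ℕ → α × β → Prop} {f : α → List β} {g : α → β → List γ}
    (hf : PolyOn D f) (hg : PolyOn E fun x : α × β => g x.1 x.2)
    (hD : ∃ q, PolyBound q ∧ ∀ B a, D B a → Bdd (q B) a ∧ ∀ b ∈ f a, E (q B) (a, b)) :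
    PolyOn D fun a => (f a).flatMap (g a) := by
  have key : ∀ (g : β → List γ) (l : List β) (acc : List γ),
      l.foldl (fun acc b => acc ++ g b) acc = acc ++ l.flatMap g := by
    intro g l
    induction l with
    | nil => simp
    | cons b l ih => simp [ih]
  obtain ⟨q, hq, hqE⟩ := hD
  -- The bound for the accumulator exceeds the parameter at which `E` is known, so a smaller `B'` is
  -- admitted for `E`.
  have hh : PolyOn (fun B x => Bdd B x ∧ ∃ B' ≤ B, E B' (x.1, x.2.2))
      fun x : α × List γ × β => x.2.1 ++ g x.1 x.2.2 :=
    .append (PolyTime.on (PolyTime.id.snd.fst) fun _ _ h => h.1) <|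
      PolyOn.comp hg.le (PolyTime.on (PolyTime.id.fst.pair PolyTime.id.snd.snd) fun _ _ h => h.1)
        ⟨_, .id, fun _ _ h => h.2⟩
  have := PolyOn.foldl (h := fun a acc b => acc ++ g a b) (g := fun _ => []) hf .nil hh ?_
  · simpa [key] using this
  obtain ⟨p, hp, hpb, -⟩ := hf
  obtain ⟨r, hr, hrb, -⟩ := hg
  refine ⟨fun B => q B + p B * r (q B) + r (q B) + p B,
    ((hq.add (hp.mul (hr.comp hq))).add (hr.comp hq)).add hp, fun B a ha l₁ l₂ hl => ?_⟩
  obtain ⟨h1, h2⟩ := hqE B a ha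
  have h3 : Bdd (q B + p B * r (q B) + r (q B) + p B) (l₁.flatMap (g a)) := by
    refine ⟨?_, fun c hc => ?_⟩
    · rw [List.length_flatMap]
      have h4 := List.sum_le_card_nsmul (l₁.map fun b => (g a b).length) (r (q B)) ?_
      · have h5 := (hpb B a ha).1
        simp only [hl, List.length_append] at h5
        have := Nat.mul_le_mul_right (r (q B)) ((Nat.le_add_right _ _).trans h5)
        simp only [List.length_map, smul_eq_mul] at h4
        omega
      · intro x hx
        obtain ⟨b, hb, rfl⟩ := List.mem_map.1 hx
        exact (hrb _ _ (h2 b (by simp [hl, hb]))).1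
    · obtain ⟨b, hb, hc⟩ := List.mem_flatMap.1 hc
      exact bdd_mono (by omega) ((hrb _ _ (h2 b (by simp [hl, hb]))).2 c hc)
  simp only [key, List.nil_append]
  refine ⟨h3, ?_⟩
  rintro b l₃ rfl
  exact ⟨⟨bdd_mono (by omega) h1, h3, bdd_mono (by omega) ((hpb B a ha).2 b (by simp [hl]))⟩,
    q B, by omega, h2 b (by simp [hl])⟩

theorem PolyTime.flatMap {f : α → List β} {g : α → β → List γ} (hf : PolyTime f)
    (hg : PolyTime fun x : α × β => g x.1 x.2) : PolyTime fun a => (f a).flatMap (g a) := by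
  refine PolyOn.flatMap hf hg ?_
  obtain ⟨p, hp, hpb, -⟩ := hf
  exact ⟨fun B => B + p B, PolyBound.id.add hp, fun B a ha =>
    ⟨bdd_mono (Nat.le_add_right _ _) ha, fun b hb => ⟨bdd_mono (Nat.le_add_right _ _) ha,
      bdd_mono (Nat.le_add_left _ _) ((hpb B a ha).2 b hb)⟩⟩⟩

theorem PolyTime.map {f : α → List β} {g : α → β → γ} (hf : PolyTime f)
    (hg : PolyTime fun x : α × β => g x.1 x.2) : PolyTime fun a => (f a).map (g a) := by
  have := PolyTime.flatMap (g := fun a b => [g a b]) hf (PolyOn.cons hg .nil)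
  simpa [← List.map_eq_flatMap] using this

theorem PolyTime.any {f : α → List β} {p : α → β → Bool} (hf : PolyTime f)
    (hp : PolyTime fun x : α × β => p x.1 x.2) : PolyTime fun a => (f a).any (p a) := by
  have key : ∀ (p : β → Bool) (l : List β) (acc : Bool),
      l.foldl (fun acc b => p b || acc) acc = (l.any p || acc) := by
    intro p l
    induction l with
    | nil => simp
    | cons b l ih =>
      intro acc
      simp only [List.foldl_cons, ih, List.any_cons]
      cases p b <;> cases acc <;> simp
  have := PolyTime.foldl (h := fun a acc b => p a b || acc) (g := fun _ => false) hf
    (.const_bool _) ((hp.comp (PolyTime.id.fst.pair PolyTime.id.snd.snd)).or PolyTime.id.snd.fst)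
    ⟨_, .id, fun _ _ _ _ _ _ _ _ => trivial⟩
  simpa [key] using this

theorem PolyTime.all {f : α → List β} {p : α → β → Bool} (hf : PolyTime f)
    (hp : PolyTime fun x : α × β => p x.1 x.2) : PolyTime fun a => (f a).all (p a) := by
  have := (PolyTime.any (p := fun a b => !p a b) hf hp.not).not
  simpa [List.all_eq_not_any_not] using this

theorem PolyTime.countP {f : α → List β} {p : α → β → Bool} (hf : PolyTime f)
    (hp : PolyTime fun x : α × β => p x.1 x.2) : PolyTime fun a => (f a).countP (p a) := by
  have key : ∀ (p : β → Bool) (l : List β) (n : ℕ),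
      l.foldl (fun n b => if p b then n + 1 else n) n = n + l.countP p := by
    intro p l
    induction l with
    | nil => simp
    | cons b l ih =>
      intro n
      cases h : p b <;> simp [h, ih]
      omega
  have := PolyTime.foldl (h := fun a n b => if p a b then n + 1 else n) (g := fun _ => 0) hf
    (.const_nat _) ((hp.comp (PolyTime.id.fst.pair PolyTime.id.snd.snd)).cond
      (PolyTime.id.snd.fst.add (.const_nat 1)) PolyTime.id.snd.fst) ⟨_, .id, ?_⟩
  · simpa [key] using this
  · intro B a _ hf _ l₁ l₂ h
    rw [key]
    have h1 := hf.1
    have h2 := List.countP_le_length (p := p a) (l := l₁)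
    simp [h] at h1 ⊢
    omega

theorem polyTime_foldl_max : PolyTime fun l : List ℕ => l.foldl max 0 := by
  refine PolyTime.foldl (h := fun _ m b => max m b) (g := fun _ => 0) .id (.const_nat _)
    (PolyTime.id.snd.fst.max PolyTime.id.snd.snd) ⟨_, .id, ?_⟩
  intro B l hl _ _ l₁ l₂ h
  have : ∀ (l : List ℕ) m, m ≤ B → (∀ a ∈ l, a ≤ B) → l.foldl max m ≤ B := by
    intro l
    induction l with
    | nil => simp
    | cons b l ih =>
      exact fun m hm hl => ih _ (max_le hm (hl b (by simp))) fun a ha => hl a (by simp [ha])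
  exact this l₁ 0 (Nat.zero_le _) fun a ha => hl.2 a (by simp [h, ha])

theorem PolyOn.mul {f g : α → ℕ} (hf : PolyOn D f) (hg : PolyOn D g) :
    PolyOn D fun a => f a * g a := by
  have key : ∀ (c : ℕ) (l : List ℕ) (n : ℕ),
      l.foldl (fun n _ => n + c) n = n + l.length * c := by
    intro c l
    induction l with
    | nil => simp
    | cons b l ih =>
      intro n
      simp [ih, Nat.succ_mul]
      omega
  have := PolyTime.foldl (f := fun x : ℕ × ℕ => List.range x.1) (h := fun x n _ => n + x.2)
    (g := fun _ => 0) PolyTime.id.fst.range (.const_nat _)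
    (PolyTime.id.snd.fst.add PolyTime.id.fst.snd) ⟨_, PolyBound.id.mul .id, ?_⟩
  · simpa [key] using this.comp (hf.pair hg)
  · intro B x hx hf _ l₁ l₂ h
    rw [key, Nat.zero_add]
    have h1 := hf.1
    refine Nat.mul_le_mul ?_ hx.2
    simp only [h, List.length_append] at h1
    omega

theorem PolyTime.getD {f : α → List β} {i : α → ℕ} {d : α → β} (hf : PolyTime f)
    (hi : PolyTime i) (hd : PolyTime d) : PolyTime fun a => (f a).getD (i a) (d a) := by
  -- A linear scan: the accumulator holds the current position and the value found so far.
  have key : ∀ (i : ℕ) (d : β) (l : List β) (x : ℕ × β),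
      l.foldl (fun x b => (x.1 + 1, if decide (x.1 = i) then b else x.2)) x =
        (x.1 + l.length, if x.1 ≤ i then l.getD (i - x.1) x.2 else x.2) := by
    intro i d l
    induction l with
    | nil => simp
    | cons b l ih =>
      intro x
      rw [List.foldl_cons, ih]
      refine Prod.ext (by simp; omega) ?_
      dsimp only
      rcases lt_trichotomy x.1 i with h | h | h
      · rw [if_pos (by omega), if_pos h.le, show i - x.1 = i - (x.1 + 1) + 1 by omega]
        simp [h.ne]
      · rw [if_neg (by omega), if_pos h.le]
        simp [h]
      · simp [show ¬ x.1 + 1 ≤ i by omega, show ¬ x.1 ≤ i by omega, h.ne']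
  have := PolyTime.foldl (h := fun (a : α) (x : ℕ × β) b =>
    (x.1 + 1, if decide (x.1 = i a) then b else x.2)) (g := fun a => (0, d a)) hf
    ((PolyOn.const_nat _).pair hd) ((PolyTime.id.snd.fst.fst.add (.const_nat 1)).pair
      ((PolyTime.id.snd.fst.fst.eq_nat (hi.comp PolyTime.id.fst)).cond PolyTime.id.snd.snd
        PolyTime.id.snd.fst.snd)) ⟨_, .id, ?_⟩
  · convert PolyOn.snd this using 2 with a
    rw [key _ (d a)]
    simp
  · intro B a _ hf hg l₁ l₂ h
    rw [key _ (d a)]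
    have h1 := hf.1
    refine ⟨?_, ?_⟩
    · simp [h] at h1 ⊢
      omega
    · simp only [Nat.zero_le, if_true, Nat.sub_zero]
      by_cases hl : i a < l₁.length
      · rw [List.getD_eq_getElem _ _ hl]
        exact hf.2 _ (by simp [h])
      · rw [List.getD_eq_default _ _ (by omega)]
        exact hg.2

/-- The number of sections is a product of lengths, so the output size must be part of the domain.
The fold builds the sections of the suffixes of `L`. Each of them must be bounded, since one empty
list can make the final result small after large intermediate ones. -/
theorem PolyOn.sections :
    PolyOn (fun B L => Bdd B L ∧ ∀ L', L' <:+ L → L'.sections.length ≤ B)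
      (List.sections : List (List β) → List (List β)) := by
  have key : ∀ L : List (List β), L.reverse.foldl
      (fun acc l => acc.flatMap fun s => l.map fun a => a :: s) [[]] = L.sections := by
    intro L
    induction L with
    | nil => rfl
    | cons l L ih => rw [List.reverse_cons, List.foldl_append, ih]; rfl
  have := PolyOn.foldl (D := fun B L => Bdd B L ∧ ∀ L', L' <:+ L → L'.sections.length ≤ B)
    (E := Bdd) (f := List.reverse)
    (h := fun (_ : List (List β)) acc l => acc.flatMap fun s => l.map fun a => a :: s)
    (g := fun _ => [[]]) (PolyTime.on polyTime_reverse fun _ _ h => h.1)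
    (.cons .nil .nil) ?_ ⟨_, .id, ?_⟩
  · simpa [key] using this
  · refine PolyTime.flatMap 
      (g := fun (x : List (List β) × List (List β) × List β) s => x.2.2.map fun a => a :: s)
      PolyTime.id.snd.fst ?_
    exact PolyTime.map (g := fun (x : (List (List β) × List (List β) × List β) × List β) a =>
      a :: x.2) PolyTime.id.fst.snd.snd
      (PolyOn.cons PolyTime.id.snd PolyTime.id.fst.snd)
  · rintro B L ⟨hL, hL'⟩ l₁ l₂ h
    obtain ⟨L', rfl⟩ : ∃ L', l₁ = L'.reverse := ⟨l₁.reverse, by simp⟩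
    have hs : L' <:+ L := ⟨l₂.reverse, by rw [← List.reverse_reverse L, h]; simp⟩
    rw [key]
    have hb : Bdd B L'.sections := by
      refine ⟨hL' _ hs, fun s hs' => ?_⟩
      rw [List.mem_sections] at hs'
      refine ⟨hs'.length_eq.le.trans (hs.length_le.trans hL.1), fun b hb => ?_⟩
      obtain ⟨i, hi, rfl⟩ := List.mem_iff_getElem.1 hb
      have hi' : i < L'.length := hs'.length_eq ▸ hi
      exact (hL.2 _ (hs.subset (List.getElem_mem hi'))).2 _ (hs'.get hi hi')
    refine ⟨hb, ?_⟩
    rintro b l₃ rfl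
    refine ⟨hL, hb, hL.2 b ?_⟩
    rw [← List.mem_reverse, h]
    simp

end Closure

/-! ## The algorithm -/

/-- A graph with vertices `0, …, n - 1`, and a rooted tree with nodes `0, …, N - 1` and bags. -/
structure DecompData where
  n : ℕ
  N : ℕ
  r : ℕ
  adj : ℕ → ℕ → Bool
  child : ℕ → ℕ → Bool
  bag : ℕ → ℕ → Bool

/-- The class of a vertex (`0`: outside of the alliance; `1`: inside; `2`: inside and marginally
protected), the number of its forgotten neighbours in the alliance, and the number of its forgotten
neighbours of class `2`. -/
abbrev Entry : Type := ℕ × ℕ × ℕ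

/-- A node, the number of nodes up to which its children have been treated, the number of forgotten
vertices of the alliance, and the entries of all vertices, those outside of the bag being zero. -/
abbrev Record : Type := ℕ × ℕ × ℕ × List Entry

namespace DecompData

/-- The entry of the vertex `v`. -/
def entry (x : Record) (v : ℕ) : Entry := x.2.2.2.getD v (0, 0, 0)

/-- The class of the vertex `v`. -/
def cls (x : Record) (v : ℕ) : ℕ := (entry x v).1

variable (I : DecompData)

/-- The degree of the vertex `v`. -/
def deg (v : ℕ) : ℕ := (List.range I.n).countP (I.adj v)

/-- The local condition for a vertex of class `κ` and degree `δ` that has `a` neighbours in the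
alliance, `d` of them of class `2`. -/
def isGood (κ δ a d : ℕ) : Bool :=
  decide (κ = 0) || (decide (δ ≤ a + a + 1) && decide (1 ≤ d) &&
    (decide (κ ≤ 1) || decide (a + a ≤ δ)))

/-- The number of neighbours of `u` in the bag of `s` whose class is at least `c`. -/
def bagCount (s : ℕ) (g : Record) (c u : ℕ) : ℕ :=
  (List.range I.n).countP fun v => I.bag s v && (I.adj u v && decide (c ≤ cls g v))

/-- The number of neighbours of `u` that are in the bag of `s` but not of `t` and whose class is at
least `c`. -/
def forgetCount (t s : ℕ) (g : Record) (c u : ℕ) : ℕ :=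
  (List.range I.n).countP fun v =>
    (I.bag s v && !I.bag t v) && (I.adj u v && decide (c ≤ cls g v))

/-- The record `x` on the node `t` arises from the record `f` on `t` and the record `g` on the child `s`,
as far as the vertex `u` is concerned. -/
def isStepAt (f g x : Record) (u : ℕ) : Bool :=
  if I.bag x.1 u then
    decide (cls f u = cls x u) && (!I.bag g.1 u || decide (cls g u = cls x u)) &&
      decide ((entry x u).2.1 =
        (entry f u).2.1 + (entry g u).2.1 + I.forgetCount x.1 g.1 g 1 u) &&
      decide ((entry x u).2.2 =
        (entry f u).2.2 + (entry g u).2.2 + I.forgetCount x.1 g.1 g 2 u)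
  else
    !I.bag g.1 u || isGood (cls g u) (I.deg u) ((entry g u).2.1 + I.bagCount g.1 g 1 u)
      ((entry g u).2.2 + I.bagCount g.1 g 2 u)

/-- The record `x` on the node `t` arises from the record `f` on `t` and the record `g` on the child
`s`. -/
def isStep (f g x : Record) : Bool :=
  decide (x.2.2.1 = f.2.2.1 + g.2.2.1 + (List.range I.n).countP fun v =>
    (I.bag g.1 v && !I.bag x.1 v) && decide (1 ≤ cls g v)) &&
    (List.range I.n).all fun u => I.isStepAt f g x u

/-- The records `f` and `x` agree up to their second component. -/
def isSame (f x : Record) : Bool :=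
  decide (x.2.2.1 = f.2.2.1) && (List.range I.n).all fun u =>
    decide (cls f u = cls x u) && decide ((entry f u).2.1 = (entry x u).2.1) &&
      decide ((entry f u).2.2 = (entry x u).2.2)

/-- The record `x` holds before any child has been treated. -/
def isStart (x : Record) : Bool :=
  decide (x.2.2.1 = 0) && (List.range I.n).all fun u =>
    decide ((entry x u).2.1 = 0) && decide ((entry x u).2.2 = 0)

/-- The record `x` follows from the record `f` and records in the list `F`. -/
def followsFrom (F : List Record) (f x : Record) : Bool :=
  decide (f.1 = x.1) && decide (f.2.1 + 1 = x.2.1) &&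
    if I.child x.1 f.2.1 then
      F.any fun g => decide (g.1 = f.2.1) && decide (g.2.1 = I.N) && I.isStep f g x
    else I.isSame f x

/-- The record `x` follows from the records in the list `F`. -/
def follows (F : List Record) (x : Record) : Bool :=
  if decide (x.2.1 = 0) then I.isStart x else F.any fun f => I.followsFrom F f x

/-- The possible entries of the vertex `v` in a record on the node `t`. -/
def options (t v : ℕ) : List Entry :=
  if I.bag t v then
    (List.range 3).flatMap fun κ => (List.range (I.n + 1)).flatMap fun a =>
      (List.range (I.n + 1)).map fun d => (κ, a, d)
  else [(0, 0, 0)]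

/-- The possible lists of entries in a record on the node `t`. -/
def states (t : ℕ) : List (List Entry) :=
  ((List.range I.n).map (I.options t)).sections

/-- All candidates for records. -/
def candidates : List Record :=
  (List.range I.N).flatMap fun t => (I.states t).flatMap fun st =>
    (List.range (I.N + 1)).flatMap fun j => (List.range (I.n + 1)).map fun z => (t, j, z, st)

/-- The records that can be derived in `i` rounds. -/
def table : ℕ → List Record
  | 0 => []
  | i + 1 => I.candidates.filter (I.follows (table i))

/-- The result of the algorithm. -/
def answer : ℕ :=
  max 1 ((((I.table (I.N * (I.N + 1))).filter fun x =>
    decide (x.1 = I.r) && decide (x.2.1 = I.N)).map fun x => x.2.2.1).foldl max 0)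

end DecompData

/-! ## Counting -/

open Classical in
/-- The number of `v < n` with the property `P`. -/
noncomputable def cnt (n : ℕ) (P : ℕ → Prop) : ℕ := (List.range n).countP fun v => decide (P v)

theorem cnt_congr {n : ℕ} {P Q : ℕ → Prop} (h : ∀ v < n, P v ↔ Q v) : cnt n P = cnt n Q :=
  List.countP_congr fun v hv => by simpa using h v (List.mem_range.1 hv)

theorem countP_range {n : ℕ} (p : ℕ → Bool) : (List.range n).countP p = cnt n fun v => p v = true :=
  List.countP_congr fun v _ => by simp

theorem cnt_eq_zero {n : ℕ} {P : ℕ → Prop} (h : ∀ v < n, ¬ P v) : cnt n P = 0 :=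
  List.countP_eq_zero.2 fun v hv => by simpa using h v (List.mem_range.1 hv)

theorem cnt_le (n : ℕ) (P : ℕ → Prop) : cnt n P ≤ n :=
  List.countP_le_length.trans (by simp)

theorem cnt_add {n : ℕ} {P Q R : ℕ → Prop} (h : ∀ v < n, R v ↔ P v ∨ Q v)
    (hd : ∀ v < n, P v → ¬ Q v) : cnt n R = cnt n P + cnt n Q := by
  have key : ∀ l : List ℕ, (∀ v ∈ l, v < n) → ∀ (_ : DecidablePred P) (_ : DecidablePred Q)
      (_ : DecidablePred R), l.countP (fun v => decide (R v)) =
        l.countP (fun v => decide (P v)) + l.countP fun v => decide (Q v) := by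
    intro l
    induction l with
    | nil => simp
    | cons v l ih =>
      intro hl _ _ _
      have h1 := ih (fun w hw => hl w (by simp [hw])) inferInstance inferInstance inferInstance
      have h2 := h v (hl v (by simp))
      have h3 := hd v (hl v (by simp))
      simp only [List.countP_cons, h1, decide_eq_true_eq]
      by_cases hP : P v <;> by_cases hQ : Q v <;> simp_all <;> omega
  exact key _ (fun v hv => List.mem_range.1 hv) _ _ _

namespace DecompData

/-! ## Correctness of the dynamic program -/

variable (I : DecompData)

/-- `s` is a descendant of `t` (possibly `t` itself). -/
def Desc (t s : ℕ) : Prop := Relation.ReflTransGen (fun t s => I.child t s = true) t s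

/-- `s` is a proper descendant of `t`. -/
def ProperDesc (t s : ℕ) : Prop := Relation.TransGen (fun t s => I.child t s = true) t s

/-- The tree with its bags is a tree decomposition with an empty bag at the root: here `top v` is
the node closest to the root whose bag contains `v`, and `depth t` is the distance from the root. -/
structure Valid (top depth : ℕ → ℕ) : Prop where
  adj_symm : ∀ u v, I.adj u v = true → I.adj v u = true
  child_lt : ∀ t s, I.child t s = true → s < I.N
  depth_child : ∀ t s, I.child t s = true → depth s = depth t + 1
  parent_unique : ∀ t t' s, I.child t s = true → I.child t' s = true → t = t'
  depth_lt : ∀ t < I.N, depth t < I.N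
  depth_top_le : ∀ t, ∀ v < I.n, I.bag t v = true → depth (top v) ≤ depth t
  top_eq_iff : ∀ t s, I.child t s = true → ∀ v < I.n,
    (top v = s ↔ I.bag s v = true ∧ I.bag t v = false)
  separation : ∀ s, ∀ u < I.n, ∀ v < I.n, I.adj v u = true → I.Desc s (top v) →
    I.bag s u = true ∨ I.ProperDesc s (top u)
  root_lt : I.r < I.N
  root_depth : depth I.r = 0
  root_desc : ∀ v < I.n, I.ProperDesc I.r (top v)

/-- The vertices that have been forgotten when the children of `t` below `j` have been treated. -/
def region (top : ℕ → ℕ) (t j v : ℕ) : Prop :=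
  ∃ s < j, I.child t s = true ∧ I.Desc s (top v)

/-- The number of neighbours of `u` with the property `D` whose class is at least `c`. -/
noncomputable def nb (σ : ℕ → ℕ) (D : ℕ → Prop) (c u : ℕ) : ℕ :=
  cnt I.n fun v => D v ∧ I.adj u v = true ∧ c ≤ σ v

/-- The number of vertices with the property `D` in the alliance. -/
noncomputable def size (σ : ℕ → ℕ) (D : ℕ → Prop) : ℕ := cnt I.n fun v => D v ∧ 1 ≤ σ v

/-- The local condition at the vertex `v`. -/
def Good (σ : ℕ → ℕ) (v : ℕ) : Prop :=
  isGood (σ v) (I.deg v) (I.nb σ (fun _ => True) 1 v) (I.nb σ (fun _ => True) 2 v) = true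

/-- The record `x` describes the classes `σ`. -/
structure Describes (top : ℕ → ℕ) (σ : ℕ → ℕ) (x : Record) : Prop where
  inside : ∀ u < I.n, I.bag x.1 u = true → entry x u =
    (σ u, I.nb σ (I.region top x.1 x.2.1) 1 u, I.nb σ (I.region top x.1 x.2.1) 2 u)
  outside : ∀ u < I.n, I.bag x.1 u = false → entry x u = (0, 0, 0)
  size_eq : x.2.2.1 = I.size σ (I.region top x.1 x.2.1)
  good : ∀ v < I.n, I.region top x.1 x.2.1 v → I.Good σ v

variable {I} {top depth : ℕ → ℕ} {σ τ : ℕ → ℕ}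

theorem nb_congr {D : ℕ → Prop} {c u : ℕ}
    (h : ∀ v < I.n, D v → I.adj u v = true → σ v = τ v) : I.nb σ D c u = I.nb τ D c u :=
  cnt_congr fun v hv => and_congr_right fun hD => and_congr_right fun ha => by rw [h v hv hD ha]

theorem nb_add {D E F : ℕ → Prop} {c u : ℕ}
    (h : ∀ v < I.n, I.adj u v = true → (F v ↔ D v ∨ E v)) (hd : ∀ v < I.n, D v → ¬ E v) :
    I.nb σ F c u = I.nb σ D c u + I.nb σ E c u :=
  cnt_add (fun v hv => by have := h v hv; tauto) fun v hv h1 h2 => hd v hv h1.1 h2.1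

/-- The condition sees only the closed neighbourhood of `v`; this is what makes gluing possible. -/
theorem Good.congr {v : ℕ} (hv : σ v = τ v) (h : ∀ u < I.n, I.adj v u = true → σ u = τ u)
    (hσ : I.Good σ v) : I.Good τ v := by
  unfold Good at *
  rwa [← hv, nb_congr (τ := σ) fun u hu _ ha => (h u hu ha).symm,
    nb_congr (τ := σ) fun u hu _ ha => (h u hu ha).symm]

/-! ### Growth of the set of forgotten vertices -/

namespace Valid

theorem depth_le_of_desc (hI : I.Valid top depth)
    {t s : ℕ} (h : I.Desc t s) : depth t ≤ depth s := by
  induction h with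
  | refl => rfl
  | tail _ h ih => rw [hI.depth_child _ _ h]; omega

theorem depth_lt_of_properDesc (hI : I.Valid top depth)
    {t s : ℕ} (h : I.ProperDesc t s) : depth t < depth s := by
  obtain ⟨u, h1, h2⟩ := Relation.TransGen.head'_iff.1 h
  have := hI.depth_le_of_desc h2
  rw [hI.depth_child _ _ h1] at this
  omega

theorem desc_eq_of_depth_eq (hI : I.Valid top depth)
    {s s' : ℕ} (h : I.Desc s s') (hd : depth s = depth s') : s = s' := by
  rcases Relation.reflTransGen_iff_eq_or_transGen.1 h with h | h
  · exact h.symm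
  · have := hI.depth_lt_of_properDesc h
    omega

/-- Parents are unique, so the ancestors of `x` form a chain, which meets each depth at most once.
-/
theorem desc_unique (hI : I.Valid top depth)
    {s s' x : ℕ} (h : I.Desc s x) (h' : I.Desc s' x) (hd : depth s = depth s') :
    s = s' := by
  induction h with
  | refl => exact (hI.desc_eq_of_depth_eq h' hd.symm).symm
  | @tail y x h hc ih =>
    rcases Relation.ReflTransGen.cases_tail h' with rfl | ⟨y', h1, h2⟩
    · have := hI.depth_le_of_desc h
      have := hI.depth_child _ _ hc
      omega
    · rw [hI.parent_unique _ _ _ h2 hc] at h1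
      exact ih h1

theorem not_desc_of_bag (hI : I.Valid top depth)
    {t s u : ℕ} (hc : I.child t s = true) (hu : u < I.n)
    (hb : I.bag t u = true) : ¬ I.Desc s (top u) := fun h => by
  have := hI.depth_top_le t u hu hb
  have := hI.depth_le_of_desc h
  have := hI.depth_child _ _ hc
  omega

theorem region_full_iff (hI : I.Valid top depth)
    {s v : ℕ} : I.region top s I.N v ↔ I.ProperDesc s (top v) := by
  rw [ProperDesc, Relation.TransGen.head'_iff]
  exact ⟨fun ⟨c, _, h1, h2⟩ => ⟨c, h1, h2⟩, fun ⟨c, h1, h2⟩ => ⟨c, hI.child_lt _ _ h1, h1, h2⟩⟩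

/-- A vertex with its top node in the subtree of `s` was forgotten below `s`, or its top node is `s`
and it is forgotten on the way to `t`. -/
theorem desc_top_iff (hI : I.Valid top depth)
    {t s : ℕ} (hc : I.child t s = true) {v : ℕ} (hv : v < I.n) :
    I.Desc s (top v) ↔ I.region top s I.N v ∨ (I.bag s v = true ∧ I.bag t v = false) := by
  rw [hI.region_full_iff, ← hI.top_eq_iff t s hc v hv, or_comm]
  exact Relation.reflTransGen_iff_eq_or_transGen

theorem not_region_full_of_bag (hI : I.Valid top depth)
    {s v : ℕ} (hv : v < I.n) (hb : I.bag s v = true) :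
    ¬ I.region top s I.N v := fun h => by
  have := hI.depth_top_le s v hv hb
  have := hI.depth_lt_of_properDesc (hI.region_full_iff.1 h)
  omega

theorem region_succ_iff {t j v : ℕ} (hc : I.child t j = true) :
    I.region top t (j + 1) v ↔ I.region top t j v ∨ I.Desc j (top v) := by
  constructor
  · rintro ⟨s, hs, h1, h2⟩
    rcases Nat.lt_succ_iff_lt_or_eq.1 hs with hs | rfl
    · exact .inl ⟨s, hs, h1, h2⟩
    · exact .inr h2
  · rintro (⟨s, hs, h⟩ | h)
    · exact ⟨s, by omega, h⟩
    · exact ⟨j, by omega, hc, h⟩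

theorem region_succ_iff_of_not_child {t j v : ℕ} (hc : I.child t j = false) :
    I.region top t (j + 1) v ↔ I.region top t j v := by
  constructor
  · rintro ⟨s, hs, h1, h2⟩
    rcases Nat.lt_succ_iff_lt_or_eq.1 hs with hs | rfl
    · exact ⟨s, hs, h1, h2⟩
    · simp [hc] at h1
  · rintro ⟨s, hs, h⟩
    exact ⟨s, by omega, h⟩

theorem not_desc_of_region (hI : I.Valid top depth)
    {t j v : ℕ} (hc : I.child t j = true) (h : I.region top t j v) :
    ¬ I.Desc j (top v) := fun h' => by
  obtain ⟨s, hs, h1, h2⟩ := h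
  have := hI.desc_unique h2 h' (by rw [hI.depth_child _ _ h1, hI.depth_child _ _ hc])
  omega

/-- No edge joins vertices forgotten in different child subtrees: by separation, a neighbour of such
a vertex is forgotten in the same subtree or lies in the bag of `t`. -/
theorem not_desc_of_region_of_adj (hI : I.Valid top depth) {t j u v : ℕ} (hc : I.child t j = true)
    (h : I.region top t j v) (hu : u < I.n) (hv : v < I.n) (ha : I.adj v u = true) :
    ¬ I.Desc j (top u) := by
  obtain ⟨s, hs, h1, h2⟩ := h
  rcases hI.separation s u hu v hv ha h2 with h3 | h3
  · cases hb : I.bag t u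
    · have := (hI.top_eq_iff t s h1 u hu).2 ⟨h3, hb⟩
      exact hI.not_desc_of_region hc ⟨s, hs, h1, this ▸ .refl⟩
    · exact hI.not_desc_of_bag hc hu hb
  · exact hI.not_desc_of_region hc ⟨s, hs, h1, h3.to_reflTransGen⟩

/-- Behind the case distinction: if `u` is not in the bag of `j`, a neighbour forgotten below `j`
would force `u` itself below `j`, which is impossible for a vertex in the bag of `t`. This agrees
with the zero entries of records outside of the bag. -/
theorem nb_region_succ (hI : I.Valid top depth) {t j u : ℕ} (hc : I.child t j = true) (hu : u < I.n)
    (hb : I.bag t u = true) (c : ℕ) :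
    I.nb σ (I.region top t (j + 1)) c u = I.nb σ (I.region top t j) c u +
      (if I.bag j u then I.nb σ (I.region top j I.N) c u else 0) +
      I.nb σ (fun v => I.bag j v = true ∧ I.bag t v = false) c u := by
  rw [nb_add (D := I.region top t j) (E := fun v => I.Desc j (top v))
    (fun v _ _ => region_succ_iff hc) (fun v _ => hI.not_desc_of_region hc),
    nb_add (D := I.region top j I.N) (E := fun v => I.bag j v = true ∧ I.bag t v = false)
    (fun v hv _ => hI.desc_top_iff hc hv)
    (fun v hv h1 h2 => hI.not_region_full_of_bag hv h2.1 h1), add_assoc]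
  split
  · rfl
  · next h =>
    rw [show I.nb σ (I.region top j I.N) c u = 0 from cnt_eq_zero fun v hv ⟨h1, h2, _⟩ => ?_]
    rw [hI.region_full_iff] at h1
    rcases hI.separation j u hu v hv (hI.adj_symm _ _ h2) h1.to_reflTransGen with h3 | h3
    · exact h h3
    · exact hI.not_desc_of_bag hc hu hb h3.to_reflTransGen

/-- At its top node, every neighbour of `v` is in the bag or forgotten, so the counts are final. -/
theorem nb_top (hI : I.Valid top depth)
    {t s v : ℕ} (hc : I.child t s = true) (hv : v < I.n) (hs : I.bag s v = true)
    (ht : I.bag t v = false) (c : ℕ) :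
    I.nb σ (fun _ => True) c v =
      I.nb σ (I.region top s I.N) c v + I.nb σ (fun v => I.bag s v = true) c v := by
  refine nb_add (fun u hu ha => ?_) fun u hu h1 h2 => hI.not_region_full_of_bag hu h2 h1
  have := hI.separation s u hu v hv ha ((hI.top_eq_iff t s hc v hv).2 ⟨hs, ht⟩ ▸ .refl)
  rw [hI.region_full_iff]
  tauto

theorem size_region_succ (hI : I.Valid top depth) {t j : ℕ} (hc : I.child t j = true) :
    I.size σ (I.region top t (j + 1)) = I.size σ (I.region top t j) +
      I.size σ (I.region top j I.N) +
      I.size σ (fun v => I.bag j v = true ∧ I.bag t v = false) := by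
  have h1 : I.size σ (I.region top t (j + 1)) = I.size σ (I.region top t j) +
      I.size σ (fun v => I.Desc j (top v)) :=
    cnt_add (fun v _ => by rw [region_succ_iff hc]; tauto)
      fun v _ h1 h2 => hI.not_desc_of_region hc h1.1 h2.1
  have h2 : I.size σ (fun v => I.Desc j (top v)) = I.size σ (I.region top j I.N) +
      I.size σ (fun v => I.bag j v = true ∧ I.bag t v = false) :=
    cnt_add (fun v hv => by have := hI.desc_top_iff hc hv; tauto)
      fun v hv h1 h2 => hI.not_region_full_of_bag hv h2.1.1 h1.1
  omega

end Valid

end DecompData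

theorem le_foldl_max {l : List ℕ} {a : ℕ} (h : a ∈ l) : a ≤ l.foldl max 0 := by
  have key : ∀ (l : List ℕ) m, m ≤ l.foldl max m ∧ ∀ a ∈ l, a ≤ l.foldl max m := by
    intro l
    induction l with
    | nil => simp
    | cons b l ih =>
      intro m
      obtain ⟨h1, h2⟩ := ih (max m b)
      refine ⟨(le_max_left _ _).trans h1, fun a ha => ?_⟩
      rcases List.mem_cons.1 ha with rfl | ha
      · exact (le_max_right _ _).trans h1
      · exact h2 a ha
  exact (key l 0).2 a h

theorem foldl_max_mem (l : List ℕ) : l.foldl max 0 = 0 ∨ l.foldl max 0 ∈ l := by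
  have key : ∀ (l : List ℕ) m, l.foldl max m = m ∨ l.foldl max m ∈ l := by
    intro l
    induction l with
    | nil => simp
    | cons b l ih =>
      intro m
      rcases ih (max m b) with h | h
      · rw [List.foldl_cons, h]
        rcases max_choice m b with h' | h' <;> simp [h']
      · simp [h]
  exact key l 0

/-! ### Soundness: every derived record describes a class function -/

namespace DecompData

variable {I : DecompData} {top depth : ℕ → ℕ} {σ τ : ℕ → ℕ}

theorem entry_mem_options {t : ℕ} {st : List Entry} (h : st ∈ I.states t) {u : ℕ} (hu : u < I.n) :
    st.getD u (0, 0, 0) ∈ I.options t u := by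
  rw [states, List.mem_sections] at h
  have hl : u < st.length := by rw [h.length_eq]; simpa using hu
  have h' := h.get hl (by simpa using hu)
  rw [List.getD_eq_getElem _ _ hl]
  simpa using h'

theorem map_mem_states {t : ℕ} {f : ℕ → Entry} (h : ∀ u < I.n, f u ∈ I.options t u) :
    (List.range I.n).map f ∈ I.states t := by
  rw [states, List.mem_sections, List.forall₂_map_left_iff, List.forall₂_map_right_iff,
    List.forall₂_same]
  exact fun u hu => h u (List.mem_range.1 hu)

theorem mem_candidates {x : Record} : x ∈ I.candidates ↔
    x.1 < I.N ∧ x.2.1 < I.N + 1 ∧ x.2.2.1 < I.n + 1 ∧ x.2.2.2 ∈ I.states x.1 := by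
  obtain ⟨t, j, z, st⟩ := x
  simp only [candidates, List.mem_flatMap, List.mem_range, List.mem_map, Prod.mk.injEq]
  constructor
  · rintro ⟨t', ht, st', hst, j', hj, z', hz, rfl, rfl, rfl, rfl⟩
    exact ⟨ht, hj, hz, hst⟩
  · rintro ⟨ht, hj, hz, hst⟩
    exact ⟨t, ht, st, hst, j, hj, z, hz, rfl, rfl, rfl, rfl⟩

theorem entry_outside {x : Record} (hx : x ∈ I.candidates) {u : ℕ} (hu : u < I.n)
    (hb : I.bag x.1 u = false) : entry x u = (0, 0, 0) := by
  have : entry x u ∈ _ := entry_mem_options (mem_candidates.1 hx).2.2.2 hu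
  simpa only [options, hb, Bool.false_eq_true, if_false, List.mem_singleton] using this

theorem Describes.cls_eq {x : Record} (h : I.Describes top σ x) {u : ℕ} (hu : u < I.n)
    (hb : I.bag x.1 u = true) : cls x u = σ u := by
  rw [cls, h.inside u hu hb]

theorem bagCount_eq {g : Record} (h : I.Describes top σ g) (c u : ℕ) :
    I.bagCount g.1 g c u = I.nb σ (fun v => I.bag g.1 v = true) c u := by
  rw [bagCount, countP_range]
  refine cnt_congr fun v hv => ?_
  cases hb : I.bag g.1 v
  · simp [hb]
  · simp [hb, h.cls_eq hv hb]

theorem forgetCount_eq {t : ℕ} {g : Record} (h : I.Describes top σ g) (c u : ℕ) :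
    I.forgetCount t g.1 g c u =
      I.nb σ (fun v => I.bag g.1 v = true ∧ I.bag t v = false) c u := by
  rw [forgetCount, countP_range]
  refine cnt_congr fun v hv => ?_
  cases hb : I.bag g.1 v
  · simp [hb]
  · simp [hb, h.cls_eq hv hb]

theorem forgetSize_eq {t : ℕ} {g : Record} (h : I.Describes top σ g) :
    ((List.range I.n).countP fun v => (I.bag g.1 v && !I.bag t v) && decide (1 ≤ cls g v)) =
      I.size σ (fun v => I.bag g.1 v = true ∧ I.bag t v = false) := by
  rw [countP_range]
  refine cnt_congr fun v hv => ?_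
  cases hb : I.bag g.1 v
  · simp [hb]
  · simp [hb, h.cls_eq hv hb]

/-- Nothing is forgotten yet, so only the classes on the bag matter, and these can be read off the
record. -/
theorem describes_start {x : Record} (hx : x ∈ I.candidates) (hj : x.2.1 = 0)
    (h : I.isStart x = true) : I.Describes top (cls x) x := by
  simp only [isStart, Bool.and_eq_true, decide_eq_true_eq, List.all_eq_true, List.mem_range] at h
  have hr : ∀ v, ¬ I.region top x.1 x.2.1 v := by
    rintro v ⟨s, hs, -⟩
    omega
  refine ⟨fun u hu hb => ?_, fun u hu => entry_outside hx hu, ?_, fun v _ hv => (hr v hv).elim⟩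
  · have h0 : ∀ c, I.nb (cls x) (I.region top x.1 x.2.1) c u = 0 :=
      fun c => cnt_eq_zero fun v _ h => hr v h.1
    rw [h0, h0]
    exact Prod.ext rfl (Prod.ext (h.2 u hu).1 (h.2 u hu).2)
  · rw [h.1]
    exact (cnt_eq_zero fun v _ h => hr v h.1).symm

theorem describes_same {f x : Record} (hx : x ∈ I.candidates) (hf : I.Describes top σ f)
    (ht : f.1 = x.1) (hj : f.2.1 + 1 = x.2.1) (hc : I.child x.1 f.2.1 = false)
    (h : I.isSame f x = true) : I.Describes top σ x := by
  simp only [isSame, Bool.and_eq_true, decide_eq_true_eq, List.all_eq_true, List.mem_range] at h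
  have hr : I.region top x.1 x.2.1 = I.region top f.1 f.2.1 := by
    rw [← hj, ht]
    exact funext fun v => propext (Valid.region_succ_iff_of_not_child hc)
  refine ⟨fun u hu hb => ?_, fun u hu => entry_outside hx hu, ?_, fun v hv hvr => ?_⟩
  · rw [hr, ← hf.inside u hu (ht ▸ hb)]
    obtain ⟨⟨h1, h2⟩, h3⟩ := h.2 u hu
    exact Prod.ext h1.symm (Prod.ext h2.symm h3.symm)
  · rw [h.1, hr, hf.size_eq]
  · exact hf.good v hv (hr ▸ hvr)

namespace Valid

open Classical in
-- Gluing: `τ` is used on the vertices forgotten by the time `s` has been treated in `t`, among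
-- those in the subtree of `s`, and `σ` everywhere else. The two agree on vertices in both bags
-- because the step compares classes there.
theorem describes_step (hI : I.Valid top depth)
    {f g x : Record} (hx : x ∈ I.candidates) (hf : I.Describes top σ f)
    (hg : I.Describes top τ g) (ht : f.1 = x.1) (hj : f.2.1 + 1 = x.2.1) (hgt : g.1 = f.2.1)
    (hgj : g.2.1 = I.N) (hc : I.child x.1 f.2.1 = true) (h : I.isStep f g x = true) :
    I.Describes top (fun v => if I.Desc f.2.1 (top v) then τ v else σ v) x := by
  obtain ⟨t, j, z, st⟩ := x
  obtain ⟨t', j', zf, stf⟩ := f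
  obtain ⟨s, j'', zg, stg⟩ := g
  dsimp only at ht hj hgt hgj hc
  subst ht hj hgt hgj
  set f : Record := (t', s, zf, stf) with hfd
  set g : Record := (s, I.N, zg, stg) with hgd
  set x : Record := (t', s + 1, z, st) with hxd
  set ρ : ℕ → ℕ := fun v => if I.Desc s (top v) then τ v else σ v with hρ
  have hρτ : ∀ v, I.Desc s (top v) → ρ v = τ v := fun v h => if_pos h
  have hρσ : ∀ v, ¬ I.Desc s (top v) → ρ v = σ v := fun v h => if_neg h
  simp only [isStep, Bool.and_eq_true, decide_eq_true_eq, List.all_eq_true, List.mem_range] at h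
  obtain ⟨hz, hst⟩ := h
  have hbag : ∀ u < I.n, I.bag t' u = true → cls x u = σ u ∧
      (I.bag s u = true → cls x u = τ u) ∧
      (entry x u).2.1 = (entry f u).2.1 + (entry g u).2.1 + I.forgetCount t' s g 1 u ∧
      (entry x u).2.2 = (entry f u).2.2 + (entry g u).2.2 + I.forgetCount t' s g 2 u := by
    intro u hu hb
    have := hst u hu
    rw [isStepAt, if_pos hb] at this
    simp only [Bool.and_eq_true, Bool.or_eq_true, Bool.not_eq_true', decide_eq_true_eq] at this
    obtain ⟨⟨⟨h1, h2⟩, h3⟩, h4⟩ := this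
    refine ⟨by rw [← h1, hf.cls_eq hu hb], fun hb' => ?_, h3, h4⟩
    rcases h2 with h2 | h2
    · simp [hgd, hb'] at h2
    · rw [← h2, hg.cls_eq hu hb']
  -- The vertices forgotten between `s` and `t'` are tested with their final counts.
  have hgood : ∀ u < I.n, I.bag t' u = false → I.bag s u = true → I.Good τ u := by
    intro u hu hb hb'
    have := hst u hu
    rw [isStepAt, if_neg (by simp [hxd, hb])] at this
    simp only [Bool.or_eq_true, Bool.not_eq_true'] at this
    rcases this with h2 | h2
    · simp [hgd, hb'] at h2
    · rw [hg.cls_eq hu hb', hg.inside u hu hb', bagCount_eq hg, bagCount_eq hg] at h2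
      rw [Good, hI.nb_top hc hu hb' hb, hI.nb_top hc hu hb' hb]
      exact h2
  have hτ : ∀ D : ℕ → Prop, (∀ v < I.n, D v → I.Desc s (top v)) → ∀ c u,
      I.nb ρ D c u = I.nb τ D c u :=
    fun D hD c u => nb_congr fun v hv h _ => hρτ v (hD v hv h)
  have hfull : ∀ v < I.n, I.region top s I.N v → I.Desc s (top v) :=
    fun v hv h => (hI.desc_top_iff hc hv).2 (.inl h)
  have hforg : ∀ v < I.n, I.bag s v = true ∧ I.bag t' v = false → I.Desc s (top v) :=
    fun v hv h => (hI.desc_top_iff hc hv).2 (.inr h)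
  refine ⟨fun u hu hb => ?_, fun u hu => entry_outside hx hu, ?_, fun v hv hvr => ?_⟩
  · obtain ⟨h1, h2, h3, h4⟩ := hbag u hu hb
    have hnb : ∀ c, I.nb ρ (I.region top t' (s + 1)) c u = I.nb σ (I.region top t' s) c u +
        (if I.bag s u then I.nb τ (I.region top s I.N) c u else 0) + I.forgetCount t' s g c u := by
      intro c
      rw [hI.nb_region_succ hc hu hb, hτ _ hfull, hτ _ hforg,
        nb_congr (τ := σ) fun v hv h _ => hρσ v (hI.not_desc_of_region hc h)]
      rw [← forgetCount_eq hg]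
    have hge : (entry g u).2.1 = (if I.bag s u then I.nb τ (I.region top s I.N) 1 u else 0) ∧
        (entry g u).2.2 = (if I.bag s u then I.nb τ (I.region top s I.N) 2 u else 0) := by
      cases hb' : I.bag s u
      · rw [hg.outside u hu hb']
        simp
      · rw [hg.inside u hu hb']
        simp [hgd]
    have hfe := hf.inside u hu hb
    refine Prod.ext (h1.trans (hρσ u (hI.not_desc_of_bag hc hu hb)).symm) (Prod.ext ?_ ?_)
    · rw [h3, hge.1, hfe]
      exact (hnb 1).symm
    · rw [h4, hge.2, hfe]
      exact (hnb 2).symm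
  · rw [hz, hf.size_eq, hg.size_eq, forgetSize_eq hg]
    change _ = I.size ρ (I.region top t' (s + 1))
    rw [hI.size_region_succ hc]
    refine congrArg₂ _ (congrArg₂ _ (cnt_congr fun v hv => ?_) (cnt_congr fun v hv => ?_))
      (cnt_congr fun v hv => ?_)
    · exact and_congr_right fun h => by rw [hρσ v (hI.not_desc_of_region hc h)]
    · exact and_congr_right fun h => by rw [hρτ v (hfull v hv h)]
    · exact and_congr_right fun h => by rw [hρτ v (hforg v hv h)]
  · change I.region top t' (s + 1) v at hvr
    rcases (region_succ_iff hc).1 hvr with hvr | hvr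
    · refine (hf.good v hv hvr).congr (hρσ v (hI.not_desc_of_region hc hvr)).symm
        fun u hu ha => (hρσ u (hI.not_desc_of_region_of_adj hc hvr hu hv ha)).symm
    · have hv' : I.Good τ v := by
        rcases (hI.desc_top_iff hc hv).1 hvr with h | h
        · exact hg.good v hv h
        · exact hgood v hv h.2 h.1
      refine hv'.congr (hρτ v hvr).symm fun u hu ha => ?_
      by_cases hu' : I.Desc s (top u)
      · exact (hρτ u hu').symm
      rw [hρσ u hu']
      rw [hI.desc_top_iff hc hu, hI.region_full_iff] at hu'
      -- A neighbour of `v` that is not forgotten with `s` lies in both bags, where `σ` and `τ`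
      -- coincide.
      rcases hI.separation s u hu v hv ha hvr with h | h
      · have hb : I.bag t' u = true := by
          by_contra hb
          exact hu' (.inr ⟨h, by simpa using hb⟩)
        rw [← (hbag u hu hb).1, (hbag u hu hb).2.1 h]
      · exact (hu' (.inl h)).elim

theorem exists_describes (hI : I.Valid top depth)
    (i : ℕ) : ∀ x ∈ I.table i, ∃ σ, I.Describes top σ x := by
  induction i with
  | zero => simp [table]
  | succ i ih =>
    intro x hx
    obtain ⟨hx, hfo⟩ := List.mem_filter.1 hx
    rw [follows] at hfo
    split at hfo
    · next hj => exact ⟨_, describes_start hx (by simpa using hj) hfo⟩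
    · obtain ⟨f, hf, hff⟩ := List.any_eq_true.1 hfo
      obtain ⟨σ, hσ⟩ := ih f hf
      simp only [followsFrom, Bool.and_eq_true, decide_eq_true_eq] at hff
      obtain ⟨⟨ht, hj⟩, hff⟩ := hff
      split at hff
      · next hc =>
        obtain ⟨g, hg, hgg⟩ := List.any_eq_true.1 hff
        simp only [Bool.and_eq_true, decide_eq_true_eq] at hgg
        obtain ⟨τ, hτ⟩ := ih g hg
        exact ⟨_, hI.describes_step hx hσ hτ ht hj hgg.1.1 hgg.1.2 hc hgg.2⟩
      · next hc => exact ⟨σ, describes_same hx hσ ht hj (by simpa using hc) hff⟩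

end Valid

/-! ### Completeness: the records of a good class function are derived -/

/-- The record on the node `t` that describes the classes `σ`. -/
noncomputable def record (I : DecompData) (top σ : ℕ → ℕ) (t j : ℕ) : Record :=
  (t, j, I.size σ (I.region top t j), (List.range I.n).map fun u =>
    if I.bag t u then (σ u, I.nb σ (I.region top t j) 1 u, I.nb σ (I.region top t j) 2 u)
    else (0, 0, 0))

theorem entry_record {t j u : ℕ} (hu : u < I.n) : entry (I.record top σ t j) u =
    if I.bag t u then (σ u, I.nb σ (I.region top t j) 1 u, I.nb σ (I.region top t j) 2 u)
    else (0, 0, 0) := by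
  rw [entry, record, List.getD_eq_getElem _ _ (by simpa using hu)]
  simp

theorem describes_record (hσ : ∀ v < I.n, I.Good σ v) (t j : ℕ) :
    I.Describes top σ (I.record top σ t j) :=
  ⟨fun u hu hb => by
    rw [entry_record hu, if_pos (show I.bag t u = true from hb)]; rfl, fun u hu hb => by
    rw [entry_record hu]; simpa using fun h => absurd (h.symm.trans hb) (by simp), rfl,
    fun v hv _ => hσ v hv⟩

theorem record_mem_candidates (h2 : ∀ v, σ v ≤ 2) {t j : ℕ} (ht : t < I.N) (hj : j ≤ I.N) :
    I.record top σ t j ∈ I.candidates := by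
  refine mem_candidates.2 ⟨ht, Nat.lt_succ_of_le hj, Nat.lt_succ_of_le (cnt_le _ _),
    map_mem_states fun u hu => ?_⟩
  change _ ∈ I.options t u
  rw [options]
  split
  · simp only [List.mem_flatMap, List.mem_map, List.mem_range, Prod.mk.injEq]
    exact ⟨σ u, Nat.lt_succ_of_le (h2 u), _, Nat.lt_succ_of_le (cnt_le _ _), _,
      Nat.lt_succ_of_le (cnt_le _ _), rfl, rfl, rfl⟩
  · simp

theorem isStart_record (t : ℕ) : I.isStart (I.record top σ t 0) = true := by
  have hr : ∀ v, ¬ I.region top t 0 v := by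
    rintro v ⟨s, hs, -⟩
    omega
  have h0 : ∀ c u, I.nb σ (I.region top t 0) c u = 0 :=
    fun c u => cnt_eq_zero fun v _ h => hr v h.1
  simp only [isStart, Bool.and_eq_true, decide_eq_true_eq, List.all_eq_true, List.mem_range]
  refine ⟨cnt_eq_zero fun v _ h => hr v h.1, fun u hu => ?_⟩
  rw [entry_record hu, h0, h0]
  split <;> simp

theorem isSame_record {t j : ℕ} (hc : I.child t j = false) :
    I.isSame (I.record top σ t j) (I.record top σ t (j + 1)) = true := by
  have hr : I.region top t (j + 1) = I.region top t j :=
    funext fun v => propext (Valid.region_succ_iff_of_not_child hc)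
  simp only [isSame, Bool.and_eq_true, decide_eq_true_eq, List.all_eq_true, List.mem_range, cls]
  refine ⟨by simp only [record, hr], fun u hu => ?_⟩
  simp [entry_record hu, hr]

namespace Valid

theorem isStep_record (hI : I.Valid top depth)
    (hσ : ∀ v < I.n, I.Good σ v) {t s : ℕ} (hc : I.child t s = true) :
    I.isStep (I.record top σ t s) (I.record top σ s I.N) (I.record top σ t (s + 1)) = true := by
  have hg := describes_record (top := top) hσ s I.N
  simp only [isStep, Bool.and_eq_true, decide_eq_true_eq, List.all_eq_true, List.mem_range]
  refine ⟨?_, fun u hu => ?_⟩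
  · rw [forgetSize_eq hg]
    exact hI.size_region_succ hc
  rw [isStepAt]
  have hforg : ∀ c, I.forgetCount t s (I.record top σ s I.N) c u = _ :=
    fun c => forgetCount_eq hg c u
  have hcount : ∀ c, I.bagCount s (I.record top σ s I.N) c u = _ := fun c => bagCount_eq hg c u
  simp only [show (I.record top σ t (s + 1)).1 = t from rfl,
    show (I.record top σ s I.N).1 = s from rfl, cls, entry_record hu, hforg, hcount]
  cases hb : I.bag t u
  · cases hb' : I.bag s u
    · simp
    · have := hσ u hu
      rw [Good, hI.nb_top hc hu hb' hb, hI.nb_top hc hu hb' hb] at this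
      simpa using this
  · have h1 := hI.nb_region_succ (σ := σ) hc hu hb
    cases hb' : I.bag s u <;> simp [hb', h1]

/-- Deeper nodes come first, and each level of the tree takes `N + 1` rounds, one for every value of
`j` from `0` to `N`. -/
theorem record_mem_table (hI : I.Valid top depth)
    (h2 : ∀ v, σ v ≤ 2) (hσ : ∀ v < I.n, I.Good σ v) (i : ℕ) :
    ∀ t j, t < I.N → j ≤ I.N → (I.N - 1 - depth t) * (I.N + 1) + j + 1 ≤ i →
      I.record top σ t j ∈ I.table i := by
  induction i with
  | zero => omega
  | succ i ih =>
    intro t j ht hj hi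
    refine List.mem_filter.2 ⟨record_mem_candidates h2 ht hj, ?_⟩
    rw [follows]
    rcases j with _ | j
    · rw [if_pos (by simp [record])]
      exact isStart_record t
    · rw [if_neg (by simp [record])]
      refine List.any_eq_true.2 ⟨_, ih t j ht (by omega) (by omega), ?_⟩
      simp only [followsFrom, Bool.and_eq_true, decide_eq_true_eq]
      refine ⟨⟨rfl, rfl⟩, ?_⟩
      split
      · next hc =>
        change I.child t j = true at hc
        have hj' := hI.child_lt _ _ hc
        have hd := hI.depth_child _ _ hc
        have hdl := hI.depth_lt j hj'
        refine List.any_eq_true.2 ⟨_, ih j I.N hj' le_rfl ?_, ?_⟩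
        · have : I.N - 1 - depth t = I.N - 1 - depth j + 1 := by omega
          rw [this, Nat.succ_mul] at hi
          omega
        · simp only [Bool.and_eq_true, decide_eq_true_eq]
          exact ⟨⟨rfl, rfl⟩, hI.isStep_record hσ hc⟩
      · next hc =>
        change ¬ I.child t j = true at hc
        exact isSame_record (by simpa using hc)

theorem exists_mem_table_iff (hI : I.Valid top depth) (z : ℕ) :
    (∃ x ∈ I.table (I.N * (I.N + 1)), x.1 = I.r ∧ x.2.1 = I.N ∧ x.2.2.1 = z) ↔
      ∃ σ, (∀ v < I.n, I.Good σ v) ∧ I.size σ (fun _ => True) = z := by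
  have hreg : ∀ v < I.n, I.region top I.r I.N v :=
    fun v hv => hI.region_full_iff.2 (hI.root_desc v hv)
  have hsize : ∀ σ, I.size σ (I.region top I.r I.N) = I.size σ fun _ => True :=
    fun σ => cnt_congr fun v hv => by simp [hreg v hv]
  constructor
  · rintro ⟨⟨t, j, z', st⟩, hx, hr, hj, hz⟩
    dsimp only at hr hj hz
    subst hr hj hz
    obtain ⟨σ, hσ⟩ := hI.exists_describes _ _ hx
    exact ⟨σ, fun v hv => hσ.good v hv (hreg v hv), by rw [← hsize]; exact hσ.size_eq.symm⟩
  · rintro ⟨σ, hσ, rfl⟩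
    -- Candidates use only the classes `0`, `1`, `2`. Since classes are compared only with these
    -- thresholds, larger values may be truncated.
    have h1 : ∀ D : ℕ → Prop, I.size (fun v => min (σ v) 2) D = I.size σ D :=
      fun D => cnt_congr fun v _ => and_congr_right fun _ => by simp
    have h3 : ∀ D c, c ≤ 2 → ∀ u, I.nb (fun v => min (σ v) 2) D c u = I.nb σ D c u :=
      fun D c hc u => cnt_congr fun v _ => and_congr_right fun _ => and_congr_right fun _ => by
        simp [hc]
    have h4 : ∀ v < I.n, I.Good (fun v => min (σ v) 2) v := by
      intro v hv
      have := hσ v hv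
      rw [Good] at this ⊢
      rw [h3 _ _ (by omega), h3 _ _ le_rfl]
      simp only [isGood, Bool.or_eq_true, Bool.and_eq_true, decide_eq_true_eq] at this ⊢
      omega
    refine ⟨I.record top (fun v => min (σ v) 2) I.r I.N,
      hI.record_mem_table (fun v => min_le_right _ _) h4 _ _ _ hI.root_lt le_rfl ?_,
      rfl, rfl, ?_⟩
    · have hN := hI.root_lt
      rw [hI.root_depth, Nat.sub_zero]
      obtain ⟨M, hM⟩ := Nat.exists_eq_succ_of_ne_zero (show I.N ≠ 0 by omega)
      rw [hM, Nat.succ_sub_one, Nat.succ_mul]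
      omega
    · rw [← h1, ← hsize]
      rfl

theorem le_answer (hI : I.Valid top depth)
    {z : ℕ} (hz : ∃ σ, (∀ v < I.n, I.Good σ v) ∧ I.size σ (fun _ => True) = z) :
    z ≤ I.answer := by
  obtain ⟨x, hx, h1, h2, h3⟩ := (hI.exists_mem_table_iff z).2 hz
  refine le_max_of_le_right (le_foldl_max ?_)
  exact List.mem_map.2 ⟨x, List.mem_filter.2 ⟨hx, by simp [h1, h2]⟩, h3⟩

theorem answer_mem (hI : I.Valid top depth) (h : I.answer ≠ 1) :
    ∃ σ, (∀ v < I.n, I.Good σ v) ∧ I.size σ (fun _ => True) = I.answer := by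
  refine (hI.exists_mem_table_iff _).1 ?_
  rw [answer] at h ⊢
  generalize hl : ((I.table (I.N * (I.N + 1))).filter fun x =>
    decide (x.1 = I.r) && decide (x.2.1 = I.N)).map (fun x => x.2.2.1) = l at h ⊢
  rcases foldl_max_mem l with h0 | hm
  · simp [h0] at h
  · rw [max_eq_right (by omega)]
    rw [← hl] at hm
    obtain ⟨x, hx, hz⟩ := List.mem_map.1 hm
    obtain ⟨hx, h'⟩ := List.mem_filter.1 hx
    simp only [Bool.and_eq_true, decide_eq_true_eq] at h'
    exact ⟨x, hx, h'.1, h'.2, by rw [hz, hl]⟩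

end Valid

theorem one_le_answer : 1 ≤ I.answer := le_max_left _ _

end DecompData

/-! ## Rooted trees and tree decompositions -/

section RootedTree

variable {V ι : Type*} {G : SimpleGraph V} {T : SimpleGraph ι} {X : ι → Finset V} {r : ι}

/-- The parent is the second node of a shortest walk from `t` to the root. -/
theorem exists_isChild (hT : T.Connected) {t : ι} (ht : t ≠ r) : ∃ p, IsChild T r p t := by
  obtain ⟨w, hw⟩ := (hT.preconnected t r).exists_walk_length_eq_dist
  cases w with
  | nil => exact (ht rfl).elim
  | @cons _ p _ h w =>
    refine ⟨p, h.symm, ?_⟩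
    have h1 := SimpleGraph.dist_le w
    have h2 := hT.dist_triangle (u := t) (v := p) (w := r)
    rw [SimpleGraph.dist_eq_one_iff_adj.2 h] at h2
    rw [SimpleGraph.Walk.length_cons] at hw
    rw [SimpleGraph.dist_comm, SimpleGraph.dist_comm (u := r)]
    omega

/-- Each parent is the second node of a shortest path from `t` to `r`, and paths in a tree are
unique. -/
theorem IsChild.unique (hT : T.IsTree) {p p' t : ι} (h : IsChild T r p t)
    (h' : IsChild T r p' t) : p = p' := by
  have key : ∀ {p}, (h : IsChild T r p t) →
      ∃ w : T.Walk p r, (SimpleGraph.Walk.cons h.1.symm w).IsPath := by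
    intro p h
    obtain ⟨w, hw⟩ := (hT.connected.preconnected p r).exists_walk_length_eq_dist
    refine ⟨w, SimpleGraph.Walk.isPath_of_length_eq_dist _ ?_⟩
    rw [SimpleGraph.Walk.length_cons, hw, SimpleGraph.dist_comm, SimpleGraph.dist_comm (u := t),
      h.2]
  obtain ⟨w, hw⟩ := key h
  obtain ⟨w', hw'⟩ := key h'
  have := congrArg Subtype.val (@Subsingleton.elim _ (hT.isAcyclic.subsingleton_path t r)
    ⟨_, hw⟩ ⟨_, hw'⟩)
  simpa using congrArg SimpleGraph.Walk.snd this

theorem eq_or_dist_lt_of_desc {t s : ι} (h : Relation.ReflTransGen (IsChild T r) t s) :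
    t = s ∨ T.dist r t < T.dist r s := by
  induction h with
  | refl => exact .inl rfl
  | tail _ h ih =>
    have := h.2
    rcases ih with rfl | ih <;> right <;> omega

theorem desc_root (hT : T.Connected) (t : ι) : Relation.ReflTransGen (IsChild T r) r t := by
  induction hd : T.dist r t generalizing t with
  | zero => rw [hT.dist_eq_zero_iff.1 hd]
  | succ k ih =>
    obtain ⟨p, hp⟩ := exists_isChild hT (t := t) (r := r) (by rintro rfl; simp at hd)
    have := hp.2
    exact (ih p (by omega)).tail hp

/-- The node `t` is the node closest to the root `r` whose bag contains `v`. -/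
def IsTopNode (T : SimpleGraph ι) (X : ι → Finset V) (r : ι) (v : V) (t : ι) : Prop :=
  v ∈ X t ∧ ∀ s, v ∈ X s → T.dist r t ≤ T.dist r s

namespace IsTreeDecomposition

theorem exists_isTopNode (hX : IsTreeDecomposition G T X)
    (r : ι) (v : V) : ∃ t, IsTopNode T X r v t := by
  obtain ⟨t, ht, h⟩ := WellFounded.has_min (measure (T.dist r)).wf {t | v ∈ X t} (hX.vertex_mem v)
  exact ⟨t, ht, fun s hs => not_lt.1 (h s hs)⟩

/-- The subtree of `t` can be left only through `p`. If `v ∉ X p`, the connected set of nodes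
containing `v` stays below `t`, so `a` would be farther from the root than `t`. -/
theorem mem_of_isChild (hX : IsTreeDecomposition G T X)
    {v : V} {p t a : ι} (ha : IsTopNode T X r v a) (ht : v ∈ X t) (hta : a ≠ t)
    (hp : IsChild T r p t) : v ∈ X p := by
  by_contra hv
  have hreach : Relation.ReflTransGen (T.induce {t | v ∈ X t}).Adj ⟨t, ht⟩ ⟨a, ha.1⟩ :=
    (SimpleGraph.reachable_iff_reflTransGen _ _).1 ((hX.connected v).preconnected _ _)
  have key : ∀ y : {t | v ∈ X t}, Relation.ReflTransGen (T.induce {t | v ∈ X t}).Adj ⟨t, ht⟩ y →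
      Relation.ReflTransGen (IsChild T r) t y := by
    intro y hy
    induction hy with
    | refl => exact .refl
    | @tail b c _ hbc ih =>
      have hadj : T.Adj b c := hbc
      rcases hX.isTree.dist_eq_dist_add_one_of_adj r hadj with h | h
      · have hcb : IsChild T r c b := ⟨hadj.symm, h⟩
        rcases Relation.ReflTransGen.cases_tail ih with h' | ⟨y, h1, h2⟩
        · rw [h'] at hcb
          exact (hv (hcb.unique hX.isTree hp ▸ c.2)).elim
        · rwa [h2.unique hX.isTree hcb] at h1
      · exact ih.tail ⟨hadj, h⟩
  rcases eq_or_dist_lt_of_desc (key _ hreach) with h | h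
  · exact hta h.symm
  · exact absurd (ha.2 t ht) (not_le.2 h)

theorem desc_of_mem (hX : IsTreeDecomposition G T X)
    {v : V} {a : ι} (ha : IsTopNode T X r v a) (t : ι) (ht : v ∈ X t) :
    Relation.ReflTransGen (IsChild T r) a t := by
  induction hd : T.dist r t using Nat.strong_induction_on generalizing t with
  | _ d ih =>
    by_cases hta : a = t
    · rw [hta]
    by_cases htr : t = r
    · subst htr
      have := ha.2 t ht
      rw [SimpleGraph.dist_self, Nat.le_zero, hX.isTree.connected.dist_eq_zero_iff] at this
      exact (hta this.symm).elim
    obtain ⟨p, hp⟩ := exists_isChild hX.isTree.connected htr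
    have := hp.2
    exact (ih _ (by omega) p (hX.mem_of_isChild ha ht hta hp) rfl).tail hp

theorem isTopNode_iff (hX : IsTreeDecomposition G T X)
    {v : V} {a t s : ι} (ha : IsTopNode T X r v a) (hc : IsChild T r t s) :
    a = s ↔ v ∈ X s ∧ v ∉ X t := by
  constructor
  · rintro rfl
    refine ⟨ha.1, fun h => ?_⟩
    have := ha.2 t h
    have := hc.2
    omega
  · rintro ⟨h1, h2⟩
    by_contra h
    exact h2 (hX.mem_of_isChild ha h1 h hc)

/-- Some bag below `a`, hence below `s`, contains both ends of the edge. Going up from it towards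
`s`, either `u` persists as far as `s`, or the node where it disappears from the next bag is its top
node. -/
theorem mem_or_desc (hX : IsTreeDecomposition G T X)
    {u v : V} {a b s : ι} (ha : IsTopNode T X r v a) (hb : IsTopNode T X r u b)
    (huv : G.Adj v u) (hs : Relation.ReflTransGen (IsChild T r) s a) :
    u ∈ X s ∨ Relation.TransGen (IsChild T r) s b := by
  obtain ⟨t, htv, htu⟩ := hX.edge_mem v u huv
  have key : ∀ x, Relation.ReflTransGen (IsChild T r) s x → u ∈ X x →
      u ∈ X s ∨ Relation.TransGen (IsChild T r) s b := by
    intro x hx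
    induction hx with
    | refl => exact .inl
    | @tail y x hy hyx ih =>
      intro hu
      by_cases huy : u ∈ X y
      · exact ih huy
      · rw [(hX.isTopNode_iff hb hyx).2 ⟨hu, huy⟩]
        exact .inr (.tail' hy hyx)
  exact key t (hs.trans (hX.desc_of_mem ha t htv)) htu

end IsTreeDecomposition

end RootedTree

/-! ## The input word -/

section InputWord

theorem length_relationMatrix {m n : ℕ} (R : Fin m → Fin n → Prop) :
    (relationMatrix R).length = m * n := by simp [relationMatrix]

theorem mul_add_lt {m n : ℕ} (i : Fin m) (j : Fin n) : (i : ℕ) * n + j < m * n := by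
  have := Nat.mul_le_mul_right n i.2
  rw [Nat.succ_mul] at this
  have := j.2
  omega

open Classical in
theorem getD_relationMatrix {m n : ℕ} (R : Fin m → Fin n → Prop) (i : Fin m) (j : Fin n) :
    (relationMatrix R).getD (i * n + j) 0 = if R i j then 1 else 0 := by
  have hlt := mul_add_lt i j
  rw [List.getD_eq_getElem _ _ (by rw [length_relationMatrix]; exact hlt)]
  have hn : 0 < n := j.pos
  have h1 : (⟨i * n + j, hlt⟩ : Fin (m * n)).divNat = i := by
    ext
    simp [Fin.divNat, Nat.div_eq_of_lt j.2, mul_comm _ n, Nat.mul_add_div hn]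
  have h2 : (⟨i * n + j, hlt⟩ : Fin (m * n)).modNat = j := by
    ext
    simp [Fin.modNat, Nat.mod_eq_of_lt j.2]
  simp [relationMatrix, h1, h2]

theorem mem_relationMatrix {m n : ℕ} {R : Fin m → Fin n → Prop} {a : ℕ}
    (h : a ∈ relationMatrix R) : a ≤ 1 := by
  obtain ⟨p, rfl⟩ := (List.mem_ofFn' _ _).1 h
  dsimp only
  split <;> omega

/-- The graph and the tree decomposition that are described by an input word. -/
def DecompData.ofWord (w : List ℕ) : DecompData where
  n := w.getD 0 0
  N := w.getD 1 0
  r := w.getD 2 0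
  adj u v := decide (u + 1 ≤ w.getD 0 0) && decide (v + 1 ≤ w.getD 0 0) &&
    decide (w.getD (3 + (u * w.getD 0 0 + v)) 0 = 1)
  child t s := decide (t + 1 ≤ w.getD 1 0) && decide (s + 1 ≤ w.getD 1 0) &&
    decide (w.getD (3 + w.getD 0 0 * w.getD 0 0 + (t * w.getD 1 0 + s)) 0 = 1)
  bag t v := decide (t + 1 ≤ w.getD 1 0) && decide (v + 1 ≤ w.getD 0 0) &&
    decide (w.getD (3 + w.getD 0 0 * w.getD 0 0 + w.getD 1 0 * w.getD 1 0 +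
      (t * w.getD 0 0 + v)) 0 = 1)

open DecompData

variable {n N : ℕ} {G : SimpleGraph (Fin n)} {T : SimpleGraph (Fin N)} {r : Fin N}
  {X : Fin N → Finset (Fin n)}

theorem length_inputWord :
    (inputWord G T r X).length = 3 + n * n + N * N + N * n := by
  simp [inputWord, length_relationMatrix]
  omega

theorem getD_append_add {l l' : List ℕ} {k i : ℕ} (h : l.length = k) :
    (l ++ l').getD (k + i) 0 = l'.getD i 0 := by
  rw [List.getD_append_right _ _ _ _ (by omega), h, Nat.add_sub_cancel_left]

theorem getD_relationMatrix_append {m n : ℕ} (R : Fin m → Fin n → Prop) (i : Fin m) (j : Fin n)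
    (l : List ℕ) : (relationMatrix R ++ l).getD (i * n + j) 0 = 1 ↔ R i j := by
  rw [List.getD_append _ _ _ _ (by rw [length_relationMatrix]; exact mul_add_lt i j),
    getD_relationMatrix]
  simp

/-- The range tests in `ofWord` matter: an index out of range could hit another row or another
matrix. -/
theorem adj_ofWord (u v : ℕ) : (ofWord (inputWord G T r X)).adj u v = true ↔
    ∃ (hu : u < n) (hv : v < n), G.Adj ⟨u, hu⟩ ⟨v, hv⟩ := by
  have h0 : (inputWord G T r X).getD 0 0 = n := rfl
  have h : ∀ u v : Fin n, (inputWord G T r X).getD (3 + (u * n + v)) 0 = 1 ↔ G.Adj u v := by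
    intro u v
    rw [inputWord, List.append_assoc, List.append_assoc, getD_append_add (by simp),
      getD_relationMatrix_append]
  simp only [ofWord, h0, Bool.and_eq_true, decide_eq_true_eq, Nat.succ_le_iff]
  exact ⟨fun ⟨⟨hu, hv⟩, h'⟩ => ⟨hu, hv, (h ⟨u, hu⟩ ⟨v, hv⟩).1 h'⟩,
    fun ⟨hu, hv, h'⟩ => ⟨⟨hu, hv⟩, (h ⟨u, hu⟩ ⟨v, hv⟩).2 h'⟩⟩

theorem child_ofWord (t s : ℕ) : (ofWord (inputWord G T r X)).child t s = true ↔
    ∃ (ht : t < N) (hs : s < N), IsChild T r ⟨t, ht⟩ ⟨s, hs⟩ := by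
  have h0 : (inputWord G T r X).getD 0 0 = n := rfl
  have h1 : (inputWord G T r X).getD 1 0 = N := rfl
  have h : ∀ t s : Fin N, (inputWord G T r X).getD (3 + n * n + (t * N + s)) 0 = 1 ↔
      IsChild T r t s := by
    intro t s
    rw [inputWord, List.append_assoc,
      getD_append_add (k := 3 + n * n) (by simp [length_relationMatrix]; omega),
      getD_relationMatrix_append]
  simp only [ofWord, h0, h1, Bool.and_eq_true, decide_eq_true_eq, Nat.succ_le_iff]
  exact ⟨fun ⟨⟨ht, hs⟩, h'⟩ => ⟨ht, hs, (h ⟨t, ht⟩ ⟨s, hs⟩).1 h'⟩,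
    fun ⟨ht, hs, h'⟩ => ⟨⟨ht, hs⟩, (h ⟨t, ht⟩ ⟨s, hs⟩).2 h'⟩⟩

theorem bag_ofWord (t v : ℕ) : (ofWord (inputWord G T r X)).bag t v = true ↔
    ∃ (ht : t < N) (hv : v < n), ⟨v, hv⟩ ∈ X ⟨t, ht⟩ := by
  have h0 : (inputWord G T r X).getD 0 0 = n := rfl
  have h1 : (inputWord G T r X).getD 1 0 = N := rfl
  have h : ∀ (t : Fin N) (v : Fin n),
      (inputWord G T r X).getD (3 + n * n + N * N + (t * n + v)) 0 = 1 ↔ v ∈ X t := by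
    intro t v
    rw [inputWord, getD_append_add (k := 3 + n * n + N * N)
      (by simp [length_relationMatrix]; omega), getD_relationMatrix]
    simp
  simp only [ofWord, h0, h1, Bool.and_eq_true, decide_eq_true_eq, Nat.succ_le_iff]
  exact ⟨fun ⟨⟨ht, hv⟩, h'⟩ => ⟨ht, hv, (h ⟨t, ht⟩ ⟨v, hv⟩).1 h'⟩,
    fun ⟨ht, hv, h'⟩ => ⟨⟨ht, hv⟩, (h ⟨t, ht⟩ ⟨v, hv⟩).2 h'⟩⟩

theorem desc_ofWord {t s : Fin N} (h : Relation.ReflTransGen (IsChild T r) t s) :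
    (ofWord (inputWord G T r X)).Desc t s :=
  h.lift (p := fun t s => (ofWord (inputWord G T r X)).child t s = true) Fin.val
    fun a b hab => (child_ofWord _ _).2 ⟨a.2, b.2, hab⟩

theorem properDesc_ofWord {t s : Fin N} (h : Relation.TransGen (IsChild T r) t s) :
    (ofWord (inputWord G T r X)).ProperDesc t s :=
  h.lift (p := fun t s => (ofWord (inputWord G T r X)).child t s = true) Fin.val
    fun a b hab => (child_ofWord _ _).2 ⟨a.2, b.2, hab⟩

theorem exists_desc_of_desc_ofWord {t s : ℕ} (h : (ofWord (inputWord G T r X)).Desc t s)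
    (hs : s < N) : ∃ ht, Relation.ReflTransGen (IsChild T r) (⟨t, ht⟩ : Fin N) ⟨s, hs⟩ := by
  induction h with
  | refl => exact ⟨hs, .refl⟩
  | tail _ h ih =>
    obtain ⟨h1, _, h2⟩ := (child_ofWord _ _).1 h
    obtain ⟨ht, h3⟩ := ih h1
    exact ⟨ht, h3.tail h2⟩

theorem exists_valid_ofWord (hX : IsTreeDecomposition G T X) (hr : X r = ∅) :
    ∃ top depth, (ofWord (inputWord G T r X)).Valid top depth := by
  choose top htop using hX.exists_isTopNode r
  have hconn := hX.isTree.connected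
  have htv : ∀ v (hv : v < n), (fun v => if h : v < n then (top ⟨v, h⟩ : ℕ) else 0) v =
      top ⟨v, hv⟩ := fun v hv => dif_pos hv
  have hdt : ∀ t (ht : t < N), (fun t => if h : t < N then T.dist r ⟨t, h⟩ else 0) t =
      T.dist r ⟨t, ht⟩ := fun t ht => dif_pos ht
  have hdt' : ∀ t : Fin N, (fun t => if h : t < N then T.dist r ⟨t, h⟩ else 0) (t : ℕ) =
      T.dist r t := fun t => dif_pos t.2
  refine ⟨fun v => if h : v < n then top ⟨v, h⟩ else 0,
    fun t => if h : t < N then T.dist r ⟨t, h⟩ else 0, ?_⟩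
  generalize (fun v => if h : v < n then (top ⟨v, h⟩ : ℕ) else 0) = top' at *
  generalize (fun t => if h : t < N then T.dist r ⟨t, h⟩ else 0) = depth at *
  constructor
  · intro u v h
    obtain ⟨hu, hv, h⟩ := (adj_ofWord u v).1 h
    exact (adj_ofWord v u).2 ⟨hv, hu, h.symm⟩
  · intro t s h
    exact ((child_ofWord t s).1 h).2.1
  · intro t s h
    obtain ⟨ht, hs, h⟩ := (child_ofWord t s).1 h
    rw [hdt t ht, hdt s hs, h.2]
  · intro t t' s h h'
    obtain ⟨ht, hs, h⟩ := (child_ofWord t s).1 h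
    obtain ⟨ht', _, h'⟩ := (child_ofWord t' s).1 h'
    simpa using h.unique hX.isTree h'
  · intro t ht
    change t < N at ht
    change _ < N
    rw [hdt t ht]
    -- A path has fewer edges than the tree has nodes.
    obtain ⟨w, hw, hl⟩ := hconn.exists_path_of_dist r ⟨t, ht⟩
    rw [← hl]
    simpa using hw.length_lt
  · intro t v hv hb
    obtain ⟨ht, hv, hb⟩ := (bag_ofWord t v).1 hb
    rw [htv v hv, hdt', hdt t ht]
    exact (htop _).2 _ hb
  · intro t s h v hv
    change v < n at hv
    obtain ⟨ht, hs, h⟩ := (child_ofWord t s).1 h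
    have := hX.isTopNode_iff (htop ⟨v, hv⟩) h
    rw [htv v hv, bag_ofWord, ← Bool.not_eq_true, bag_ofWord]
    simpa [hv, ht, hs, Fin.ext_iff] using this
  · intro s u hu v hv ha hd
    change u < n at hu
    change v < n at hv
    rw [htv v hv] at hd
    obtain ⟨_, _, ha⟩ := (adj_ofWord v u).1 ha
    obtain ⟨hs, hd⟩ := exists_desc_of_desc_ofWord hd (top ⟨v, hv⟩).2
    rcases hX.mem_or_desc (htop ⟨v, hv⟩) (htop ⟨u, hu⟩) ha hd with h | h
    · exact .inl ((bag_ofWord s u).2 ⟨hs, hu, h⟩)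
    · right
      rw [htv u hu]
      exact properDesc_ofWord h
  · exact r.2
  · exact (hdt' r).trans (by simp)
  · intro v hv
    change v < n at hv
    rw [htv v hv]
    refine properDesc_ofWord (t := r) ?_
    rcases Relation.reflTransGen_iff_eq_or_transGen.1 (desc_root hconn (top ⟨v, hv⟩)) with h | h
    -- The root bag is empty, so no vertex has its top node at the root.
    · have := (htop ⟨v, hv⟩).1
      rw [h, hr] at this
      simp at this
    · exact h

end InputWord

open Code DecompData

/-! ## The algorithm runs in polynomial time in the number of candidates -/

section Running

variable {α β : Type} [Code α] [Code β]

/-- Free variables of a term are kept in nested pairs: `up` weakens a term by one bound variable,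
and `var` is that variable. -/
theorem PolyTime.up {γ : Type} [Code γ] {f : α → γ} (hf : PolyTime f) :
    PolyTime fun x : α × β => f x.1 :=
  PolyTime.comp hf PolyTime.id.fst

theorem PolyTime.var : PolyTime fun x : α × β => x.2 := PolyTime.id.snd

theorem PolyOn.id : PolyOn Bdd fun x : α => x := PolyTime.id

theorem PolyOn.var : PolyOn Bdd fun x : α × β => x.2 := PolyTime.var

variable {w : α → List ℕ} {x f g : α → Record} {F : α → List Record} {u v s t c : α → ℕ}

theorem PolyTime.verts (hw : PolyTime w) : PolyTime fun a => (ofWord (w a)).n :=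
  hw.getD (.const_nat 0) (.const_nat 0)

theorem PolyTime.nodes (hw : PolyTime w) : PolyTime fun a => (ofWord (w a)).N :=
  hw.getD (.const_nat 1) (.const_nat 0)

theorem PolyTime.root (hw : PolyTime w) : PolyTime fun a => (ofWord (w a)).r :=
  hw.getD (.const_nat 2) (.const_nat 0)

theorem PolyTime.adj (hw : PolyTime w) (hu : PolyTime u) (hv : PolyTime v) :
    PolyTime fun a => (ofWord (w a)).adj (u a) (v a) :=
  PolyOn.and (.and (.le_nat (.add hu (.const_nat 1)) hw.verts)
    (.le_nat (.add hv (.const_nat 1)) hw.verts)) <|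
    .eq_nat (hw.getD (.add (.const_nat 3) (.add (.mul hu hw.verts) hv)) (.const_nat 0))
      (.const_nat 1)

theorem PolyTime.child (hw : PolyTime w) (ht : PolyTime t) (hs : PolyTime s) :
    PolyTime fun a => (ofWord (w a)).child (t a) (s a) :=
  PolyOn.and (.and (.le_nat (.add ht (.const_nat 1)) hw.nodes)
    (.le_nat (.add hs (.const_nat 1)) hw.nodes)) <|
    .eq_nat (hw.getD (.add (.add (.const_nat 3) (.mul hw.verts hw.verts))
      (.add (.mul ht hw.nodes) hs)) (.const_nat 0)) (.const_nat 1)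

theorem PolyTime.bag (hw : PolyTime w) (ht : PolyTime t) (hv : PolyTime v) :
    PolyTime fun a => (ofWord (w a)).bag (t a) (v a) :=
  PolyOn.and (.and (.le_nat (.add ht (.const_nat 1)) hw.nodes)
    (.le_nat (.add hv (.const_nat 1)) hw.verts)) <|
    .eq_nat (hw.getD (.add (.add (.add (.const_nat 3) (.mul hw.verts hw.verts))
      (.mul hw.nodes hw.nodes)) (.add (.mul ht hw.verts) hv)) (.const_nat 0)) (.const_nat 1)

theorem PolyTime.entry (hx : PolyTime x) (hv : PolyTime v) :
    PolyTime fun a => entry (x a) (v a) :=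
  PolyTime.getD (PolyOn.snd (.snd (.snd hx))) hv
    (.pair (.const_nat 0) (.pair (.const_nat 0) (.const_nat 0)))

theorem PolyTime.cls (hx : PolyTime x) (hv : PolyTime v) : PolyTime fun a => cls (x a) (v a) :=
  PolyOn.fst (hx.entry hv)

theorem PolyTime.deg (hw : PolyTime w) (hv : PolyTime v) :
    PolyTime fun a => (ofWord (w a)).deg (v a) :=
  PolyTime.countP (p := fun a u => (ofWord (w a)).adj (v a) u) (.range hw.verts)
    (hw.up.adj hv.up .var)

theorem PolyTime.isGood {κ δ m d : α → ℕ} (hκ : PolyTime κ) (hδ : PolyTime δ) (hm : PolyTime m)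
    (hd : PolyTime d) : PolyTime fun a => isGood (κ a) (δ a) (m a) (d a) :=
  PolyOn.or (.eq_nat hκ (.const_nat 0)) <|
    .and (.and (.le_nat hδ (.add (.add hm hm) (.const_nat 1))) (.le_nat (.const_nat 1) hd)) <|
    .or (.le_nat hκ (.const_nat 1)) (.le_nat (.add hm hm) hδ)

theorem PolyTime.bagCount (hw : PolyTime w) (hs : PolyTime s) (hg : PolyTime g) (hc : PolyTime c)
    (hu : PolyTime u) : PolyTime fun a => (ofWord (w a)).bagCount (s a) (g a) (c a) (u a) :=
  PolyTime.countP (p := fun a v => (ofWord (w a)).bag (s a) v &&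
    ((ofWord (w a)).adj (u a) v && decide (c a ≤ DecompData.cls (g a) v))) (.range hw.verts)
    (.and (hw.up.bag hs.up .var) (.and (hw.up.adj hu.up .var) (.le_nat hc.up (hg.up.cls .var))))

theorem PolyTime.forgetCount (hw : PolyTime w) (ht : PolyTime t) (hs : PolyTime s)
    (hg : PolyTime g) (hc : PolyTime c) (hu : PolyTime u) :
    PolyTime fun a => (ofWord (w a)).forgetCount (t a) (s a) (g a) (c a) (u a) :=
  PolyTime.countP (p := fun a v => ((ofWord (w a)).bag (s a) v && !(ofWord (w a)).bag (t a) v) &&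
    ((ofWord (w a)).adj (u a) v && decide (c a ≤ DecompData.cls (g a) v))) (.range hw.verts)
    (.and (.and (hw.up.bag hs.up .var) (.not (hw.up.bag ht.up .var)))
      (.and (hw.up.adj hu.up .var) (.le_nat hc.up (hg.up.cls .var))))

theorem PolyTime.isStepAt (hw : PolyTime w) (hf : PolyTime f) (hg : PolyTime g) (hx : PolyTime x)
    (hu : PolyTime u) :
    PolyTime fun a => (ofWord (w a)).isStepAt (f a) (g a) (x a) (u a) :=
  PolyOn.cond (hw.bag (.fst hx) hu)
    (.and (.and (.and (.eq_nat (hf.cls hu) (hx.cls hu))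
      (.or (.not (hw.bag (.fst hg) hu)) (.eq_nat (hg.cls hu) (hx.cls hu))))
      (.eq_nat (.fst (.snd (hx.entry hu))) (.add (.add (.fst (.snd (hf.entry hu)))
        (.fst (.snd (hg.entry hu)))) (hw.forgetCount (.fst hx) (.fst hg) hg (.const_nat 1) hu))))
      (.eq_nat (.snd (.snd (hx.entry hu))) (.add (.add (.snd (.snd (hf.entry hu)))
        (.snd (.snd (hg.entry hu)))) (hw.forgetCount (.fst hx) (.fst hg) hg (.const_nat 2) hu))))
    (.or (.not (hw.bag (.fst hg) hu)) (PolyTime.isGood (hg.cls hu) (hw.deg hu)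
      (.add (.fst (.snd (hg.entry hu))) (hw.bagCount (.fst hg) hg (.const_nat 1) hu))
      (.add (.snd (.snd (hg.entry hu))) (hw.bagCount (.fst hg) hg (.const_nat 2) hu))))

theorem PolyTime.isStep (hw : PolyTime w) (hf : PolyTime f) (hg : PolyTime g) (hx : PolyTime x) :
    PolyTime fun a => (ofWord (w a)).isStep (f a) (g a) (x a) :=
  PolyOn.and (.eq_nat (.fst (.snd (.snd hx)))
    (.add (.add (.fst (.snd (.snd hf))) (.fst (.snd (.snd hg))))
      (PolyTime.countP (p := fun a v => ((ofWord (w a)).bag (g a).1 v &&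
        !(ofWord (w a)).bag (x a).1 v) && decide (1 ≤ DecompData.cls (g a) v)) (.range hw.verts)
        (.and (.and (hw.up.bag (.fst hg.up) .var) (.not (hw.up.bag (.fst hx.up) .var)))
          (.le_nat (.const_nat 1) (hg.up.cls .var))))))
    (PolyTime.all (p := fun a u => (ofWord (w a)).isStepAt (f a) (g a) (x a) u)
      (.range hw.verts) (hw.up.isStepAt hf.up hg.up hx.up .var))

theorem PolyTime.isSame (hw : PolyTime w) (hf : PolyTime f) (hx : PolyTime x) :
    PolyTime fun a => (ofWord (w a)).isSame (f a) (x a) :=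
  PolyOn.and (.eq_nat (.fst (.snd (.snd hx))) (.fst (.snd (.snd hf))))
    (PolyTime.all (p := fun a u => decide (DecompData.cls (f a) u = DecompData.cls (x a) u) &&
      decide ((DecompData.entry (f a) u).2.1 = (DecompData.entry (x a) u).2.1) &&
      decide ((DecompData.entry (f a) u).2.2 = (DecompData.entry (x a) u).2.2))
      (.range hw.verts) (.and (.and (.eq_nat (hf.up.cls .var) (hx.up.cls .var))
        (.eq_nat (.fst (.snd (hf.up.entry .var))) (.fst (.snd (hx.up.entry .var)))))
        (.eq_nat (.snd (.snd (hf.up.entry .var))) (.snd (.snd (hx.up.entry .var))))))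

theorem PolyTime.isStart (hw : PolyTime w) (hx : PolyTime x) :
    PolyTime fun a => (ofWord (w a)).isStart (x a) :=
  PolyOn.and (.eq_nat (.fst (.snd (.snd hx))) (.const_nat 0))
    (PolyTime.all (p := fun a u => decide ((DecompData.entry (x a) u).2.1 = 0) &&
      decide ((DecompData.entry (x a) u).2.2 = 0)) (.range hw.verts)
      (.and (.eq_nat (.fst (.snd (hx.up.entry .var))) (.const_nat 0))
        (.eq_nat (.snd (.snd (hx.up.entry .var))) (.const_nat 0))))

theorem PolyTime.followsFrom (hw : PolyTime w) (hF : PolyTime F) (hf : PolyTime f)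
    (hx : PolyTime x) : PolyTime fun a => (ofWord (w a)).followsFrom (F a) (f a) (x a) :=
  PolyOn.and (.and (.eq_nat (.fst hf) (.fst hx))
    (.eq_nat (.add (.fst (.snd hf)) (.const_nat 1)) (.fst (.snd hx))))
    (.cond (hw.child (.fst hx) (.fst (.snd hf)))
      (PolyTime.any (p := fun a g => decide (g.1 = (f a).2.1) &&
        decide (g.2.1 = (ofWord (w a)).N) && (ofWord (w a)).isStep (f a) g (x a)) hF
        (.and (.and (.eq_nat (.fst .var) (.fst (.snd hf.up)))
          (.eq_nat (.fst (.snd .var)) hw.up.nodes)) (hw.up.isStep hf.up .var hx.up)))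
      (hw.isSame hf hx))

theorem PolyTime.follows (hw : PolyTime w) (hF : PolyTime F) (hx : PolyTime x) :
    PolyTime fun a => (ofWord (w a)).follows (F a) (x a) :=
  PolyOn.cond (.eq_nat (.fst (.snd hx)) (.const_nat 0)) (hw.isStart hx)
    (PolyTime.any (p := fun a f => (ofWord (w a)).followsFrom (F a) f (x a)) hF
      (hw.up.followsFrom hF.up .var hx.up))

theorem PolyTime.options (hw : PolyTime w) (ht : PolyTime t) (hv : PolyTime v) :
    PolyTime fun a => (ofWord (w a)).options (t a) (v a) :=
  PolyOn.cond (hw.bag ht hv)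
    (PolyTime.flatMap (g := fun a κ => (List.range ((ofWord (w a)).n + 1)).flatMap fun m =>
      (List.range ((ofWord (w a)).n + 1)).map fun d => ((κ, m, d) : Entry)) (.range (.const_nat 3))
      (PolyTime.flatMap (g := fun (a : α × ℕ) m =>
        (List.range ((ofWord (w a.1)).n + 1)).map fun d => ((a.2, m, d) : Entry))
        (.range (.add hw.up.verts (.const_nat 1)))
        (PolyTime.map (g := fun (a : (α × ℕ) × ℕ) d => ((a.1.2, a.2, d) : Entry))
          (.range (.add hw.up.up.verts (.const_nat 1)))
          (.pair (.snd (.fst (.fst .id))) (.pair (.snd (.fst .id)) (.snd .id))))))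
    (.cons (.pair (.const_nat 0) (.pair (.const_nat 0) (.const_nat 0))) .nil)

/-- The entries of a word and the numbers of the possible states of the nodes are at most `B`. -/
def StatesBdd (B : ℕ) (w : List ℕ) : Prop :=
  Bdd B w ∧ ∀ t < (ofWord w).N, ∀ L, L <:+ (List.range (ofWord w).n).map ((ofWord w).options t) →
    L.sections.length ≤ B

theorem polyOn_states : PolyOn (fun B (x : List ℕ × ℕ) => Bdd B x ∧
    ∀ L, L <:+ (List.range (ofWord x.1).n).map ((ofWord x.1).options x.2) →
      L.sections.length ≤ B) fun x => (ofWord x.1).states x.2 := by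
  have h : PolyTime fun x : List ℕ × ℕ =>
      (List.range (ofWord x.1).n).map ((ofWord x.1).options x.2) :=
    PolyTime.map (.range (PolyTime.verts (.fst .id)))
      (PolyTime.options (.fst (.fst .id)) (.snd (.fst .id)) (.snd .id))
  refine PolyOn.sections.comp (PolyTime.on h fun _ _ h => h.1) ?_
  obtain ⟨p, hp, hpb, -⟩ := h
  exact ⟨fun B => p B + B, hp.add .id, fun B x hx => ⟨bdd_mono (Nat.le_add_right _ _)
    (hpb B x hx.1), fun L hL => (hx.2 L hL).trans (Nat.le_add_left _ _)⟩⟩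

theorem polyOn_candidates : PolyOn StatesBdd fun w => (ofWord w).candidates := by
  have h : PolyTime fun x : (List ℕ × ℕ) × List (List Entry) => x.2.flatMap fun st =>
      (List.range ((ofWord x.1.1).N + 1)).flatMap fun j =>
        (List.range ((ofWord x.1.1).n + 1)).map fun z => ((x.1.2, j, z, st) : Record) :=
    PolyTime.flatMap (g := fun (x : (List ℕ × ℕ) × List (List Entry)) st =>
      (List.range ((ofWord x.1.1).N + 1)).flatMap fun j =>
        (List.range ((ofWord x.1.1).n + 1)).map fun z => ((x.1.2, j, z, st) : Record)) (.snd .id)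
      (PolyTime.flatMap (g := fun (x : ((List ℕ × ℕ) × List (List Entry)) × List Entry) j =>
        (List.range ((ofWord x.1.1.1).n + 1)).map fun z => ((x.1.1.2, j, z, x.2) : Record))
        (.range (.add (PolyTime.nodes (.fst (.fst (.fst .id)))) (.const_nat 1)))
        (PolyTime.map
          (g := fun (x : (((List ℕ × ℕ) × List (List Entry)) × List Entry) × ℕ) z =>
            ((x.1.1.1.2, x.2, z, x.1.2) : Record))
          (.range (.add (PolyTime.verts (.fst (.fst (.fst (.fst .id))))) (.const_nat 1)))
          (.pair (.snd (.fst (.fst (.fst (.fst .id))))) (.pair (.snd (.fst .id))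
            (.pair (.snd .id) (.snd (.fst (.fst .id))))))))
  refine PolyOn.flatMap (g := fun w t => ((ofWord w).states t).flatMap fun st =>
    (List.range ((ofWord w).N + 1)).flatMap fun j =>
      (List.range ((ofWord w).n + 1)).map fun z => ((t, j, z, st) : Record))
    (.range (PolyTime.on (PolyTime.nodes .id) fun _ _ h => h.1))
    (h.comp ((PolyOn.id_of fun _ _ h => h.1).pair polyOn_states)) ?_
  obtain ⟨p, hp, hpb, -⟩ := PolyTime.nodes (w := fun w => w) .id
  refine ⟨fun B => B + p B, PolyBound.id.add hp, fun B w hw =>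
    ⟨bdd_mono (Nat.le_add_right _ _) hw.1, fun t ht => ?_⟩⟩
  have ht := List.mem_range.1 ht
  refine ⟨⟨bdd_mono (Nat.le_add_right _ _) hw.1, ?_⟩,
    fun L hL => (hw.2 t ht L hL).trans (Nat.le_add_right _ _)⟩
  have : (ofWord w).N ≤ p B := hpb B w hw.1
  change t ≤ B + p B
  omega

theorem table_eq_foldl (I : DecompData) (i : ℕ) :
    I.table i = (List.range i).foldl (fun F _ => I.candidates.filter (I.follows F)) [] := by
  induction i with
  | zero => rfl
  | succ i ih => rw [List.range_succ, List.foldl_append, ← ih]; rfl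

/-- The candidates are listed once; given the pair of word and list, the rest is polynomial. -/
theorem polyOn_answer : PolyOn StatesBdd fun w => (ofWord w).answer := by
  have h : PolyTime fun x : List ℕ × List Record =>
      (List.range ((ofWord x.1).N * ((ofWord x.1).N + 1))).foldl
        (fun F _ => x.2.filter ((ofWord x.1).follows F)) [] := by
    refine PolyTime.foldl (h := fun (x : List ℕ × List Record) F _ =>
      x.2.filter ((ofWord x.1).follows F)) (.range (.mul (PolyTime.nodes (.fst .id))
        (.add (PolyTime.nodes (.fst .id)) (.const_nat 1)))) .nil
      (PolyTime.filter (p := fun (y : (List ℕ × List Record) × List Record × ℕ) x =>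
        (ofWord y.1.1).follows y.2.1 x) (.snd (.fst .id))
        (PolyTime.follows (.fst (.fst (.fst .id))) (.fst (.snd (.fst .id))) (.snd .id)))
      ⟨_, .id, fun B x hx _ hn l₁ l₂ _ => ?_⟩
    -- Each table is filtered from the candidates, so it does not grow with the number of rounds.
    rcases List.eq_nil_or_concat l₁ with rfl | ⟨l, b, rfl⟩
    · exact hn
    · rw [List.concat_eq_append, List.foldl_append]
      exact ⟨(List.length_filter_le _ _).trans hx.2.1,
        fun r hr => hx.2.2 r (List.mem_filter.1 hr).1⟩
  have h' : PolyTime fun x : List ℕ × List Record => max 1 (((x.2.filter fun y =>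
      decide (y.1 = (ofWord x.1).r) && decide (y.2.1 = (ofWord x.1).N)).map
        fun y => y.2.2.1).foldl max 0) := by
    refine PolyOn.max (.const_nat 1) (polyTime_foldl_max.comp (PolyTime.map
      (g := fun (_ : List ℕ × List Record) (y : Record) => y.2.2.1) (PolyTime.filter
        (p := fun (x : List ℕ × List Record) (y : Record) => decide (y.1 = (ofWord x.1).r) &&
          decide (y.2.1 = (ofWord x.1).N)) (.snd .id)
        (.and (.eq_nat (.fst (.snd .id)) (PolyTime.root (.fst (.fst .id))))
          (.eq_nat (.fst (.snd (.snd .id))) (PolyTime.nodes (.fst (.fst .id))))))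
      (.fst (.snd (.snd (.snd .id))))))
  have hid : PolyOn StatesBdd fun w : List ℕ => w := PolyOn.id_of fun _ _ h => h.1
  simpa only [answer, ← table_eq_foldl] using
    h'.comp (hid.pair (h.comp (hid.pair polyOn_candidates)))

end Running

/-! ## Locally minimal defensive alliances -/

section Alliance

theorem inter_erase {V : Type*} [DecidableEq V] {G : SimpleGraph V} {S : Finset V} {u v : V}
    (h : ¬ G.Adj u v) :
    G.neighborSet u ∩ (S.erase v : Finset V) = G.neighborSet u ∩ (S : Set V) := by
  rw [Finset.coe_erase, ← Set.inter_sdiff_assoc]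
  exact Set.sdiff_singleton_eq_self fun h' => h h'.1

variable {V : Type*} [Finite V] {G : SimpleGraph V} {S : Finset V}

theorem isDefensiveAlliance_iff : IsDefensiveAlliance G S ↔ S.Nonempty ∧ ∀ v ∈ S,
    (G.neighborSet v).ncard ≤ 2 * (G.neighborSet v ∩ S).ncard + 1 := by
  refine and_congr_right fun _ => forall₂_congr fun v hv => ?_
  have h1 := Set.ncard_inter_add_ncard_sdiff_eq_ncard (G.neighborSet v) (S : Set V)
  have h2 : (insert v (G.neighborSet v) ∩ (S : Set V)).ncard =
      (G.neighborSet v ∩ (S : Set V)).ncard + 1 := by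
    rw [Set.insert_inter_of_mem (by simpa using hv), Set.ncard_insert_of_notMem (by simp)]
  omega

theorem ncard_inter_erase [DecidableEq V] {u v : V} (hv : v ∈ S) (h : G.Adj u v) :
    (G.neighborSet u ∩ (S.erase v : Finset V)).ncard + 1 =
      (G.neighborSet u ∩ (S : Set V)).ncard := by
  rw [Finset.coe_erase, ← Set.inter_sdiff_assoc]
  exact Set.ncard_sdiff_singleton_add_one ⟨h, hv⟩

/-- Without `v`, the vertex `u` with `a` neighbours in `S` would need degree at most `2 (a - 1) + 1
< 2a`. -/
theorem IsLocallyMinimalDefensiveAlliance.of_marginal [DecidableEq V] (hS : IsDefensiveAlliance G S)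
    (h : ∀ v ∈ S, ∃ u ∈ S, G.Adj v u ∧ 2 * (G.neighborSet u ∩ S).ncard ≤ (G.neighborSet u).ncard) :
    IsLocallyMinimalDefensiveAlliance G S := by
  refine ⟨hS, fun v hv hv' => ?_⟩
  obtain ⟨u, hu, huv, hd⟩ := h v hv
  have h1 := (isDefensiveAlliance_iff.1 hv').2 u (Finset.mem_erase.2 ⟨huv.ne', hu⟩)
  have h2 := ncard_inter_erase hv huv.symm
  omega

/-- As `S.erase v` is nonempty, it fails at some vertex. That vertex was protected in `S`, so it
lost `v` as a neighbour and was marginal. -/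
theorem IsLocallyMinimalDefensiveAlliance.exists_marginal [DecidableEq V]
    (hS : IsLocallyMinimalDefensiveAlliance G S) (h2 : 2 ≤ S.card) {v : V} (hv : v ∈ S) :
    ∃ u ∈ S, G.Adj v u ∧ 2 * (G.neighborSet u ∩ S).ncard ≤ (G.neighborSet u).ncard := by
  have h := hS.2 v hv
  rw [isDefensiveAlliance_iff, not_and] at h
  have h := h (Finset.card_pos.1 (by rw [Finset.card_erase_of_mem hv]; omega))
  push Not at h
  obtain ⟨u, hu, hd⟩ := h
  have hu := (Finset.mem_erase.1 hu).2
  have hS' := (isDefensiveAlliance_iff.1 hS.1).2 u hu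
  by_cases huv : G.Adj u v
  · have := ncard_inter_erase hv huv
    exact ⟨u, hu, huv.symm, by omega⟩
  · rw [inter_erase huv] at hd
    omega

/-- The whole vertex set is a defensive alliance, and one of least cardinality is locally minimal.
-/
theorem exists_isLocallyMinimalDefensiveAlliance [Nonempty V] [DecidableEq V]
    (G : SimpleGraph V) : ∃ S, IsLocallyMinimalDefensiveAlliance G S := by
  cases nonempty_fintype V
  have hne : {S : Finset V | IsDefensiveAlliance G S}.Nonempty :=
    ⟨Finset.univ, Finset.univ_nonempty, fun v _ => by simp⟩
  obtain ⟨S, hS, h⟩ := WellFounded.has_min (measure Finset.card).wf _ hne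
  exact ⟨S, hS, fun v hv hv' => h _ hv' (Finset.card_erase_lt_of_mem hv)⟩

end Alliance

/-! ### From class functions to locally minimal alliances -/

section Correctness

variable {n N : ℕ} {G : SimpleGraph (Fin n)} {T : SimpleGraph (Fin N)} {r : Fin N}
  {X : Fin N → Finset (Fin n)}

theorem cnt_eq_ncard (n : ℕ) (P : ℕ → Prop) : cnt n P = {v : Fin n | P v}.ncard := by
  classical
  have h : cnt n P = ((Finset.range n).filter P).card := by
    rw [cnt, List.countP_eq_length_filter]
    simp only [Finset.card, Finset.filter, Finset.range, Multiset.range, Multiset.filter_coe,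
      Multiset.coe_card]
  rw [h, Set.ncard_eq_toFinset_card', ← Finset.card_map Fin.valEmbedding]
  congr 1
  ext v
  simp only [Finset.mem_filter, Finset.mem_range, Finset.mem_map, Set.mem_toFinset,
    Set.mem_ofPred_eq, Fin.valEmbedding_apply]
  exact ⟨fun ⟨h1, h2⟩ => ⟨⟨v, h1⟩, h2, rfl⟩, fun ⟨a, h1, h2⟩ => h2 ▸ ⟨a.2, h1⟩⟩

theorem deg_ofWord (v : Fin n) :
    (ofWord (inputWord G T r X)).deg v = (G.neighborSet v).ncard := by
  rw [deg, countP_range]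
  refine (cnt_eq_ncard n _).trans (congrArg _ (Set.ext fun u => ?_))
  simp [adj_ofWord]

theorem nb_ofWord (σ : ℕ → ℕ) (c : ℕ) (v : Fin n) :
    (ofWord (inputWord G T r X)).nb σ (fun _ => True) c v =
      (G.neighborSet v ∩ {u : Fin n | c ≤ σ u}).ncard := by
  refine (cnt_eq_ncard n _).trans (congrArg _ (Set.ext fun u => ?_))
  simp [adj_ofWord]

theorem good_ofWord (σ : ℕ → ℕ) (v : Fin n) : (ofWord (inputWord G T r X)).Good σ v ↔
    (1 ≤ σ v → (G.neighborSet v).ncard ≤ 2 * (G.neighborSet v ∩ {u : Fin n | 1 ≤ σ u}).ncard + 1 ∧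
      (∃ u : Fin n, G.Adj v u ∧ 2 ≤ σ u) ∧
      (2 ≤ σ v →
        2 * (G.neighborSet v ∩ {u : Fin n | 1 ≤ σ u}).ncard ≤ (G.neighborSet v).ncard)) := by
  have h : (∃ u : Fin n, G.Adj v u ∧ 2 ≤ σ u) ↔
      1 ≤ (G.neighborSet v ∩ {u : Fin n | 2 ≤ σ u}).ncard := by
    rw [Nat.succ_le_iff, Set.ncard_pos]
    rfl
  rw [Good, deg_ofWord, nb_ofWord, nb_ofWord, h]
  simp only [isGood, Bool.or_eq_true, Bool.and_eq_true, decide_eq_true_eq]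
  omega

theorem exists_alliance_of_good {σ : ℕ → ℕ}
    (hσ : ∀ v < n, (ofWord (inputWord G T r X)).Good σ v)
    (h1 : 1 ≤ (ofWord (inputWord G T r X)).size σ fun _ => True) :
    ∃ S, IsLocallyMinimalDefensiveAlliance G S ∧
      S.card = (ofWord (inputWord G T r X)).size σ fun _ => True := by
  classical
  set S : Finset (Fin n) := Finset.univ.filter fun v => 1 ≤ σ v with hS
  have hcoe : {u : Fin n | 1 ≤ σ u} = (S : Set (Fin n)) := by ext; simp [hS]
  have hmem : ∀ v, v ∈ S ↔ 1 ≤ σ v := by simp [hS]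
  have hcard : S.card = (ofWord (inputWord G T r X)).size σ fun _ => True := by
    refine Eq.trans ?_ (cnt_eq_ncard n _).symm
    simp only [true_and, hcoe, Set.ncard_coe_finset]
  have hσ' : ∀ v : Fin n, v ∈ S → _ :=
    fun v hv => (good_ofWord σ v).1 (hσ v v.2) ((hmem v).1 hv)
  simp only [hcoe] at hσ'
  refine ⟨S, .of_marginal (isDefensiveAlliance_iff.2 ⟨Finset.card_pos.1 (by omega),
    fun v hv => (hσ' v hv).1⟩) fun v hv => ?_, hcard⟩
  obtain ⟨u, huv, hu⟩ := (hσ' v hv).2.1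
  have huS : u ∈ S := (hmem u).2 (by omega)
  exact ⟨u, huS, huv, (hσ' u huS).2.2 hu⟩

theorem exists_good_of_alliance {S : Finset (Fin n)} (hS : IsLocallyMinimalDefensiveAlliance G S)
    (h2 : 2 ≤ S.card) : ∃ σ, (∀ v < n, (ofWord (inputWord G T r X)).Good σ v) ∧
      (ofWord (inputWord G T r X)).size σ (fun _ => True) = S.card := by
  classical
  let τ : Fin n → ℕ := fun v => if v ∈ S then
    if 2 * (G.neighborSet v ∩ S).ncard ≤ (G.neighborSet v).ncard then 2 else 1 else 0
  let σ : ℕ → ℕ := fun v => if h : v < n then τ ⟨v, h⟩ else 0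
  have hσ : ∀ v : Fin n, σ v = τ v := fun v => dif_pos v.2
  have hmem : ∀ v : Fin n, 1 ≤ σ v ↔ v ∈ S := by
    intro v
    rw [hσ]
    dsimp only [τ]
    split_ifs <;> simp_all
  have hmarg : ∀ v : Fin n, 2 ≤ σ v ↔
      v ∈ S ∧ 2 * (G.neighborSet v ∩ S).ncard ≤ (G.neighborSet v).ncard := by
    intro v
    rw [hσ]
    dsimp only [τ]
    split_ifs <;> simp_all
  have hcoe : {u : Fin n | 1 ≤ σ u} = (S : Set (Fin n)) := by ext; simp [hmem]
  refine ⟨σ, fun v hv => (good_ofWord σ ⟨v, hv⟩).2 fun hvS => ?_, ?_⟩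
  · rw [hcoe]
    have hvS := (hmem ⟨v, hv⟩).1 hvS
    refine ⟨(isDefensiveAlliance_iff.1 hS.1).2 _ hvS, ?_, fun h => ((hmarg _).1 h).2⟩
    obtain ⟨u, hu, huv, hd⟩ := hS.exists_marginal h2 hvS
    exact ⟨u, huv, (hmarg u).2 ⟨hu, hd⟩⟩
  · refine (cnt_eq_ncard n _).trans ?_
    simp only [true_and, hcoe, Set.ncard_coe_finset]

theorem isGreatest_answer (hn : 1 ≤ n) (hX : IsTreeDecomposition G T X) (hr : X r = ∅) :
    IsGreatest {a | ∃ S, IsLocallyMinimalDefensiveAlliance G S ∧ S.card = a}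
      (ofWord (inputWord G T r X)).answer := by
  obtain ⟨top, depth, hI⟩ := exists_valid_ofWord hX hr
  have hub : ∀ S, IsLocallyMinimalDefensiveAlliance G S →
      S.card ≤ (ofWord (inputWord G T r X)).answer := by
    intro S hS
    by_cases h2 : 2 ≤ S.card
    · exact hI.le_answer (exists_good_of_alliance hS h2)
    · have := one_le_answer (I := ofWord (inputWord G T r X))
      omega
  refine ⟨?_, ?_⟩
  -- The value `1` may come from the default in `answer`. Then any locally minimal alliance has size
  -- `1`, by the upper bound and nonemptiness.
  · by_cases h : (ofWord (inputWord G T r X)).answer = 1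
    · have : Nonempty (Fin n) := ⟨⟨0, hn⟩⟩
      obtain ⟨S, hS⟩ := exists_isLocallyMinimalDefensiveAlliance G
      have h1 := Finset.card_pos.2 hS.1.1
      have h2 := hub S hS
      exact ⟨S, hS, by omega⟩
    · obtain ⟨σ, hσ, hz⟩ := hI.answer_mem h
      have := one_le_answer (I := ofWord (inputWord G T r X))
      rw [← hz] at this ⊢
      exact exists_alliance_of_good hσ this
  · rintro a ⟨S, hS, rfl⟩
    exact hub S hS

end Correctness

/-! ## The running time -/

section RunningTime

variable {n N : ℕ} {G : SimpleGraph (Fin n)} {T : SimpleGraph (Fin N)} {r : Fin N}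
  {X : Fin N → Finset (Fin n)}

theorem length_sections {α : Type*} (L : List (List α)) :
    L.sections.length = (L.map List.length).prod := by
  induction L with
  | nil => rfl
  | cons l L ih => simp [List.sections, List.length_flatMap, ih, mul_comm]

theorem length_options (I : DecompData) (t v : ℕ) :
    (I.options t v).length = if I.bag t v then 3 * ((I.n + 1) * (I.n + 1)) else 1 := by
  rw [options]
  split
  · simp [List.length_flatMap]
    ring
  · simp

theorem length_sections_options_le (I : DecompData) (t : ℕ) {L : List (List Entry)}
    (hL : L <:+ (List.range I.n).map (I.options t)) :
    L.sections.length ≤ (3 * ((I.n + 1) * (I.n + 1))) ^ cnt I.n fun v => I.bag t v = true := by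
  have key : ∀ l : List ℕ, ((l.map (I.options t)).map List.length).prod =
      (3 * ((I.n + 1) * (I.n + 1))) ^ l.countP (I.bag t) := by
    intro l
    induction l with
    | nil => simp
    | cons v l ih =>
      simp only [List.map_cons, List.prod_cons, ih, length_options]
      cases h : I.bag t v <;> simp [h, pow_succ, mul_comm]
  obtain ⟨l, hl, rfl⟩ : ∃ l, l <:+ List.range I.n ∧ L = l.map (I.options t) := by
    rw [List.suffix_iff_eq_drop] at hL
    rw [hL, ← List.map_drop]
    exact ⟨_, List.drop_suffix _ _, rfl⟩
  rw [length_sections, key, ← countP_range]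
  exact Nat.pow_le_pow_right (by positivity) (hl.sublist.countP_le)

/-- For `n ≥ 2`, both `3` and `n + 1` are at most `n²`, and `m ≤ k + 1 ≤ 2 ^ (k + 1)`. For `n = 1`
powers of `n` are useless, but then `m ≤ 1` and the base is `12`. -/
theorem stateBound_le {n k m : ℕ} (hn : 1 ≤ n) (hk : m ≤ k + 1) (hm : m ≤ n) :
    (3 * ((n + 1) * (n + 1))) ^ m ≤ 12 * (n ^ 2 ^ (k + 1)) ^ 6 := by
  rcases Nat.lt_or_ge 1 n with h | h
  · have h1 : 3 * ((n + 1) * (n + 1)) ≤ n ^ 6 := by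
      have h3 : 3 ≤ n * n := by nlinarith
      have h4 : n + 1 ≤ n * n := by nlinarith
      calc 3 * ((n + 1) * (n + 1)) ≤ (n * n) * ((n * n) * (n * n)) :=
            Nat.mul_le_mul h3 (Nat.mul_le_mul h4 h4)
        _ = n ^ 6 := by ring
    calc (3 * ((n + 1) * (n + 1))) ^ m ≤ (n ^ 6) ^ m := Nat.pow_le_pow_left h1 m
      _ ≤ (n ^ 6) ^ 2 ^ (k + 1) := Nat.pow_le_pow_right (by positivity)
          (hk.trans Nat.lt_two_pow_self.le)
      _ = (n ^ 2 ^ (k + 1)) ^ 6 := by rw [← pow_mul, ← pow_mul, mul_comm]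
      _ ≤ _ := Nat.le_mul_of_pos_left _ (by norm_num)
  · obtain rfl : n = 1 := by omega
    simp only [one_pow, mul_one]
    calc _ ≤ (3 * ((1 + 1) * (1 + 1))) ^ 1 := Nat.pow_le_pow_right (by norm_num) hm
      _ = 12 := by norm_num

theorem statesBdd_inputWord {B k : ℕ} (hn : 1 ≤ n) (hk : bagWidth X ≤ k)
    (hB : 12 * (n ^ 2 ^ (k + 1)) ^ 6 + (3 + n * n + N * N + N * n) ≤ B) :
    StatesBdd B (inputWord G T r X) := by
  refine ⟨⟨by rw [length_inputWord]; omega, fun a ha => ?_⟩, fun t ht L hL => ?_⟩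
  · have hnn : n ≤ n * n := Nat.le_mul_self n
    have hNN : N ≤ N * N := Nat.le_mul_self N
    have hr := r.2
    change a ≤ B
    simp only [inputWord, List.mem_append, List.mem_cons, List.not_mem_nil, or_false] at ha
    rcases ha with (((rfl | rfl | rfl) | ha) | ha) | ha
    · omega
    · omega
    · omega
    all_goals
      have := mem_relationMatrix ha
      omega
  · change t < N at ht
    refine (length_sections_options_le _ t hL).trans ?_
    have hc : (cnt (ofWord (inputWord G T r X)).n fun v =>
        (ofWord (inputWord G T r X)).bag t v = true) = (X ⟨t, ht⟩).card := by
      refine (cnt_eq_ncard n _).trans ?_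
      rw [← Set.ncard_coe_finset]
      congr 1
      ext v
      simp [bag_ofWord, ht]
    rw [hc]
    have h1 : (X ⟨t, ht⟩).card ≤ k + 1 := by
      have := Finset.le_sup (f := fun t => (X t).card) (Finset.mem_univ (⟨t, ht⟩ : Fin N))
      rw [bagWidth] at hk
      omega
    have h2 : (X ⟨t, ht⟩).card ≤ n := by simpa using Finset.card_le_univ (X ⟨t, ht⟩)
    exact (stateBound_le hn h1 h2).trans (by omega)

theorem sizeBound_le {n N M c : ℕ} (hM : 1 ≤ M) (hn : n ≤ M) (hN : N ≤ c * n ^ c) :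
    12 * M ^ 6 + (3 + n * n + N * N + N * n) + 2 ≤
      (18 + c * c + 2 * c) * M ^ (18 + c * c + 2 * c) := by
  have hN' : N ≤ c * M ^ c := hN.trans (Nat.mul_le_mul_left _ (Nat.pow_le_pow_left hn c))
  -- The exponent exceeds `6`, `2 * c` and `c + 1`. The coefficients add up to `12 + 5 + 1 + c * c +
  -- c`.
  set E := M ^ (18 + c * c + 2 * c) with hE
  have hpow : ∀ i ≤ 18 + c * c + 2 * c, M ^ i ≤ E := fun i hi => Nat.pow_le_pow_right hM hi
  have h0 : 1 ≤ E := Nat.one_le_pow _ _ hM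
  have h1 : M ^ 6 ≤ E := hpow 6 (by omega)
  have h2 : n * n ≤ E := (Nat.mul_le_mul hn hn).trans (by rw [← pow_two]; exact hpow 2 (by omega))
  have h3 : N * N ≤ c * c * E := by
    refine (Nat.mul_le_mul hN' hN').trans ?_
    rw [show c * M ^ c * (c * M ^ c) = c * c * M ^ (2 * c) by ring]
    exact Nat.mul_le_mul_left _ (hpow _ (by omega))
  have h4 : N * n ≤ c * E := by
    refine (Nat.mul_le_mul hN' hn).trans ?_
    rw [show c * M ^ c * M = c * M ^ (c + 1) by ring]
    exact Nat.mul_le_mul_left _ (hpow _ (by nlinarith))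
  nlinarith

end RunningTime

theorem mainTheorem4 :
    ∃ P : RAM.Program, ∀ c : ℕ, ∃ C : ℕ,
      ∀ (n N k : ℕ) (G : SimpleGraph (Fin n)) (T : SimpleGraph (Fin N)) (r : Fin N)
        (X : Fin N → Finset (Fin n)),
        1 ≤ n → N ≤ c * n ^ c →
        IsNiceTreeDecomposition G T r X → bagWidth X ≤ k →
        ∃ t m : ℕ, RAM.Outputs P (inputWord G T r X) t m ∧
          t ≤ C * 8 ^ k * n ^ (C * 2 ^ (k + 1)) ∧
          IsGreatest {a | ∃ S, IsLocallyMinimalDefensiveAlliance G S ∧ S.card = a} m := by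
  obtain ⟨P, q, ⟨E, hq⟩, hP⟩ := RAM.exists_program polyOn_answer fun _ _ h => h.1
  refine ⟨P, fun c => ?_⟩
  obtain ⟨A, hA⟩ : ∃ A, A = 18 + c * c + 2 * c := ⟨_, rfl⟩
  -- From `(A * M ^ A) ^ E` with `M = n ^ 2 ^ (k + 1)`, the first summand covers the constant factor
  -- and the second the exponent; of `8 ^ k` only `1 ≤ 8 ^ k` is needed.
  refine ⟨A ^ E + A * E, fun n N k G T r X hn hN hX hk => ?_⟩
  obtain ⟨M, hM⟩ : ∃ M, M = n ^ 2 ^ (k + 1) := ⟨_, rfl⟩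
  have hM1 : 1 ≤ M := hM ▸ Nat.one_le_pow _ _ hn
  have hnM : n ≤ M := hM ▸ Nat.le_self_pow (by positivity) n
  obtain ⟨t, ht, hout⟩ := hP _ (inputWord G T r X) n N rfl rfl length_inputWord
    (statesBdd_inputWord hn hk le_rfl)
  refine ⟨t, _, hout, ?_, isGreatest_answer hn hX.toIsTreeDecomposition hX.root_bag⟩
  have hsize := sizeBound_le hM1 hnM hN
  rw [← hM] at ht
  rw [← hA] at hsize
  calc t ≤ _ := ht.trans (hq _)
    _ ≤ (A * M ^ A) ^ E := Nat.pow_le_pow_left hsize E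
    _ = A ^ E * 1 * n ^ (A * E * 2 ^ (k + 1)) := by
      rw [mul_pow, ← pow_mul, hM, ← pow_mul, mul_comm (2 ^ (k + 1)), mul_one]
    _ ≤ _ := Nat.mul_le_mul
      (Nat.mul_le_mul (Nat.le_add_right _ _) (Nat.one_le_pow _ _ (by norm_num)))
      (Nat.pow_le_pow_right hn (Nat.mul_le_mul_right _ (Nat.le_add_left _ _)))
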